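/- Let $d,r\in\mathbb{N}=\{1,2,\dots\}$, let $a<b$ be real numbers and let $\mathbb{K}\in\{\mathbb{R},\mathbb{C}\}$. Let $H^r_{\rm mix}([a,b]^d)$ be the Hilbert space of all $f\in L^2([a,b]^d)$ ($\mathbb K$-valued) whose weak derivatives $D^\alpha f$ exist in $L^2([a,b]^d)$ for all $\alpha\in\{0,\dots,r\}^d$, with the scalar product $$\langle f,g\rangle_r=\sum_{\alpha\in\{0,\dots,r\}^d}\int_{[a,b]^d}D^\alpha f(\mathbf x)\,\overline{D^\alpha g(\mathbf x)}\,d\mathbf x,$$ and let $H^r_{\rm mix}(\mathbb{T}^d)$ be its subspace of periodic functions, that is, of those $f$ whose derivatives $D^\alpha f$, $\alpha\in\{0,\dots,r\}^d$, are also weak derivatives of $f$ on the torus $\mathbb{T}^d$ obtained from $[a,b]^d$ by identifying opposite faces. Let $F_d^r$ and $\widetilde F_d^r$ be the unit balls of these two spaces (with the same norm). For $F\in\{F_d^r,\widetilde F_d^r\}$, a deterministic algorithm $A:F\to L^2([a,b]^d)$ takes, for each input $f\in F$, a finite number $n(f)\ge 1$ of measurements $y_1,y_2,\dots,y_{n(f)}\in\mathbb{K}$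 and outputs $A(f)=\phi(y_1,\dots,y_{n(f)})$ for an arbitrary mapping $\phi$. Each $y_i$ is the value at $f$ of a continuous linear functional on the Hilbert space, which may be chosen depending on $y_1,\dots,y_{i-1}$; also the decision to stop may depend on the values computed so far. The cost of $A$ is the smallest possible value of $\sup_{f\in F}n(f)$ over all such representations of $A$, and its worst case error is $\sup_{f\in F}\|f-A(f)\|_{L^2([a,b]^d)}$. Let $e(n,\mathcal{P}_d^r)$ and $e(n,\widetilde{\mathcal{P}}_d^r)$ be the infimum of the worst case errors of all algorithms with cost at most $n$ in the case $F=F_d^r$ (nonperiodic problem) and $F=\widetilde F_d^r$ (periodic problem), respectively. Then, as $n\to\infty$, $$e(n,\mathcal{P}_d^r)\;\sim\;\left(\frac{(b-a)^d}{\pi^d\,(d-1)!}\right)^{r} n^{-r}(\ln n)^{r(d-1)},$$ where $x_n\sim y_n$ means $\lim_{n\to\infty}x_n/y_n=1$. In particular, the $n$-th minimal errors of the nonperiodic and of the periodic problem are strongly equivalent: $e(n,\mathcal{P}_d^r)\sim e(n,\widetilde{\mathcal{P}}_d^r)$. -/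

import Mathlib

open scoped ContDiff ENNReal

noncomputable section

namespace IBC

universe u v w

/-! ## Problems, information, algorithms -/

/-- A problem: a set of algorithms (methods), each with an error and a cost. -/
structure Problem where
  Alg : Type u
  err : Alg → ℝ≥0∞
  cost : Alg → ℕ∞

/-- The `n`-th minimal error `e(n, P) = inf {err A | cost A ≤ n}`. -/
def Problem.minimalError (P : Problem.{u}) (n : ℕ) : ℝ≥0∞ :=
  ⨅ (A : P.Alg) (_ : P.cost A ≤ (n : ℕ∞)), P.err A

/-- The first `n` pieces of information `[y₁, …, yₙ]` about the input `f`, where the measurement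
`yₙ₊₁ = L [y₁, …, yₙ] f` may depend on the information collected before. -/
def answers {𝕂 : Type u} {F : Type v} (L : List 𝕂 → F → 𝕂) (f : F) : ℕ → List 𝕂
  | 0 => []
  | n + 1 => answers L f n ++ [L (answers L f n) f]

/-- A representation of an (adaptive) information mapping on `F` based on the class `Λ` of
admissible measurements. `halt y` says that the termination function vanishes at `y`. -/
structure Information {𝕂 : Type u} {F : Type v} (Λ : Set (F → 𝕂)) where
  measurement : List 𝕂 → F → 𝕂
  measurement_mem : ∀ y, measurement y ∈ Λ
  halt : List 𝕂 → Prop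
  terminates : ∀ f, ∃ n : ℕ, 1 ≤ n ∧ halt (answers measurement f n)

namespace Information

variable {𝕂 : Type u} {F : Type v} {Λ : Set (F → 𝕂)}

/-- The number `n(f)` of measurements taken for the input `f`. -/
def count (N : Information Λ) (f : F) : ℕ :=
  sInf {n : ℕ | 1 ≤ n ∧ N.halt (answers N.measurement f n)}

/-- The information `N(f) = (y₁, …, y_{n(f)})`. -/
def map (N : Information Λ) (f : F) : List 𝕂 :=
  answers N.measurement f (N.count f)

/-- The worst case cost `sup_f n(f)`. -/
def cost (N : Information Λ) : ℕ∞ :=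
  ⨆ f : F, (N.count f : ℕ∞)

end Information

/-- `(φ, N)` is a representation of the mapping `A : F → G` if `A = φ ∘ N`. -/
def Represents {𝕂 : Type u} {F : Type v} {G : Type w} {Λ : Set (F → 𝕂)}
    (φ : List 𝕂 → G) (N : Information Λ) (A : F → G) : Prop :=
  ∀ f, A f = φ (N.map f)

/-- The problem `P[S, F, G, Λ, det, wc]`: approximate `S : F → G` in the worst case setting by
deterministic (possibly adaptive and nonlinear) algorithms based on `Λ`. -/
def detWorstCase {𝕂 : Type u} {F : Type v} {G : Type w} [PseudoEMetricSpace G]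
    (S : F → G) (Λ : Set (F → 𝕂)) : Problem.{max v w} where
  Alg := {A : F → G // ∃ (φ : List 𝕂 → G) (N : Information Λ), Represents φ N A}
  err A := ⨆ f : F, edist (S f) (A.1 f)
  cost A := sInf {c : ℕ∞ | ∃ (φ : List 𝕂 → G) (N : Information Λ),
    Represents φ N A.1 ∧ c = N.cost}

/-- The class `Λ^all` of linear information on a subset `F` of a normed space `H`:
all restrictions to `F` of continuous linear functionals on `H`. -/
def linearInformation (𝕜 : Type u) [RCLike 𝕜] {H : Type v} [NormedAddCommGroup H]
    [NormedSpace 𝕜 H] (F : Set H) : Set (F → 𝕜) :=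
  {L | ∃ l : H →L[𝕜] 𝕜, ∀ f : F, L f = l (f : H)}

/-! ## Weak derivatives on the cube and on the torus -/

/-- The classical partial derivative `∂φ/∂xᵢ`. -/
def partialDeriv {d : ℕ} (i : Fin d) (φ : (Fin d → ℝ) → ℝ) : (Fin d → ℝ) → ℝ :=
  fun x => fderiv ℝ φ x (Pi.single i 1)

/-- The classical partial derivative `D^α φ = ∂₁^{α₁} ⋯ ∂_d^{α_d} φ`
(for smooth `φ`, the order of differentiation does not matter). -/
def multiDeriv {d : ℕ} (α : Fin d → ℕ) (φ : (Fin d → ℝ) → ℝ) : (Fin d → ℝ) → ℝ :=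
  (List.finRange d).foldr (fun i ψ => (partialDeriv i)^[α i] ψ) φ

/-- The cube `[a,b]^d`. -/
def cube (d : ℕ) (a b : ℝ) : Set (Fin d → ℝ) :=
  Set.Icc (fun _ => a) (fun _ => b)

/-- Lebesgue measure on the cube `[a,b]^d`. -/
abbrev cubeMeasure (d : ℕ) (a b : ℝ) : MeasureTheory.Measure (Fin d → ℝ) :=
  MeasureTheory.volume.restrict (cube d a b)

/-- The space `L²([a,b]^d)` of `𝕜`-valued functions. -/
abbrev L2Cube (𝕜 : Type u) [RCLike 𝕜] (d : ℕ) (a b : ℝ) : Type u :=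
  MeasureTheory.Lp 𝕜 2 (cubeMeasure d a b)

/-- Test functions on the open cube: smooth with compact support in `(a,b)^d`. -/
def cubeTests (d : ℕ) (a b : ℝ) : Set ((Fin d → ℝ) → ℝ) :=
  {φ | ContDiff ℝ ∞ φ ∧ HasCompactSupport φ ∧
    tsupport φ ⊆ Set.pi Set.univ (fun _ => Set.Ioo a b)}

/-- Test functions on the torus, represented by `[a,b]^d` with opposite faces identified:
smooth functions that are `(b-a)`-periodic in each variable. -/
def torusTests (d : ℕ) (a b : ℝ) : Set ((Fin d → ℝ) → ℝ) :=
  {φ | ContDiff ℝ ∞ φ ∧ ∀ (x : Fin d → ℝ) (i : Fin d), φ (x + Pi.single i (b - a)) = φ x}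

/-- `g` is the weak derivative `D^α f` with respect to the class `T` of test functions:
`∫ D^α φ · f = (-1)^{|α|} ∫ φ · g` for all `φ ∈ T`. -/
def IsWeakDeriv {𝕜 : Type u} [RCLike 𝕜] {d : ℕ} {a b : ℝ} (T : Set ((Fin d → ℝ) → ℝ))
    (α : Fin d → ℕ) (f g : L2Cube 𝕜 d a b) : Prop :=
  ∀ φ ∈ T, ∫ x, multiDeriv α φ x • f x ∂(cubeMeasure d a b)
    = (-1 : ℝ) ^ (∑ i, α i) • ∫ x, φ x • g x ∂(cubeMeasure d a b)

theorem contDiff_partialDeriv {d : ℕ} (i : Fin d) {φ : (Fin d → ℝ) → ℝ}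
    (hφ : ContDiff ℝ ∞ φ) : ContDiff ℝ ∞ (partialDeriv i φ) := by
  unfold partialDeriv
  exact (hφ.fderiv_right (m := ∞) (by simp)).clm_apply contDiff_const

theorem contDiff_multiDeriv {d : ℕ} (α : Fin d → ℕ) {φ : (Fin d → ℝ) → ℝ}
    (hφ : ContDiff ℝ ∞ φ) : ContDiff ℝ ∞ (multiDeriv α φ) := by
  have hit : ∀ (i : Fin d) (k : ℕ) (ψ : (Fin d → ℝ) → ℝ), ContDiff ℝ ∞ ψ →
      ContDiff ℝ ∞ ((partialDeriv i)^[k] ψ) := by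
    intro i k
    induction k with
    | zero => intro ψ hψ; simpa using hψ
    | succ k ih =>
      intro ψ hψ
      rw [Function.iterate_succ_apply]
      exact ih _ (contDiff_partialDeriv i hψ)
  unfold multiDeriv
  induction List.finRange d with
  | nil => simp [hφ]
  | cons i l ih => simpa using hit i (α i) _ ih

theorem integrable_smul {𝕜 : Type u} [RCLike 𝕜] {d : ℕ} {a b : ℝ} {ψ : (Fin d → ℝ) → ℝ}
    (hψ : Continuous ψ) (f : L2Cube 𝕜 d a b) :
    MeasureTheory.Integrable (fun x => ψ x • f x) (cubeMeasure d a b) := by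
  have hcomp : IsCompact (cube d a b) := isCompact_Icc
  have : MeasureTheory.IsFiniteMeasure (cubeMeasure d a b) :=
    ⟨by simpa using hcomp.measure_lt_top⟩
  have hf : MeasureTheory.Integrable (fun x => f x) (cubeMeasure d a b) :=
    (MeasureTheory.Lp.memLp f).integrable (by norm_num)
  obtain ⟨C, hC⟩ := hcomp.exists_bound_of_continuousOn hψ.continuousOn
  refine hf.bdd_smul C hψ.aestronglyMeasurable ?_
  exact (MeasureTheory.ae_restrict_mem isClosed_Icc.measurableSet).mono fun x hx => hC x hx

theorem IsWeakDeriv.add {𝕜 : Type u} [RCLike 𝕜] {d : ℕ} {a b : ℝ} {T : Set ((Fin d → ℝ) → ℝ)}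
    (hT : ∀ φ ∈ T, ContDiff ℝ ∞ φ) {α : Fin d → ℕ} {f₁ g₁ f₂ g₂ : L2Cube 𝕜 d a b}
    (h₁ : IsWeakDeriv T α f₁ g₁) (h₂ : IsWeakDeriv T α f₂ g₂) :
    IsWeakDeriv T α (f₁ + f₂) (g₁ + g₂) := by
  have key : ∀ (ψ : (Fin d → ℝ) → ℝ), Continuous ψ → ∀ p q : L2Cube 𝕜 d a b,
      ∫ x, ψ x • (p + q) x ∂(cubeMeasure d a b)
        = ∫ x, ψ x • p x ∂(cubeMeasure d a b) + ∫ x, ψ x • q x ∂(cubeMeasure d a b) := by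
    intro ψ hψ p q
    rw [← MeasureTheory.integral_add (integrable_smul hψ p) (integrable_smul hψ q)]
    refine MeasureTheory.integral_congr_ae ?_
    filter_upwards [MeasureTheory.Lp.coeFn_add p q] with x hx
    rw [hx, Pi.add_apply, smul_add]
  intro φ hφ
  rw [key _ (contDiff_multiDeriv α (hT φ hφ)).continuous, key _ (hT φ hφ).continuous,
    h₁ φ hφ, h₂ φ hφ, smul_add]

theorem IsWeakDeriv.smul {𝕜 : Type u} [RCLike 𝕜] {d : ℕ} {a b : ℝ} {T : Set ((Fin d → ℝ) → ℝ)}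
    {α : Fin d → ℕ} (c : 𝕜) {f g : L2Cube 𝕜 d a b}
    (h : IsWeakDeriv T α f g) : IsWeakDeriv T α (c • f) (c • g) := by
  have key : ∀ (ψ : (Fin d → ℝ) → ℝ) (p : L2Cube 𝕜 d a b),
      ∫ x, ψ x • (c • p) x ∂(cubeMeasure d a b)
        = c • ∫ x, ψ x • p x ∂(cubeMeasure d a b) := by
    intro ψ p
    rw [← MeasureTheory.integral_smul]
    refine MeasureTheory.integral_congr_ae ?_
    filter_upwards [MeasureTheory.Lp.coeFn_smul c p] with x hx
    rw [hx, Pi.smul_apply, smul_comm]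
  intro φ hφ
  rw [key, key, h φ hφ, smul_comm]

theorem IsWeakDeriv.zero {𝕜 : Type u} [RCLike 𝕜] {d : ℕ} {a b : ℝ} {T : Set ((Fin d → ℝ) → ℝ)}
    {α : Fin d → ℕ} : IsWeakDeriv T α (0 : L2Cube 𝕜 d a b) 0 := by
  have key : ∀ (ψ : (Fin d → ℝ) → ℝ),
      ∫ x, ψ x • (0 : L2Cube 𝕜 d a b) x ∂(cubeMeasure d a b) = 0 := by
    intro ψ
    rw [← MeasureTheory.integral_zero (Fin d → ℝ) 𝕜 (μ := cubeMeasure d a b)]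
    refine MeasureTheory.integral_congr_ae ?_
    filter_upwards [MeasureTheory.Lp.coeFn_zero 𝕜 2 (cubeMeasure d a b)] with x hx
    rw [hx, Pi.zero_apply, smul_zero]
  intro φ _
  rw [key, key, smul_zero]

/-! ## Sobolev spaces of mixed smoothness -/

/-- Families `(g_α)` of functions in `L²([a,b]^d)`, indexed by `α ∈ {0,…,r}^d`, with the scalar
product `∑_α ⟨g_α, h_α⟩`. -/
abbrev JetSpace (𝕜 : Type u) [RCLike 𝕜] (d r : ℕ) (a b : ℝ) : Type u :=
  PiLp 2 (fun _ : Fin d → Fin (r + 1) => L2Cube 𝕜 d a b)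

/-- The families `(D^α f)_{α ∈ {0,…,r}^d}` of weak derivatives with respect to the class `T`
of test functions. -/
def weakJets (𝕜 : Type u) [RCLike 𝕜] (d r : ℕ) (a b : ℝ) (T : Set ((Fin d → ℝ) → ℝ))
    (hT : ∀ φ ∈ T, ContDiff ℝ ∞ φ) : Submodule 𝕜 (JetSpace 𝕜 d r a b) where
  carrier := {g | ∀ α, IsWeakDeriv T (fun i => (α i : ℕ)) (g 0) (g α)}
  add_mem' := by
    intro f g h₁ h₂ α
    exact (h₁ α).add hT (h₂ α)
  zero_mem' := fun _ => IsWeakDeriv.zero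
  smul_mem' := by
    intro c f h α
    exact (h α).smul c

/-- The space `H^r_mix([a,b]^d)` of all `f ∈ L²([a,b]^d)` that have a weak derivative
`D^α f ∈ L²([a,b]^d)` for all `α ∈ {0,…,r}^d`, with the scalar product
`∑_{α ∈ {0,…,r}^d} ⟨D^α f, D^α g⟩_{L²}`. The function `f` is represented by the family of its
weak derivatives, see `mixedSobolev_coord_zero_injective` and `exists_mixedSobolev_iff`. -/
def mixedSobolev (𝕜 : Type u) [RCLike 𝕜] (d r : ℕ) (a b : ℝ) :
    Submodule 𝕜 (JetSpace 𝕜 d r a b) :=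
  weakJets 𝕜 d r a b (cubeTests d a b) (fun _ h => h.1)

/-- The subspace `H^r_mix(𝕋^d)` of periodic functions in `H^r_mix([a,b]^d)`: the weak
derivatives on the cube are also the weak derivatives on the torus. -/
def periodicMixedSobolev (𝕜 : Type u) [RCLike 𝕜] (d r : ℕ) (a b : ℝ) :
    Submodule 𝕜 (JetSpace 𝕜 d r a b) :=
  mixedSobolev 𝕜 d r a b ⊓ weakJets 𝕜 d r a b (torusTests d a b) (fun _ h => h.1)

/-- A function `f ∈ L²` is in `H^r_mix([a,b]^d)` iff all weak derivatives of order
`α ∈ {0,…,r}^d` exist in `L²`. -/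
theorem exists_mixedSobolev_iff {𝕜 : Type u} [RCLike 𝕜] {d r : ℕ} {a b : ℝ}
    (f : L2Cube 𝕜 d a b) :
    (∃ g ∈ mixedSobolev 𝕜 d r a b, g 0 = f) ↔
      ∀ α : Fin d → Fin (r + 1), ∃ g : L2Cube 𝕜 d a b,
        IsWeakDeriv (cubeTests d a b) (fun i => (α i : ℕ)) f g := by
  constructor
  · rintro ⟨g, hg, rfl⟩ α
    exact ⟨g α, hg α⟩
  · intro h
    choose G hG using h
    classical
    refine ⟨WithLp.toLp 2 (Function.update G 0 f), fun α => ?_, by simp⟩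
    by_cases hα : α = 0
    · subst hα
      intro φ _
      have : ∀ l : List (Fin d), l.foldr (fun _ ψ => ψ) φ = φ := by
        intro l; induction l with
        | nil => rfl
        | cons i l ih => simp [ih]
      simp [multiDeriv, this]
    · simpa [Function.update_of_ne hα] using hG α

/-- The scalar product of `H^r_mix([a,b]^d)`. -/
theorem inner_mixedSobolev {𝕜 : Type u} [RCLike 𝕜] {d r : ℕ} {a b : ℝ}
    (f g : mixedSobolev 𝕜 d r a b) :
    inner 𝕜 f g = ∑ α, inner 𝕜 ((f : JetSpace 𝕜 d r a b) α) ((g : JetSpace 𝕜 d r a b) α) := by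
  rw [Submodule.coe_inner, PiLp.inner_apply]

/-- A function determines its weak derivatives, so that `H^r_mix([a,b]^d)` is embedded
into `L²([a,b]^d)`. -/
theorem mixedSobolev_coord_zero_injective {𝕜 : Type u} [RCLike 𝕜] {d r : ℕ} {a b : ℝ} :
    Function.Injective
      (fun f : mixedSobolev 𝕜 d r a b => (f : JetSpace 𝕜 d r a b) 0) := by
  have main : ∀ f ∈ mixedSobolev 𝕜 d r a b, f 0 = 0 → f = 0 := by
    intro f hf h0
    ext1 α
    have hopen : IsOpen (Set.pi Set.univ (fun _ : Fin d => Set.Ioo a b)) :=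
      isOpen_set_pi Set.finite_univ fun _ _ => isOpen_Ioo
    have hint : MeasureTheory.Integrable (fun x => (f α) x) (cubeMeasure d a b) := by
      simpa using integrable_smul (ψ := fun _ => (1 : ℝ)) continuous_const (f α)
    have hae : ∀ᵐ x ∂(cubeMeasure d a b),
        x ∈ Set.pi Set.univ (fun _ : Fin d => Set.Ioo a b) → (f α) x = 0 := by
      refine hopen.ae_eq_zero_of_integral_contDiff_smul_eq_zero
        (hint.locallyIntegrable.locallyIntegrableOn _) ?_
      intro φ h₁ h₂ h₃
      have h := hf α φ ⟨h₁, h₂, h₃⟩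
      rw [h0, (IsWeakDeriv.zero (𝕜 := 𝕜) (a := a) (b := b) (T := cubeTests d a b)
        (α := fun i => (α i : ℕ))) φ ⟨h₁, h₂, h₃⟩] at h
      have hz : ∫ x, φ x • (0 : L2Cube 𝕜 d a b) x ∂(cubeMeasure d a b) = 0 := by
        rw [← MeasureTheory.integral_zero (Fin d → ℝ) 𝕜 (μ := cubeMeasure d a b)]
        refine MeasureTheory.integral_congr_ae ?_
        filter_upwards [MeasureTheory.Lp.coeFn_zero 𝕜 2 (cubeMeasure d a b)] with x hx
        rw [hx, Pi.zero_apply, smul_zero]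
      rw [hz, smul_zero] at h
      exact (smul_eq_zero.mp h.symm).resolve_left (pow_ne_zero _ (by norm_num))
    have hmem : ∀ᵐ x ∂(cubeMeasure d a b),
        x ∈ Set.pi Set.univ (fun _ : Fin d => Set.Ioo a b) := by
      have : MeasureTheory.volume.restrict (Set.pi Set.univ (fun _ : Fin d => Set.Ioo a b))
          = cubeMeasure d a b :=
        MeasureTheory.Measure.restrict_congr_set
          (MeasureTheory.Measure.univ_pi_Ioo_ae_eq_Icc (μ := fun _ : Fin d => MeasureTheory.volume)
            (f := fun _ => a) (g := fun _ => b))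
      rw [← this]
      exact MeasureTheory.ae_restrict_mem hopen.measurableSet
    refine MeasureTheory.Lp.ext ?_
    filter_upwards [hae, hmem, MeasureTheory.Lp.coeFn_zero 𝕜 2 (cubeMeasure d a b)]
      with x hx hx' hx0
    rw [hx hx']
    exact hx0.symm
  intro f g hfg
  have := main _ (f - g).2 (by simpa [sub_eq_zero] using hfg)
  exact sub_eq_zero.mp (Subtype.ext this)

/-! ## The approximation problems -/

/-- Given a space `V` of functions `f` represented by families of derivatives, the problem
`P[APP, F, L², Λ^all, det, wc]` of approximating the embedding `f ↦ f` into `L²([a,b]^d)`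
on the unit ball `F` of `V`. -/
def L2Approximation {𝕜 : Type u} [RCLike 𝕜] {d r : ℕ} {a b : ℝ}
    (V : Submodule 𝕜 (JetSpace 𝕜 d r a b)) : Problem.{u} :=
  detWorstCase
    (fun f : Metric.closedBall (0 : V) 1 => ((f : V) : JetSpace 𝕜 d r a b) 0)
    (linearInformation 𝕜 (Metric.closedBall (0 : V) 1))

end IBC

end

noncomputable section

namespace IBC

universe u v w

/-! ## Diagonal operators between Hilbert spaces -/

section Hilbert

variable {𝕜 : Type u} [RCLike 𝕜] {X : Type w} {Y : Type v} [NormedAddCommGroup X] [InnerProductSpace 𝕜 X]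
  [NormedAddCommGroup Y] [InnerProductSpace 𝕜 Y]

/-! The minimal errors of the embedding of a Hilbert space into `L²` are governed by its singular
values, and the singular values of a tensor product operator are products of univariate ones. The
theorem therefore reduces to counting how many products of univariate singular values exceed a
threshold. The univariate singular values need not be known exactly. It suffices that the number of
inverse singular values `≤ v ^ r` is `(b - a) / π * v + O(1)`, and that periodic and nonperiodic
functions share this leading term.

Upper bound (`exists_minimalError_le`): in dimension one, `r` linear conditions make the derivatives
of orders `1, …, r` mean-free, so that integration by parts against trigonometric functions leaves
no boundary terms. Together with `2 M + 1` vanishing Fourier coefficients this bounds the embedding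
on a subspace of codimension at most `r + 2 M + 1` (`exists_functionals`). Hence the nonperiodic
singular values obey the periodic count up to the additive constant `r`. Truncating the tensor
product of the univariate singular systems is a linear algorithm. Its error estimate uses only the
identity `inner_jetTens_eq` and Bessel's inequality; the mixed space is never identified with a
tensor product of univariate spaces.

Lower bound (`le_minimalError_of_periodic`): products of sines and cosines belong to the periodic
space and are orthogonal in both norms. More than `n` of them span an element annihilated by all
measurements along the branch of zero answers. That element and its negative get the same output
(`le_minimalError`), so neither adaption nor nonlinearity helps.

Counting: if the univariate count is `A v + O(1)`, induction on the dimension by Abel summation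
gives `A ^ d / (d - 1)! * s * (ln s) ^ (d - 1)` plus lower order terms (`prodCount_le`,
`le_prodCount`). Inverting this with `s ≈ κ n / (ln n) ^ (d - 1)` yields the asymptotics
(`isEquivalent_of_counting`). Everything applies to any space between the periodic and the
nonperiodic one, which also gives the strong equivalence. -/

theorem hasSum_norm_sq_inner {ι : Type*} (e : HilbertBasis ι 𝕜 Y) (g : Y) :
    HasSum (fun m => ‖inner 𝕜 (e m) g‖ ^ 2) (‖g‖ ^ 2) := by
  have h := RCLike.hasSum_re 𝕜 (e.hasSum_inner_mul_inner g g)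
  rw [inner_self_eq_norm_sq] at h
  convert h using 2 with m
  rw [← inner_conj_symm g (e m), RCLike.conj_mul]
  norm_cast

/-- The error of a truncated orthogonal expansion in `Y`, if the expansion is compatible with
an orthonormal family in `X`. -/
theorem norm_sub_sum_inner_le {ι : Type*} (e : HilbertBasis ι 𝕜 Y) {h : ι → X}
    (hh : Orthonormal 𝕜 h) {w : ι → ℝ} {f : X} {g : Y}
    (hfg : ∀ m, inner 𝕜 (h m) f = (w m : 𝕜) * inner 𝕜 (e m) g) (S : Finset ι) {t : ℝ}
    (ht : 0 < t) (hS : ∀ m ∉ S, t ≤ w m) :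
    ‖g - ∑ m ∈ S, inner 𝕜 (e m) g • e m‖ ≤ ‖f‖ / t := by
  classical
  set R := g - ∑ m ∈ S, inner 𝕜 (e m) g • e m with hR
  have hin : ∀ m, inner 𝕜 (e m) R = if m ∈ S then 0 else inner 𝕜 (e m) g := by
    intro m
    rw [hR, inner_sub_right, inner_sum]
    simp only [inner_smul_right, orthonormal_iff_ite.mp e.orthonormal]
    by_cases hm : m ∈ S <;> simp [hm]
  have h1 := hasSum_norm_sq_inner e R
  -- Outside `S` the coefficient of the remainder is `⟪h m, f⟫ / w m` with `w m ≥ t`. Parseval for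
  -- `e` and Bessel for `h`, which need not be complete, then give the bound.
  have h2 : ∀ m, ‖inner 𝕜 (e m) R‖ ^ 2 ≤ (1 / t ^ 2) * ‖inner 𝕜 (h m) f‖ ^ 2 := by
    intro m
    rw [hin]
    split_ifs with hm
    · rw [norm_zero, zero_pow two_ne_zero]; positivity
    · have hw := hS m hm
      rw [hfg, norm_mul, RCLike.norm_ofReal, abs_of_pos (ht.trans_le hw), mul_pow, ← mul_assoc]
      refine le_mul_of_one_le_left (by positivity) ?_
      rw [one_div_mul_eq_div, one_le_div (by positivity)]
      gcongr
  have h3 : ‖R‖ ^ 2 ≤ (1 / t ^ 2) * ‖f‖ ^ 2 := by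
    rw [← h1.tsum_eq]
    refine (h1.summable.tsum_le_tsum h2 ((hh.inner_products_summable (x := f)).mul_left _)).trans ?_
    rw [tsum_mul_left]
    gcongr
    exact hh.tsum_inner_products_le f
  refine le_of_sq_le_sq ?_ (by positivity)
  rw [div_pow]
  calc ‖R‖ ^ 2 ≤ _ := h3
    _ = _ := by ring

/-- A nonzero linear combination of more than `n` vectors annihilated by `n` functionals. -/
theorem exists_sum_smul_apply_eq_zero {ι : Type*} (S : Finset ι) {n : ℕ} (hn : n < S.card)
    (v : ι → X) (L : X →ₗ[𝕜] (Fin n → 𝕜)) :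
    ∃ c : ι → 𝕜, (∃ i ∈ S, c i ≠ 0) ∧ L (∑ i ∈ S, c i • v i) = 0 := by
  have : ¬ LinearIndependent 𝕜 (fun i : S => L (v i)) := by
    intro hli
    have := hli.fintype_card_le_finrank
    simp at this
    omega
  rw [Fintype.not_linearIndependent_iff] at this
  obtain ⟨g, hg, i, hi⟩ := this
  classical
  refine ⟨fun i => if h : i ∈ S then g ⟨i, h⟩ else 0, ⟨i, i.2, by simpa using hi⟩, ?_⟩
  rw [map_sum, ← hg, ← Finset.sum_coe_sort]
  simp

theorem norm_sq_sum_smul_of_orthogonal {ι : Type*} {v : ι → X} {S : Finset ι}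
    (hv : ∀ i ∈ S, ∀ j ∈ S, i ≠ j → inner 𝕜 (v i) (v j) = 0) (c : ι → 𝕜) :
    ‖∑ i ∈ S, c i • v i‖ ^ 2 = ∑ i ∈ S, ‖c i‖ ^ 2 * ‖v i‖ ^ 2 := by
  rw [← inner_self_eq_norm_sq (𝕜 := 𝕜), sum_inner, map_sum]
  refine Finset.sum_congr rfl fun i hi => ?_
  rw [inner_sum, Finset.sum_eq_single i]
  · rw [inner_self_eq_norm_sq, norm_smul, mul_pow]
  · intro j hj hji
    rw [inner_smul_left, inner_smul_right, hv i hi j hj hji.symm, mul_zero, mul_zero]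
  · exact fun h => absurd hi h

/-! ### Compactness and singular value decomposition from finite-codimensional bounds -/

variable [CompleteSpace X] [CompleteSpace Y]

/-- An operator that is small on subspaces of finite codimension is compact. -/
theorem isCompactOperator_of_finite_codim (S : X →L[𝕜] Y)
    (hS : ∀ t : ℝ, 0 < t → ∃ (n : ℕ) (L : X →L[𝕜] (Fin n → 𝕜)), ∀ f, L f = 0 → ‖S f‖ ≤ ‖f‖ / t) :
    IsCompactOperator S := by
  -- The approximant is `S` composed with the orthogonal projection onto `(ker L)ᗮ`. That space is
  -- finite-dimensional because `L` is injective on it, and the difference is `S` applied to the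
  -- component in `ker L`.
  have key : ∀ k : ℕ, ∃ T : X →L[𝕜] Y, IsCompactOperator T ∧ ‖S - T‖ ≤ 1 / ((k : ℝ) + 1) := by
    intro k
    obtain ⟨n, L, hL⟩ := hS (k + 1) (by positivity)
    have hcl : IsClosed (LinearMap.ker (L : X →ₗ[𝕜] (Fin n → 𝕜)) : Set X) := L.isClosed_ker
    have hc : CompleteSpace (LinearMap.ker (L : X →ₗ[𝕜] (Fin n → 𝕜))) := hcl.completeSpace_coe
    set K := (LinearMap.ker (L : X →ₗ[𝕜] (Fin n → 𝕜)))ᗮ with hK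
    have hfin : FiniteDimensional 𝕜 K := by
      refine FiniteDimensional.of_injective ((L : X →ₗ[𝕜] (Fin n → 𝕜)).comp K.subtype) ?_
      rw [← LinearMap.ker_eq_bot, LinearMap.ker_eq_bot']
      intro x hx
      have h1 : (x : X) ∈ LinearMap.ker (L : X →ₗ[𝕜] (Fin n → 𝕜)) := hx
      exact Subtype.ext (inner_self_eq_zero (𝕜 := 𝕜).mp (x.2 _ h1))
    have hcompact : IsCompactOperator K.subtypeL := by
      have hid : IsCompactOperator (id : K → K) :=
        (isCompactOperator_id_iff_finiteDimensional (𝕜 := 𝕜)).mpr hfin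
      exact hid.clm_comp K.subtypeL
    refine ⟨S ∘L (K.subtypeL ∘L K.orthogonalProjectionOnto),
      (hcompact.comp_clm K.orthogonalProjectionOnto).clm_comp S, ?_⟩
    refine ContinuousLinearMap.opNorm_le_bound _ (by positivity) fun x => ?_
    have hx : (S - S ∘L (K.subtypeL ∘L K.orthogonalProjectionOnto)) x
        = S (x - K.orthogonalProjectionOnto x) := by
      simp
    rw [hx]
    have hmem : x - K.orthogonalProjectionOnto x ∈ LinearMap.ker (L : X →ₗ[𝕜] (Fin n → 𝕜)) := by
      have hKK : Kᗮ = LinearMap.ker (L : X →ₗ[𝕜] (Fin n → 𝕜)) := by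
        rw [hK, Submodule.orthogonal_orthogonal]
      exact hKK.le (K.sub_starProjection_mem_orthogonal x)
    refine (hL _ hmem).trans ?_
    rw [div_eq_inv_mul, one_div]
    gcongr
    have h1 : x - K.orthogonalProjectionOnto x = Kᗮ.starProjection x := by
      rw [Submodule.starProjection_orthogonal_val]; rfl
    rw [h1]
    exact Submodule.norm_starProjection_apply_le _ x
  choose T hT hTS using key
  refine isCompactOperator_of_tendsto (l := Filter.atTop) (F := T) ?_ (Filter.Eventually.of_forall hT)
  rw [tendsto_iff_norm_sub_tendsto_zero]
  refine squeeze_zero (fun _ => norm_nonneg _) (fun k => ?_)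
    tendsto_one_div_add_atTop_nhds_zero_nat
  rw [norm_sub_rev]
  exact hTS k

/-- A compact self-adjoint operator has an orthonormal basis of eigenvectors. -/
theorem exists_hilbertBasis_eigenvectors {T : Y →L[𝕜] Y} (hT : IsCompactOperator T)
    (hT' : T.IsSymmetric) :
    ∃ (I : Type (max u v)) (e : HilbertBasis I 𝕜 Y) (μ : I → 𝕜), ∀ i, T (e i) = μ i • e i := by
  have hclosed : ∀ μ : 𝕜, CompleteSpace (Module.End.eigenspace (T : Module.End 𝕜 Y) μ) := by
    intro μ
    have : IsClosed (Module.End.eigenspace (T : Module.End 𝕜 Y) μ : Set Y) := by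
      have : (Module.End.eigenspace (T : Module.End 𝕜 Y) μ : Set Y) = {x | T x = μ • x} := by
        ext x; simp
      rw [this]
      exact isClosed_eq T.continuous (continuous_const_smul μ)
    exact this.completeSpace_coe
  -- All eigenvalues are admitted, including zero, so the union of the bases is complete by the
  -- spectral theorem.
  choose s b hb using fun μ : 𝕜 =>
    exists_hilbertBasis 𝕜 (Module.End.eigenspace (T : Module.End 𝕜 Y) μ)
  have hon := hT'.orthogonalFamily_eigenspaces.orthonormal_sigma_orthonormal
    (v_family := fun μ => b μ) (fun μ => (b μ).orthonormal)
  refine ⟨_, HilbertBasis.mkOfOrthogonalEqBot hon ?_, fun p => Sigma.fst p, ?_⟩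
  · rw [eq_bot_iff, ← ContinuousLinearMap.orthogonalComplement_iSup_eigenspaces_eq_bot hT hT']
    intro x hx
    rw [Submodule.mem_orthogonal] at hx ⊢
    intro y hy
    induction hy using Submodule.iSup_induction' with
    | mem μ y hy =>
      -- Orthogonality to `x` passes from the basis of an eigenspace to its span and, by closedness,
      -- to the whole eigenspace.
      have hd := (b μ).dense_span
      have hclosed' : IsClosed {z : Module.End.eigenspace (T : Module.End 𝕜 Y) μ |
          inner 𝕜 (z : Y) x = 0} :=
        isClosed_eq (by fun_prop) continuous_const
      have hsub : (Submodule.span 𝕜 (Set.range (b μ)) : Set _) ⊆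
          {z : Module.End.eigenspace (T : Module.End 𝕜 Y) μ | inner 𝕜 (z : Y) x = 0} := by
        intro z hz
        induction hz using Submodule.span_induction with
        | mem z hz =>
          obtain ⟨i, rfl⟩ := hz
          exact hx _ (Submodule.subset_span ⟨⟨μ, i⟩, rfl⟩)
        | zero => simp
        | add p q _ _ hp hq =>
          simp only [Set.mem_ofPred_eq] at hp hq ⊢
          rw [Submodule.coe_add, inner_add_left, hp, hq, add_zero]
        | smul c p _ hp =>
          simp only [Set.mem_ofPred_eq] at hp ⊢
          rw [Submodule.coe_smul, inner_smul_left, hp, mul_zero]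
      have : (⟨y, hy⟩ : Module.End.eigenspace (T : Module.End 𝕜 Y) μ) ∈
          closure (Submodule.span 𝕜 (Set.range (b μ)) : Set _) := by
        rw [← Submodule.topologicalClosure_coe, hd]; trivial
      exact closure_minimal hsub hclosed' this
    | zero => simp
    | add p q _ _ hp hq => rw [inner_add_left, hp, hq, add_zero]
  · rintro ⟨μ, i⟩
    rw [HilbertBasis.coe_mkOfOrthogonalEqBot]
    exact Module.End.mem_eigenspace_iff.mp (b μ i).2

/-- Singular value decomposition of an injective-adjoint operator that is small on subspaces of
finite codimension. -/
theorem exists_singular_system (S : X →L[𝕜] Y) (hdense : ∀ y, (∀ x, inner 𝕜 (S x) y = 0) → y = 0)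
    (hS : ∀ t : ℝ, 0 < t → ∃ (n : ℕ) (L : X →L[𝕜] (Fin n → 𝕜)), ∀ f, L f = 0 → ‖S f‖ ≤ ‖f‖ / t) :
    ∃ (I : Type (max u v)) (e : HilbertBasis I 𝕜 Y) (h : I → X) (w : I → ℝ), Orthonormal 𝕜 h ∧
      (∀ i, 0 < w i) ∧ (∀ i, S (h i) = ((w i)⁻¹ : 𝕜) • e i) ∧
      ∀ i f, inner 𝕜 (h i) f = (w i : 𝕜) * inner 𝕜 (e i) (S f) := by
  -- The basis `e` consists of eigenvectors of `S S*`. Since `hdense` makes the adjoint injective,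
  -- zero is not an eigenvalue and every `e i` has a positive singular value.
  have hc : IsCompactOperator (S ∘L ContinuousLinearMap.adjoint S) :=
    (isCompactOperator_of_finite_codim S hS).comp_clm _
  have hsym : (S ∘L ContinuousLinearMap.adjoint S).IsSymmetric := by
    intro x y
    change inner 𝕜 (S (ContinuousLinearMap.adjoint S x)) y
      = inner 𝕜 x (S (ContinuousLinearMap.adjoint S y))
    rw [← ContinuousLinearMap.adjoint_inner_right, ContinuousLinearMap.adjoint_inner_left]
  obtain ⟨I, e, μ, he⟩ := exists_hilbertBasis_eigenvectors hc hsym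
  set A := ContinuousLinearMap.adjoint S with hA
  have hne : ∀ i, A (e i) ≠ 0 := by
    intro i hi
    have := hdense (e i) fun x => by
      rw [← ContinuousLinearMap.adjoint_inner_right, ← hA, hi, inner_zero_right]
    exact e.orthonormal.ne_zero i this
  have hinner : ∀ i j, inner 𝕜 (A (e i)) (A (e j)) = μ j * inner 𝕜 (e i) (e j) := by
    intro i j
    rw [hA, ContinuousLinearMap.adjoint_inner_left]
    have := he j
    simp only [ContinuousLinearMap.comp_apply] at this
    rw [← hA, this, inner_smul_right]
  have hμ : ∀ i, μ i = ((‖A (e i)‖ ^ 2 : ℝ) : 𝕜) := by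
    intro i
    have := hinner i i
    rw [inner_self_eq_norm_sq_to_K, inner_self_eq_norm_sq_to_K, e.orthonormal.1 i] at this
    simp at this
    rw [← this]; push_cast; rfl
  have hpos : ∀ i, 0 < ‖A (e i)‖ := fun i => norm_pos_iff.mpr (hne i)
  -- The singular value is `‖S* e i‖`; its inverse is the weight, and `h i` is the normalized `S* e
  -- i`.
  refine ⟨I, e, fun i => ((‖A (e i)‖⁻¹ : ℝ) : 𝕜) • A (e i), fun i => ‖A (e i)‖⁻¹, ?_,
    fun i => inv_pos.mpr (hpos i), ?_, ?_⟩
  · constructor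
    · intro i
      rw [norm_smul, RCLike.norm_ofReal, abs_of_pos (inv_pos.mpr (hpos i)),
        inv_mul_cancel₀ (hpos i).ne']
    · intro i j hij
      rw [inner_smul_left, inner_smul_right, hinner, e.orthonormal.2 hij]
      simp
  · intro i
    have := he i
    simp only [ContinuousLinearMap.comp_apply] at this
    have h0 : ((‖A (e i)‖ : ℝ) : 𝕜) ≠ 0 := by exact_mod_cast (hpos i).ne'
    rw [map_smul, this, hμ, smul_smul]
    congr 1
    push_cast
    field_simp
  · intro i f
    rw [inner_smul_left, hA, ContinuousLinearMap.adjoint_inner_left]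
    simp

omit [CompleteSpace X] [CompleteSpace Y] in
/-- Comparison of singular numbers with an approximation by functionals. -/
theorem card_le_of_finite_codim {I : Type*} {S : X →L[𝕜] Y} {e : HilbertBasis I 𝕜 Y} {h : I → X}
    {w : I → ℝ} (hh : Orthonormal 𝕜 h) (hw : ∀ i, 0 < w i)
    (hSh : ∀ i, S (h i) = ((w i)⁻¹ : 𝕜) • e i) {t : ℝ} (ht : 0 < t) {n : ℕ}
    (L : X →L[𝕜] (Fin n → 𝕜)) (hL : ∀ f, L f = 0 → ‖S f‖ ≤ ‖f‖ / t) (F : Finset I)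
    (hF : ∀ i ∈ F, w i < t) : F.card ≤ n := by
  by_contra! hcard
  -- More than `n` of the `h i` have a nonzero combination in the kernel of `L`. On it `S` acts with
  -- factors `(w i)⁻¹ > t⁻¹`, contradicting `hL`.
  obtain ⟨c, ⟨i₀, hi₀, hci₀⟩, hc⟩ :=
    exists_sum_smul_apply_eq_zero F hcard h (L : X →ₗ[𝕜] (Fin n → 𝕜))
  have h1 := hL _ hc
  have h2 : ‖∑ i ∈ F, c i • h i‖ ^ 2 = ∑ i ∈ F, ‖c i‖ ^ 2 := by
    rw [norm_sq_sum_smul_of_orthogonal (fun i _ j _ hij => hh.2 hij)]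
    simp [hh.1]
  have h3 : ‖S (∑ i ∈ F, c i • h i)‖ ^ 2 = ∑ i ∈ F, ‖c i‖ ^ 2 * ((w i)⁻¹) ^ 2 := by
    rw [map_sum]
    simp only [map_smul, hSh, smul_smul]
    rw [norm_sq_sum_smul_of_orthogonal (fun i _ j _ hij => e.orthonormal.2 hij)]
    refine Finset.sum_congr rfl fun i _ => ?_
    rw [e.orthonormal.1 i, norm_mul, norm_inv, RCLike.norm_ofReal, abs_of_pos (hw i)]
    ring
  have h4 : ∑ i ∈ F, ‖c i‖ ^ 2 * (t⁻¹) ^ 2 < ∑ i ∈ F, ‖c i‖ ^ 2 * ((w i)⁻¹) ^ 2 := by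
    have hlt : ∀ i ∈ F, (t⁻¹) ^ 2 < ((w i)⁻¹) ^ 2 := fun i hi => by
      have := hF i hi
      have := hw i
      gcongr
    refine Finset.sum_lt_sum (fun i hi => ?_) ⟨i₀, hi₀, ?_⟩
    · exact mul_le_mul_of_nonneg_left (hlt i hi).le (by positivity)
    · exact mul_lt_mul_of_pos_left (hlt i₀ hi₀) (by positivity)
  rw [← h3, ← Finset.sum_mul, ← h2, ← mul_pow, ← div_eq_mul_inv] at h4
  exact absurd (lt_of_pow_lt_pow_left₀ 2 (norm_nonneg _) h4) (not_lt.mpr h1)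

end Hilbert

/-! ## Minimal errors of linear problems on the unit ball -/

theorem count_spec {𝕂 : Type u} {F : Type v} {Λ : Set (F → 𝕂)} (N : Information Λ) (f : F) :
    1 ≤ N.count f ∧ N.halt (answers N.measurement f (N.count f)) :=
  Nat.sInf_mem (N.terminates f)

/-- As long as all answers vanish, an adaptive method runs through one fixed sequence of
functionals. This removes adaption from the lower bound. -/
theorem answers_eq_replicate {𝕂 : Type u} [Zero 𝕂] {F : Type v} {L : List 𝕂 → F → 𝕂} {f : F}
    {n : ℕ} (h : ∀ i < n, L (List.replicate i 0) f = 0) {k : ℕ} (hk : k ≤ n) :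
    answers L f k = List.replicate k 0 := by
  induction k with
  | zero => rfl
  | succ k ih =>
    rw [answers, ih (by omega), h k (by omega), List.replicate_succ']

/-- Measurements that look only at the length of the list are nonadaptive information. -/
theorem answers_length_dependent {𝕂 : Type u} {F : Type v} (L : ℕ → F → 𝕂) (f : F) (n : ℕ) :
    answers (fun y : List 𝕂 => L y.length) f n = (List.range n).map fun i => L i f := by
  induction n with
  | zero => rfl
  | succ n ih => rw [answers, ih, List.range_succ]; simp

/-- The minimal error is at least `1 / t` if there are more than `n` orthogonal elements on which
the solution operator is bounded from below. -/
theorem le_minimalError {𝕜 : Type u} [RCLike 𝕜] {V : Type v} {G : Type w} [NormedAddCommGroup V]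
    [InnerProductSpace 𝕜 V] [NormedAddCommGroup G] [InnerProductSpace 𝕜 G] (S : V →ₗ[𝕜] G)
    {ι : Type*} {F : Finset ι} {n : ℕ} (hn : n < F.card) {v : ι → V}
    (hv : ∀ i ∈ F, ∀ j ∈ F, i ≠ j → inner 𝕜 (v i) (v j) = 0)
    (hSv : ∀ i ∈ F, ∀ j ∈ F, i ≠ j → inner 𝕜 (S (v i)) (S (v j)) = 0)
    (hv0 : ∀ i ∈ F, v i ≠ 0) {t : ℝ} (ht : 0 < t) (hle : ∀ i ∈ F, ‖v i‖ ≤ t * ‖S (v i)‖) :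
    ENNReal.ofReal (1 / t) ≤
      (detWorstCase (fun f : Metric.closedBall (0 : V) 1 => S f)
        (linearInformation 𝕜 (Metric.closedBall (0 : V) 1))).minimalError n := by
  refine le_iInf₂ fun A hA => ?_
  obtain ⟨φ, N, hrep, hc⟩ : (detWorstCase (fun f : Metric.closedBall (0 : V) 1 => S f)
      (linearInformation 𝕜 (Metric.closedBall (0 : V) 1))).cost A ∈
      {c : ℕ∞ | ∃ (φ : List 𝕜 → G) (N : Information
        (linearInformation 𝕜 (Metric.closedBall (0 : V) 1))),
        Represents φ N A.1 ∧ c = N.cost} := by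
    -- The cost is an infimum in the well-ordered `ℕ∞`, hence attained by some representation.
    refine csInf_mem ?_
    obtain ⟨φ, N, h⟩ := A.2
    exact ⟨_, φ, N, h, rfl⟩
  rw [hc] at hA
  -- These are the functionals asked along the branch of zero answers. More than `n` vectors have a
  -- nonzero combination annihilated by the first `n` of them.
  choose l hl using fun i : ℕ => N.measurement_mem (List.replicate i 0)
  obtain ⟨c, ⟨i₀, hi₀, hci₀⟩, hc0⟩ := exists_sum_smul_apply_eq_zero F hn v
    (LinearMap.pi fun i : Fin n => (l i : V →ₗ[𝕜] 𝕜))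
  set f := ∑ i ∈ F, c i • v i with hf
  have hlf : ∀ i < n, l i f = 0 := fun i hi => congrFun hc0 ⟨i, hi⟩
  have hnorm := norm_sq_sum_smul_of_orthogonal hv c
  have hnormS := norm_sq_sum_smul_of_orthogonal hSv c
  rw [← hf] at hnorm
  have hSf : ‖S f‖ ^ 2 = ∑ i ∈ F, ‖c i‖ ^ 2 * ‖S (v i)‖ ^ 2 := by
    rw [← hnormS, hf, map_sum]
    simp only [map_smul]
  have hfpos : 0 < ‖f‖ := by
    have : 0 < ‖f‖ ^ 2 := by
      rw [hnorm]
      refine Finset.sum_pos' (fun i _ => by positivity) ⟨i₀, hi₀, ?_⟩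
      have := norm_pos_iff.mpr (hv0 i₀ hi₀)
      positivity
    exact (sq_pos_iff.mp this).lt_of_le' (norm_nonneg f)
  have hfS : ‖f‖ ≤ t * ‖S f‖ := by
    refine le_of_sq_le_sq ?_ (by positivity)
    rw [mul_pow, hSf, hnorm, Finset.mul_sum]
    refine Finset.sum_le_sum fun i hi => ?_
    calc ‖c i‖ ^ 2 * ‖v i‖ ^ 2 ≤ ‖c i‖ ^ 2 * (t * ‖S (v i)‖) ^ 2 := by
          gcongr
          exact hle i hi
      _ = _ := by ring
  set g : V := ((‖f‖⁻¹ : ℝ) : 𝕜) • f with hg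
  have hgnorm : ‖g‖ = 1 := by
    rw [hg, norm_smul, RCLike.norm_ofReal, abs_of_pos (inv_pos.mpr hfpos), inv_mul_cancel₀ hfpos.ne']
  have hSg : 1 / t ≤ ‖S g‖ := by
    rw [hg, map_smul, norm_smul, RCLike.norm_ofReal, abs_of_pos (inv_pos.mpr hfpos),
      div_le_iff₀ ht, inv_mul_eq_div, div_mul_eq_mul_div, le_div_iff₀ hfpos, one_mul, mul_comm]
    exact hfS
  have hlg : ∀ i < n, l i g = 0 := fun i hi => by rw [hg, map_smul, hlf i hi, smul_zero]
  -- Both `g` and `-g` produce only zeros, so they stop at the same time with the same information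
  -- and receive the same output.
  let p : Metric.closedBall (0 : V) 1 := ⟨g, by simp [hgnorm]⟩
  let q : Metric.closedBall (0 : V) 1 := ⟨-g, by simp [hgnorm]⟩
  have hp : ∀ k ≤ n, answers N.measurement p k = List.replicate k 0 := fun k hk =>
    answers_eq_replicate (fun i hi => by rw [hl]; exact hlg i hi) hk
  have hq : ∀ k ≤ n, answers N.measurement q k = List.replicate k 0 := fun k hk =>
    answers_eq_replicate (fun i hi => by
      rw [hl]; change l i (-g) = 0; rw [map_neg, hlg i hi, neg_zero]) hk
  have hcn : ∀ x, N.count x ≤ n := fun x => by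
    exact_mod_cast (le_iSup (fun x => (N.count x : ℕ∞)) x).trans hA
  have hcount : N.count p = N.count q := by
    refine le_antisymm (Nat.sInf_le ⟨(count_spec N q).1, ?_⟩) (Nat.sInf_le ⟨(count_spec N p).1, ?_⟩)
    · rw [hp _ (hcn q), ← hq _ (hcn q)]; exact (count_spec N q).2
    · rw [hq _ (hcn p), ← hp _ (hcn p)]; exact (count_spec N p).2
  have hmap : A.1 p = A.1 q := by
    rw [hrep, hrep, Information.map, Information.map, hp _ (hcn p), hq _ (hcn q), hcount]
  set E := (detWorstCase (fun f : Metric.closedBall (0 : V) 1 => S f)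
      (linearInformation 𝕜 (Metric.closedBall (0 : V) 1))).err A with hE
  have h1 : edist (S g) (A.1 p) ≤ E := le_iSup
    (fun f : Metric.closedBall (0 : V) 1 => edist (S f) (A.1 f)) p
  have h2 : edist (S (-g)) (A.1 p) ≤ E := by
    rw [hmap]
    exact le_iSup (fun f : Metric.closedBall (0 : V) 1 => edist (S f) (A.1 f)) q
  -- The two solutions are at distance `2 ‖S g‖ ≥ 2 / t`, so a common output misses one of them by
  -- at least `1 / t`.
  have h3 : 2 * ENNReal.ofReal (1 / t) ≤ 2 * E := by
    calc 2 * ENNReal.ofReal (1 / t) ≤ 2 * ENNReal.ofReal ‖S g‖ := by gcongr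
      _ = edist (S g) (S (-g)) := by
        rw [map_neg, edist_dist, dist_eq_norm, sub_neg_eq_add, ← two_smul 𝕜, norm_smul,
          RCLike.norm_ofNat, ENNReal.ofReal_mul (by norm_num)]
        simp
      _ ≤ edist (S g) (A.1 p) + edist (S (-g)) (A.1 p) := edist_triangle_right _ _ _
      _ ≤ E + E := add_le_add h1 h2
      _ = 2 * E := (two_mul E).symm
  exact (ENNReal.mul_le_mul_iff_right (by norm_num) (by norm_num)).mp h3

/-- The minimal error is bounded by the error of a linear algorithm that uses `n` functionals. -/
theorem minimalError_le {𝕜 : Type u} [RCLike 𝕜] {V : Type v} {G : Type w} [NormedAddCommGroup V]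
    [NormedSpace 𝕜 V] [NormedAddCommGroup G] [NormedSpace 𝕜 G] (S : V → G)
    {ι : Type*} {F : Finset ι} {n : ℕ} (hn : F.card ≤ n) (hn1 : 1 ≤ n) (l : ι → V →L[𝕜] 𝕜)
    (g : ι → G) {τ : ℝ} (h : ∀ f, ‖f‖ ≤ 1 → ‖S f - ∑ m ∈ F, l m f • g m‖ ≤ τ) :
    (detWorstCase (fun f : Metric.closedBall (0 : V) 1 => S f)
        (linearInformation 𝕜 (Metric.closedBall (0 : V) 1))).minimalError n
      ≤ ENNReal.ofReal τ := by
  classical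
  -- Zero functionals pad the information to exactly `n` measurements, which keeps the count
  -- constant and at least one.
  let L : ℕ → V →L[𝕜] 𝕜 := fun i => if h : i < F.card then l (F.equivFin.symm ⟨i, h⟩) else 0
  let M : ℕ → Metric.closedBall (0 : V) 1 → 𝕜 := fun i f => L i f
  let N : Information (linearInformation 𝕜 (Metric.closedBall (0 : V) 1)) :=
    { measurement := fun y => M y.length
      measurement_mem := fun y => ⟨L y.length, fun _ => rfl⟩
      halt := fun y => y.length = n
      terminates := fun f => ⟨n, hn1, by rw [answers_length_dependent]; simp⟩ }
  have hcount : ∀ f, N.count f = n := by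
    intro f
    have := (count_spec N f).2
    change (answers (fun y : List 𝕜 => M y.length) f (N.count f)).length = n at this
    rwa [answers_length_dependent, List.length_map, List.length_range] at this
  -- The default value of `getD` never enters on actual information, because `F.card ≤ n` is at most
  -- its length.
  let φ : List 𝕜 → G := fun y => ∑ i : Fin F.card, y.getD i 0 • g (F.equivFin.symm i)
  have hφ : ∀ f, φ (N.map f) = ∑ m ∈ F, l m f • g m := by
    intro f
    have : N.map f = (List.range n).map fun i => M i f := by
      rw [Information.map, hcount]
      exact answers_length_dependent M f n
    rw [this, ← Finset.sum_coe_sort F, ← F.equivFin.symm.sum_comp]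
    refine Finset.sum_congr rfl fun i _ => ?_
    have hi : (i : ℕ) < n := i.2.trans_le hn
    simp [List.getD, hi, M, L]
  refine (iInf₂_le ⟨fun f => φ (N.map f), φ, N, fun _ => rfl⟩ ?_).trans ?_
  · refine sInf_le_of_le ⟨φ, N, fun _ => rfl, rfl⟩ ?_
    exact iSup_le fun f => by rw [hcount]
  · refine iSup_le fun f => ?_
    change edist (S f) (φ (N.map f)) ≤ _
    rw [hφ, edist_dist, dist_eq_norm]
    exact ENNReal.ofReal_le_ofReal (h f (mem_closedBall_zero_iff.mp f.2))

open Filter Topology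

/-! ## Counting lattice points in hyperbolic regions -/

/-- Abel summation for a differentiable function at finitely many points. -/
theorem sum_eq_card_mul_add_integral {I : Type*} (F : Finset I) {ν : I → ℝ} {s : ℝ}
    (hν : ∀ i ∈ F, 1 ≤ ν i ∧ ν i ≤ s) {G H : ℝ → ℝ}
    (hG : ∀ v ∈ Set.Icc 1 s, HasDerivAt G (-H v) v) (hH : ContinuousOn H (Set.Icc 1 s)) :
    IntervalIntegrable (fun v => ((F.filter (ν · ≤ v)).card : ℝ) * H v) MeasureTheory.volume 1 s ∧
    ∑ i ∈ F, G (ν i) = F.card * G s + ∫ v in (1 : ℝ)..s, ((F.filter (ν · ≤ v)).card : ℝ) * H v := by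
  have hite : ∀ v, ((F.filter (ν · ≤ v)).card : ℝ) * H v
      = ∑ i ∈ F, Set.indicator (Set.Ici (ν i)) H v := by
    intro v
    rw [Finset.card_filter, Nat.cast_sum, Finset.sum_mul]
    refine Finset.sum_congr rfl fun i _ => ?_
    by_cases h : ν i ≤ v <;> simp [h]
  simp only [hite]
  have hint : ∀ i ∈ F, IntervalIntegrable (Set.indicator (Set.Ici (ν i)) H)
      MeasureTheory.volume 1 s := by
    intro i hi
    have h1s : (1 : ℝ) ≤ s := (hν i hi).1.trans (hν i hi).2
    have := (hH.mono (Set.uIcc_of_le h1s).le).intervalIntegrable (μ := MeasureTheory.volume)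
    rw [intervalIntegrable_iff] at this ⊢
    exact this.indicator measurableSet_Ici
  refine ⟨by simpa only [Finset.sum_fn] using IntervalIntegrable.sum F hint, ?_⟩
  rw [intervalIntegral.integral_finsetSum hint, ← nsmul_eq_mul, ← Finset.sum_const,
    ← Finset.sum_add_distrib]
  refine Finset.sum_congr rfl fun i hi => ?_
  obtain ⟨h1, h2⟩ := hν i hi
  -- Each summand is `G (ν i) = G s + ∫ H` over `[ν i, s]`. Extending this integral to `[1, s]` by
  -- an indicator makes the indicators add up to the counting function.
  have hsplit : ∫ v in (1 : ℝ)..s, Set.indicator (Set.Ici (ν i)) H v = ∫ v in (ν i)..s, H v := by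
    rw [intervalIntegral.integral_of_le (h1.trans h2), intervalIntegral.integral_of_le h2,
      MeasureTheory.integral_indicator measurableSet_Ici,
      MeasureTheory.Measure.restrict_restrict measurableSet_Ici,
      ← MeasureTheory.integral_Icc_eq_integral_Ioc]
    have : (Set.Ici (ν i) ∩ Set.Ioc 1 s : Set ℝ) =ᵐ[MeasureTheory.volume] Set.Icc (ν i) s := by
      have h3 : (Set.Ici (ν i) ∩ Set.Icc 1 s : Set ℝ) = Set.Icc (ν i) s := by
        ext x
        simp only [Set.mem_inter_iff, Set.mem_Ici, Set.mem_Icc]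
        exact ⟨fun h => ⟨h.1, h.2.2⟩, fun h => ⟨h.1, h1.trans h.1, h.2⟩⟩
      rw [← h3]
      exact (MeasureTheory.ae_eq_refl _).inter MeasureTheory.Ioc_ae_eq_Icc
    rw [MeasureTheory.Measure.restrict_congr_set this]
  have hftc : ∫ v in (ν i)..s, -H v = G s - G (ν i) := by
    refine intervalIntegral.integral_eq_sub_of_hasDerivAt (fun v hv => ?_) ?_
    · rw [Set.uIcc_of_le h2] at hv
      exact hG v ⟨h1.trans hv.1, hv.2⟩
    · refine ContinuousOn.intervalIntegrable ?_
      rw [Set.uIcc_of_le h2]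
      exact (hH.mono (Set.Icc_subset_Icc_left h1)).neg
  rw [intervalIntegral.integral_neg] at hftc
  rw [hsplit]
  linarith

/-- Integration by parts with antiderivative `A * P v - (A * v + B) * G v`. It evaluates the
right-hand side of the Abel summation once the counting function is replaced by an affine bound. -/
theorem integral_affine_mul {s : ℝ} (hs : 1 ≤ s) {P G H : ℝ → ℝ}
    (hP : ∀ v ∈ Set.Icc 1 s, HasDerivAt P (G v) v)
    (hG : ∀ v ∈ Set.Icc 1 s, HasDerivAt G (-H v) v) (hH : ContinuousOn H (Set.Icc 1 s)) (A B : ℝ) :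
    (A * s + B) * G s + ∫ v in (1 : ℝ)..s, (A * v + B) * H v
      = (A + B) * G 1 + A * (P s - P 1) := by
  have : ∫ v in (1 : ℝ)..s, (A * v + B) * H v
      = (A * P s - (A * s + B) * G s) - (A * P 1 - (A * 1 + B) * G 1) := by
    refine intervalIntegral.integral_eq_sub_of_hasDerivAt
      (f := fun v => A * P v - (A * v + B) * G v) (fun v hv => ?_) ?_
    · rw [Set.uIcc_of_le hs] at hv
      have h1 : HasDerivAt (fun v => A * P v - (A * v + B) * G v) _ v :=
        ((hP v hv).const_mul A).sub ((((hasDerivAt_id v).const_mul A).add_const B).mul (hG v hv))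
      refine h1.congr_deriv ?_
      simp only [id]
      ring
    · refine ContinuousOn.intervalIntegrable ?_
      rw [Set.uIcc_of_le hs]
      exact ContinuousOn.mul (by fun_prop) hH
  rw [this]
  ring

/-- The function `s (ln s)^k`. -/
def mulLogPow (k : ℕ) (s : ℝ) : ℝ := s * Real.log s ^ k

theorem mulLogPow_nonneg (k : ℕ) {s : ℝ} (hs : 1 ≤ s) : 0 ≤ mulLogPow k s :=
  mul_nonneg (by linarith) (pow_nonneg (Real.log_nonneg hs) k)

theorem hasDerivAt_log_div {s v : ℝ} (hs : 0 < s) (hv : 0 < v) :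
    HasDerivAt (fun v => Real.log (s / v)) (-v⁻¹) v := by
  have h : HasDerivAt (fun v => Real.log s - Real.log v) (-v⁻¹) v := by
    simpa using (Real.hasDerivAt_log hv.ne').const_sub (Real.log s)
  refine h.congr_of_eventuallyEq ?_
  filter_upwards [lt_mem_nhds hv] with x hx
  rw [Real.log_div hs.ne' hx.ne']

/-! ### Sums of `s (ln s)^k` over points with affine counting bounds -/

section Layer

variable {I : Type*} {ν : I → ℝ} {s : ℝ}

/-- For `k = 0` the truncated exponent `k - 1` is harmless because its coefficient is zero. -/
theorem hasDerivAt_mulLogPow_div (k : ℕ) {s v : ℝ} (hs : 0 < s) (hv : 0 < v) :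
    HasDerivAt (fun v => mulLogPow k (s / v))
      (-((s / v ^ 2) * Real.log (s / v) ^ k
        + (s / v ^ 2) * (k * Real.log (s / v) ^ (k - 1)))) v := by
  have h1 : HasDerivAt (fun v => s / v) (-(s / v ^ 2)) v := by
    have h : HasDerivAt (fun v => s * v⁻¹) _ v := (hasDerivAt_inv hv.ne').const_mul s
    simp only [div_eq_mul_inv]
    exact h.congr_deriv (by ring)
  have h2 : HasDerivAt (fun v => s / v * Real.log (s / v) ^ k) _ v :=
    h1.mul ((hasDerivAt_log_div hs hv).pow k)
  refine h2.congr_deriv ?_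
  field_simp
  ring

/-- This antiderivative increases by `mulLogPow (k + 1) s / (k + 1)` over `[1, s]`: one more
logarithm and one more factor of the factorial per dimension. -/
theorem hasDerivAt_log_div_pow (k : ℕ) {s v : ℝ} (hs : 0 < s) (hv : 0 < v) :
    HasDerivAt (fun v => -(s * Real.log (s / v) ^ (k + 1) / (k + 1))) (mulLogPow k (s / v)) v := by
  have h : HasDerivAt (fun v => -(s * Real.log (s / v) ^ (k + 1) / (k + 1))) _ v :=
    ((((hasDerivAt_log_div hs hv).pow (k + 1)).const_mul s).div_const ((k : ℝ) + 1)).neg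
  refine h.congr_deriv ?_
  unfold mulLogPow
  have : (k : ℝ) + 1 ≠ 0 := by positivity
  push_cast
  field_simp

/-- In the Abel summation both the boundary value `G s` and the weight `H` are nonnegative, so an
affine bound on the counting function from either side may be inserted. This is the induction step
from dimension `d` to `d + 1`. -/
theorem layerCake (hs : 1 ≤ s) (F : Finset I) (hν : ∀ i ∈ F, 1 ≤ ν i ∧ ν i ≤ s) (k : ℕ) (A B : ℝ) :
    ((∀ v ∈ Set.Icc 1 s, ((F.filter (ν · ≤ v)).card : ℝ) ≤ A * v + B) →
      ∑ i ∈ F, mulLogPow k (s / ν i)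
        ≤ A * (mulLogPow (k + 1) s / (k + 1)) + (A + B) * mulLogPow k s) ∧
    ((∀ v ∈ Set.Icc 1 s, A * v + B ≤ ((F.filter (ν · ≤ v)).card : ℝ)) →
      A * (mulLogPow (k + 1) s / (k + 1)) + (A + B) * mulLogPow k s
        ≤ ∑ i ∈ F, mulLogPow k (s / ν i)) := by
  set H : ℝ → ℝ := fun v => (s / v ^ 2) * Real.log (s / v) ^ k
        + (s / v ^ 2) * (k * Real.log (s / v) ^ (k - 1)) with hHdef
  have hs0 : 0 < s := by linarith
  have hG : ∀ v ∈ Set.Icc 1 s, HasDerivAt (fun v => mulLogPow k (s / v)) (-H v) v := fun v hv =>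
    hasDerivAt_mulLogPow_div k hs0 (by linarith [hv.1])
  have hP : ∀ v ∈ Set.Icc 1 s, HasDerivAt (fun v => -(s * Real.log (s / v) ^ (k + 1) / (k + 1)))
      (mulLogPow k (s / v)) v := fun v hv => hasDerivAt_log_div_pow k hs0 (by linarith [hv.1])
  have hlog : ContinuousOn (fun v => Real.log (s / v)) (Set.Icc 1 s) := fun v hv =>
    (hasDerivAt_log_div hs0 (by linarith [hv.1])).continuousAt.continuousWithinAt
  have hdiv : ContinuousOn (fun v => s / v ^ 2) (Set.Icc 1 s) :=
    continuousOn_const.div (by fun_prop) fun v hv => by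
      have : (0 : ℝ) < v := by linarith [hv.1]
      positivity
  have hH : ContinuousOn H (Set.Icc 1 s) :=
    (hdiv.mul (hlog.pow k)).add (hdiv.mul (continuousOn_const.mul (hlog.pow (k - 1))))
  have hH0 : ∀ v ∈ Set.Icc 1 s, 0 ≤ H v := fun v hv => by
    have hv0 : (0 : ℝ) < v := by linarith [hv.1]
    have : 0 ≤ Real.log (s / v) := Real.log_nonneg (by rw [le_div_iff₀ hv0]; linarith [hv.2])
    simp only [hHdef]
    positivity
  obtain ⟨hint, hsum⟩ := sum_eq_card_mul_add_integral F hν hG hH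
  have haff := integral_affine_mul hs hP hG hH A B
  have hint2 : IntervalIntegrable (fun v => (A * v + B) * H v) MeasureTheory.volume 1 s := by
    refine ContinuousOn.intervalIntegrable ?_
    rw [Set.uIcc_of_le hs]
    exact ContinuousOn.mul (by fun_prop) hH
  have hFs : F.filter (ν · ≤ s) = F := Finset.filter_true_of_mem fun i hi => (hν i hi).2
  have hval : A * (mulLogPow (k + 1) s / (k + 1)) + (A + B) * mulLogPow k s
      = (A * s + B) * mulLogPow k (s / s) + ∫ v in (1 : ℝ)..s, (A * v + B) * H v := by
    rw [haff, div_self hs0.ne']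
    simp [mulLogPow]
    ring
  have hGs : 0 ≤ mulLogPow k (s / s) := by
    rw [div_self hs0.ne']; exact mulLogPow_nonneg k le_rfl
  rw [hval, hsum]
  constructor
  · intro h
    refine add_le_add ?_ (intervalIntegral.integral_mono_on hs hint hint2 fun v hv => ?_)
    · have := h s ⟨hs, le_rfl⟩
      rw [hFs] at this
      gcongr
    · exact mul_le_mul_of_nonneg_right (h v hv) (hH0 v hv)
  · intro h
    refine add_le_add ?_ (intervalIntegral.integral_mono_on hs hint2 hint fun v hv => ?_)
    · have := h s ⟨hs, le_rfl⟩
      rw [hFs] at this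
      gcongr
    · exact mul_le_mul_of_nonneg_right (h v hv) (hH0 v hv)

end Layer

/-! ### The counting function -/

/-- The number of multi-indices `m` with `∏ ν (m j) ≤ s`. -/
def prodCount {I : Type*} (ν : I → ℝ) (d : ℕ) (s : ℝ) : ℕ :=
  Set.ncard {m : Fin d → I | ∏ j, ν (m j) ≤ s}

section Count

variable {I : Type*} {ν : I → ℝ}

theorem le_prod_of_one_le (hν : ∀ i, 1 ≤ ν i) {d : ℕ} (m : Fin d → I) (j : Fin d) :
    ν (m j) ≤ ∏ j, ν (m j) := by
  rw [← Finset.mul_prod_erase _ _ (Finset.mem_univ j)]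
  exact le_mul_of_one_le_right (by linarith [hν (m j)])
    (Finset.one_le_prod fun i _ => hν (m i))

/-- Every factor is at least one, hence each is bounded by the product. Finiteness makes the `ncard`
in `prodCount` a genuine count. -/
theorem finite_prod_le (hν : ∀ i, 1 ≤ ν i) (hfin : ∀ s, {i | ν i ≤ s}.Finite) (d : ℕ) (s : ℝ) :
    {m : Fin d → I | ∏ j, ν (m j) ≤ s}.Finite := by
  refine (Set.Finite.pi' fun _ : Fin d => hfin s).subset fun m hm j => ?_
  exact (le_prod_of_one_le hν m j).trans hm

theorem prodCount_zero {s : ℝ} (hs : 1 ≤ s) : prodCount ν 0 s = 1 := by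
  rw [prodCount, Set.ncard_eq_one]
  exact ⟨Fin.elim0, by ext m; simp [hs, Subsingleton.elim m Fin.elim0]⟩

/-- The multi-indices are sorted by their first entry `i`. Only `ν i ≤ s` contributes, because the
remaining product is at least one. -/
theorem prodCount_succ (hν : ∀ i, 1 ≤ ν i) (hfin : ∀ s, {i | ν i ≤ s}.Finite) (d : ℕ) (s : ℝ) :
    prodCount ν (d + 1) s = ∑ i ∈ (hfin s).toFinset, prodCount ν d (s / ν i) := by
  classical
  have hset : {m : Fin (d + 1) → I | ∏ j, ν (m j) ≤ s}
      = ((hfin s).toFinset.biUnion fun i =>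
        (finite_prod_le hν hfin d (s / ν i)).toFinset.image (Fin.cons i) : Finset (Fin (d + 1) → I)) := by
    ext m
    simp only [Set.mem_ofPred_eq, Finset.coe_biUnion, Set.Finite.coe_toFinset, Finset.coe_image,
      Set.mem_iUnion, Set.mem_image, exists_prop]
    constructor
    · intro hm
      refine ⟨m 0, (le_prod_of_one_le hν m 0).trans hm, Fin.tail m, ?_, Fin.cons_self_tail m⟩
      rw [le_div_iff₀ (by linarith [hν (m 0)]), mul_comm]
      rwa [Fin.prod_univ_succ] at hm
    · rintro ⟨i, -, m', hm', rfl⟩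
      rw [le_div_iff₀ (by linarith [hν i]), mul_comm] at hm'
      rw [Fin.prod_univ_succ]
      simpa using hm'
  rw [prodCount, hset, Set.ncard_coe_finset, Finset.card_biUnion]
  · refine Finset.sum_congr rfl fun i _ => ?_
    rw [Finset.card_image_of_injective _ (Fin.cons_right_injective (α := fun _ => I) i), prodCount,
      ← Set.ncard_coe_finset, Set.Finite.coe_toFinset]
  · intro i _ j _ hij
    rw [Function.onFun, Finset.disjoint_left]
    intro m hm hm'
    simp only [Finset.mem_image] at hm hm'
    obtain ⟨p, -, rfl⟩ := hm
    obtain ⟨q, -, hq⟩ := hm'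
    exact hij (by simpa using (congrFun hq 0).symm)

/-- Lower order terms. -/
def lowerOrder (d : ℕ) (s : ℝ) : ℝ := ∑ j ∈ Finset.range d, mulLogPow j s + 1

theorem lowerOrder_mono_le (d : ℕ) {s : ℝ} (hs : 1 ≤ s) :
    0 ≤ ∑ j ∈ Finset.range d, mulLogPow j s :=
  Finset.sum_nonneg fun j _ => mulLogPow_nonneg j hs

/-- Summation over one further index raises each power of the logarithm by at most one, so lower
order terms in dimension `d` stay of lower order in dimension `d + 1`. -/
theorem sum_lowerOrder_le (hν : ∀ i, 1 ≤ ν i) (hfin : ∀ s, {i | ν i ≤ s}.Finite) {A B : ℝ}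
    (hA : 0 ≤ A) (hB : 0 ≤ B)
    (hN : ∀ v, 1 ≤ v → ((hfin v).toFinset.card : ℝ) ≤ A * v + B) (d : ℕ) {s : ℝ} (hs : 1 ≤ s) :
    ∑ i ∈ (hfin s).toFinset, lowerOrder d (s / ν i) ≤ (3 * A + 2 * B) * lowerOrder (d + 1) s := by
  have hmem : ∀ i ∈ (hfin s).toFinset, 1 ≤ ν i ∧ ν i ≤ s := fun i hi => ⟨hν i, by simpa using hi⟩
  have hcard : ∀ v ∈ Set.Icc 1 s,
      (((hfin s).toFinset.filter (ν · ≤ v)).card : ℝ) ≤ A * v + B := by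
    intro v hv
    refine le_trans ?_ (hN v hv.1)
    gcongr
    intro i hi
    simpa using (Finset.mem_filter.mp hi).2
  have h1 : ∀ j ∈ Finset.range d, ∑ i ∈ (hfin s).toFinset, mulLogPow j (s / ν i)
      ≤ A * mulLogPow (j + 1) s + (A + B) * mulLogPow j s := by
    intro j _
    refine ((layerCake hs _ hmem j A B).1 hcard).trans ?_
    gcongr
    refine div_le_self (mulLogPow_nonneg _ hs) ?_
    have : (0 : ℝ) ≤ j := by positivity
    linarith
  simp only [lowerOrder, Finset.sum_add_distrib, Finset.sum_const, nsmul_eq_mul, mul_one]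
  rw [Finset.sum_comm]
  have h2 := Finset.sum_le_sum h1
  rw [Finset.sum_add_distrib, ← Finset.mul_sum, ← Finset.mul_sum] at h2
  have h3 : ∑ j ∈ Finset.range d, mulLogPow (j + 1) s
      ≤ ∑ j ∈ Finset.range (d + 1), mulLogPow j s := by
    rw [Finset.sum_range_succ']
    linarith [mulLogPow_nonneg 0 hs]
  have h4 : ∑ j ∈ Finset.range d, mulLogPow j s ≤ ∑ j ∈ Finset.range (d + 1), mulLogPow j s := by
    rw [Finset.sum_range_succ]
    linarith [mulLogPow_nonneg d hs]
  have h5 : s ≤ ∑ j ∈ Finset.range (d + 1), mulLogPow j s := by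
    rw [Finset.sum_range_succ']
    have := Finset.sum_nonneg fun j (_ : j ∈ Finset.range d) => mulLogPow_nonneg (j + 1) hs
    simp [mulLogPow] at this ⊢
    linarith
  have h6 := hN s hs
  -- The three contributions are at most `A * Z`, `(A + B) * Z` and `A * Z + B`, which together do
  -- not exceed `(3 * A + 2 * B) * (Z + 1)`.
  set Z := ∑ j ∈ Finset.range (d + 1), mulLogPow j s
  have h7 := mul_le_mul_of_nonneg_left h3 hA
  have h8 := mul_le_mul_of_nonneg_left h4 (add_nonneg hA hB)
  have h9 := mul_le_mul_of_nonneg_left h5 hA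
  have h10 : 0 ≤ Z := by linarith
  nlinarith [mul_nonneg hB h10]

/-- Induction through `prodCount_succ`: summing the leading term with `layerCake` multiplies its
constant by `A / (d + 1)` and adds a logarithm, while the other terms are absorbed by `lowerOrder`.
-/
theorem prodCount_le (hν : ∀ i, 1 ≤ ν i) (hfin : ∀ s, {i | ν i ≤ s}.Finite) {A B : ℝ}
    (hA : 0 ≤ A) (hB : 0 ≤ B)
    (hN : ∀ v, 1 ≤ v → ((hfin v).toFinset.card : ℝ) ≤ A * v + B) (d : ℕ) :
    ∃ K, 0 ≤ K ∧ ∀ s, 1 ≤ s → (prodCount ν (d + 1) s : ℝ)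
      ≤ A ^ (d + 1) / d.factorial * mulLogPow d s + K * lowerOrder d s := by
  have hmem : ∀ s, ∀ i ∈ (hfin s).toFinset, 1 ≤ ν i ∧ ν i ≤ s :=
    fun s i hi => ⟨hν i, by simpa using hi⟩
  have hone : ∀ s, ∀ i ∈ (hfin s).toFinset, 1 ≤ s / ν i := fun s i hi => by
    rw [le_div_iff₀ (by linarith [hν i]), one_mul]
    exact (hmem s i hi).2
  induction d with
  | zero =>
    refine ⟨B, hB, fun s hs => ?_⟩
    rw [prodCount_succ hν hfin, Finset.sum_congr rfl fun i hi => prodCount_zero (hone s i hi)]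
    simpa [mulLogPow, lowerOrder] using hN s hs
  | succ d ih =>
    obtain ⟨K, hK, ih⟩ := ih
    set c := A ^ (d + 1) / (d.factorial : ℝ) with hc
    have hc0 : 0 ≤ c := by positivity
    refine ⟨c * (A + B) + K * (3 * A + 2 * B), by positivity, fun s hs => ?_⟩
    have hcard : ∀ v ∈ Set.Icc 1 s,
        (((hfin s).toFinset.filter (ν · ≤ v)).card : ℝ) ≤ A * v + B := by
      intro v hv
      refine le_trans ?_ (hN v hv.1)
      gcongr
      intro i hi
      simpa using (Finset.mem_filter.mp hi).2
    rw [prodCount_succ hν hfin, Nat.cast_sum]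
    have h1 := Finset.sum_le_sum fun i hi => ih (s / ν i) (hone s i hi)
    rw [Finset.sum_add_distrib, ← Finset.mul_sum, ← Finset.mul_sum] at h1
    have h2 := mul_le_mul_of_nonneg_left ((layerCake hs _ (hmem s) d A B).1 hcard) hc0
    have h3 := mul_le_mul_of_nonneg_left (sum_lowerOrder_le hν hfin hA hB hN d hs) hK
    have h4 : mulLogPow d s ≤ lowerOrder (d + 1) s := by
      rw [lowerOrder, Finset.sum_range_succ]
      linarith [lowerOrder_mono_le d hs]
    have h5 := mul_le_mul_of_nonneg_left h4 (mul_nonneg hc0 (add_nonneg hA hB))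
    have h6 : A ^ (d + 1 + 1) / ((d + 1).factorial : ℝ) = c * A / (d + 1) := by
      rw [hc, Nat.factorial_succ]
      push_cast
      field_simp
      ring
    rw [h6]
    calc _ ≤ _ := h1
      _ ≤ _ := add_le_add h2 h3
      _ = c * A / (d + 1) * mulLogPow (d + 1) s + (c * (A + B) * mulLogPow d s
          + K * ((3 * A + 2 * B) * lowerOrder (d + 1) s)) := by ring
      _ ≤ _ := by linarith

/-- The mirror image of `prodCount_le` with `-B` for `B`. The upper bound `hN` is still needed,
since the subtracted lower order terms must be bounded from above. -/
theorem le_prodCount (hν : ∀ i, 1 ≤ ν i) (hfin : ∀ s, {i | ν i ≤ s}.Finite) {A B : ℝ}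
    (hA : 0 ≤ A) (hB : 0 ≤ B)
    (hN : ∀ v, 1 ≤ v → ((hfin v).toFinset.card : ℝ) ≤ A * v + B)
    (hN' : ∀ v, 1 ≤ v → A * v - B ≤ ((hfin v).toFinset.card : ℝ)) (d : ℕ) :
    ∃ K, 0 ≤ K ∧ ∀ s, 1 ≤ s →
      A ^ (d + 1) / d.factorial * mulLogPow d s - K * lowerOrder d s
        ≤ (prodCount ν (d + 1) s : ℝ) := by
  have hmem : ∀ s, ∀ i ∈ (hfin s).toFinset, 1 ≤ ν i ∧ ν i ≤ s :=
    fun s i hi => ⟨hν i, by simpa using hi⟩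
  have hone : ∀ s, ∀ i ∈ (hfin s).toFinset, 1 ≤ s / ν i := fun s i hi => by
    rw [le_div_iff₀ (by linarith [hν i]), one_mul]
    exact (hmem s i hi).2
  induction d with
  | zero =>
    refine ⟨B, hB, fun s hs => ?_⟩
    rw [prodCount_succ hν hfin, Finset.sum_congr rfl fun i hi => prodCount_zero (hone s i hi)]
    simpa [mulLogPow, lowerOrder] using hN' s hs
  | succ d ih =>
    obtain ⟨K, hK, ih⟩ := ih
    set c := A ^ (d + 1) / (d.factorial : ℝ) with hc
    have hc0 : 0 ≤ c := by positivity
    refine ⟨c * (A + B) + K * (3 * A + 2 * B), by positivity, fun s hs => ?_⟩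
    have hcard : ∀ v ∈ Set.Icc 1 s,
        A * v + -B ≤ (((hfin s).toFinset.filter (ν · ≤ v)).card : ℝ) := by
      intro v hv
      rw [← sub_eq_add_neg]
      refine (hN' v hv.1).trans ?_
      gcongr
      intro i hi
      have hi' : ν i ≤ v := by simpa using hi
      simpa using ⟨hi'.trans hv.2, hi'⟩
    rw [prodCount_succ hν hfin, Nat.cast_sum]
    have h1 := Finset.sum_le_sum fun i hi => ih (s / ν i) (hone s i hi)
    rw [Finset.sum_sub_distrib, ← Finset.mul_sum, ← Finset.mul_sum] at h1
    have h2 := mul_le_mul_of_nonneg_left ((layerCake hs _ (hmem s) d A (-B)).2 hcard) hc0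
    have h3 := mul_le_mul_of_nonneg_left (sum_lowerOrder_le hν hfin hA hB hN d hs) hK
    have h4 : mulLogPow d s ≤ lowerOrder (d + 1) s := by
      rw [lowerOrder, Finset.sum_range_succ]
      linarith [lowerOrder_mono_le d hs]
    have h5 := mul_le_mul_of_nonneg_left h4 (mul_nonneg hc0 (add_nonneg hA hB))
    have h6 : A ^ (d + 1 + 1) / ((d + 1).factorial : ℝ) = c * A / (d + 1) := by
      rw [hc, Nat.factorial_succ]
      push_cast
      field_simp
      ring
    have h7 := mul_nonneg (mul_nonneg hc0 hA) (mulLogPow_nonneg d hs)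
    rw [h6]
    refine le_trans ?_ h1
    refine le_trans ?_ (sub_le_sub h2 h3)
    -- Writing `A - B` as `-(A + B) + 2 * A` isolates a nonnegative term that can be dropped.
    have : c * (A * (mulLogPow (d + 1) s / (d + 1)) + (A + -B) * mulLogPow d s)
        = c * A / (d + 1) * mulLogPow (d + 1) s - c * (A + B) * mulLogPow d s
          + 2 * (c * A * mulLogPow d s) := by ring
    rw [this]
    linarith

theorem lowerOrder_isLittleO (d : ℕ) : lowerOrder d =o[atTop] mulLogPow d := by
  have hlog : Tendsto Real.log atTop atTop := Real.tendsto_log_atTop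
  unfold lowerOrder
  refine Asymptotics.IsLittleO.add (f₁ := fun s => ∑ j ∈ Finset.range d, mulLogPow j s) ?_ ?_
  · refine Asymptotics.IsLittleO.fun_sum fun j hj => ?_
    refine Asymptotics.IsBigO.mul_isLittleO (Asymptotics.isBigO_refl (fun s : ℝ => s) atTop) ?_
    exact (Asymptotics.isLittleO_pow_pow_atTop_of_lt (Finset.mem_range.mp hj)).comp_tendsto hlog
  · rw [Asymptotics.isLittleO_const_left]
    right
    refine tendsto_norm_atTop_atTop.comp ?_
    refine tendsto_atTop_mono' _ ?_ tendsto_id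
    filter_upwards [eventually_ge_atTop (Real.exp 1), eventually_ge_atTop 1] with s hs hs1
    have : 1 ≤ Real.log s := by rwa [Real.le_log_iff_exp_le (by linarith)]
    exact le_mul_of_one_le_right (by simp; linarith) (one_le_pow₀ this)

theorem eventually_lowerOrder_le (d : ℕ) (K : ℝ) (hK : 0 ≤ K) {ε : ℝ} (hε : 0 < ε) :
    ∀ᶠ s in atTop, K * lowerOrder d s ≤ ε * mulLogPow d s := by
  -- Dividing by `K + 1` instead of `K` covers `K = 0`.
  filter_upwards [(lowerOrder_isLittleO d).bound (show 0 < ε / (K + 1) by positivity),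
    eventually_ge_atTop 1] with s hs hs1
  have h0 : 0 ≤ lowerOrder d s := by
    have := lowerOrder_mono_le d hs1
    unfold lowerOrder; linarith
  rw [Real.norm_of_nonneg h0, Real.norm_of_nonneg (mulLogPow_nonneg d hs1)] at hs
  calc K * lowerOrder d s ≤ (K + 1) * lowerOrder d s := by gcongr; linarith
    _ ≤ (K + 1) * (ε / (K + 1) * mulLogPow d s) := by gcongr
    _ = _ := by field_simp

end Count

/-! ### Inversion of the counting asymptotics -/

theorem tendsto_div_log_pow_atTop (d : ℕ) {κ : ℝ} (hκ : 0 < κ) :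
    Tendsto (fun x : ℝ => κ * x / Real.log x ^ d) atTop atTop := by
  have h := (Real.isLittleO_pow_log_id_atTop (n := d)).tendsto_div_nhds_zero
  have h' : Tendsto (fun x : ℝ => Real.log x ^ d / x) atTop (𝓝[>] 0) := by
    rw [tendsto_nhdsWithin_iff]
    refine ⟨h, ?_⟩
    filter_upwards [eventually_gt_atTop 1] with x hx
    have := Real.log_pos hx
    simp only [Set.mem_Ioi]
    positivity
  have h2 := h'.inv_tendsto_nhdsGT_zero.const_mul_atTop hκ
  refine h2.congr fun x => ?_
  simp [mul_div_assoc]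

/-- For `s = κ x / (ln x)^d` the corrections to `ln x` are of order `ln ln x`, hence `ln s ~ ln x`.
So this `s` is an approximate inverse of `s (ln s)^d` at `κ x`. -/
theorem tendsto_log_div_log_pow (d : ℕ) {κ : ℝ} (hκ : 0 < κ) :
    Tendsto (fun x : ℝ => Real.log (κ * x / Real.log x ^ d) / Real.log x) atTop (𝓝 1) := by
  have hlog : Tendsto Real.log atTop atTop := Real.tendsto_log_atTop
  have h1 : Tendsto (fun x : ℝ => Real.log κ / Real.log x) atTop (𝓝 0) :=
    hlog.const_div_atTop _
  have h2 : Tendsto (fun x : ℝ => Real.log (Real.log x) / Real.log x) atTop (𝓝 0) :=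
    (Real.isLittleO_log_id_atTop.tendsto_div_nhds_zero).comp hlog
  have h3 : Tendsto (fun x : ℝ => Real.log κ / Real.log x + 1
      - d * (Real.log (Real.log x) / Real.log x)) atTop (𝓝 1) := by
    simpa using (h1.add_const 1).sub (h2.const_mul (d : ℝ))
  refine h3.congr' ?_
  filter_upwards [eventually_gt_atTop 1] with x hx
  have hx0 : (0 : ℝ) < x := by linarith
  have := Real.log_pos hx
  rw [Real.log_div (by positivity) (by positivity), Real.log_mul (by positivity) (by positivity),
    Real.log_pow]
  field_simp

/-- Values of `s (ln s)^d` at `s = κ x / (ln x)^d`. -/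
theorem tendsto_mulLogPow_div (d : ℕ) {κ : ℝ} (hκ : 0 < κ) :
    Tendsto (fun x : ℝ => mulLogPow d (κ * x / Real.log x ^ d) / x) atTop (𝓝 κ) := by
  have h := ((tendsto_log_div_log_pow d hκ).pow d).const_mul κ
  rw [one_pow, mul_one] at h
  refine h.congr' ?_
  filter_upwards [eventually_gt_atTop 1] with x hx
  have hx0 : (0 : ℝ) < x := by linarith
  have := Real.log_pos hx
  unfold mulLogPow
  rw [div_pow]
  field_simp

/-- Inversion: bounds for `e n` at the inverse of the counting function give the asymptotic
behaviour of `e`. -/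
theorem isEquivalent_of_counting {e : ℕ → ℝ} (d r : ℕ) {c : ℝ} (hc : 0 < c)
    (hU : ∀ ε > 0, ∀ᶠ s in atTop, ∀ n : ℕ, 1 ≤ n → (c + ε) * mulLogPow d s ≤ n → e n ≤ (s ^ r)⁻¹)
    (hL : ∀ ε > 0, ∀ᶠ s in atTop, ∀ n : ℕ, 1 ≤ n → (n : ℝ) < (c - ε) * mulLogPow d s →
      (s ^ r)⁻¹ ≤ e n) :
    Asymptotics.IsEquivalent atTop e
      (fun n : ℕ => c ^ r * (n : ℝ) ^ (-(r : ℤ)) * Real.log (n : ℝ) ^ (r * d)) := by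
  have hcast : Tendsto (fun n : ℕ => (n : ℝ)) atTop atTop := tendsto_natCast_atTop_atTop
  set τ : ℕ → ℝ := fun n => c ^ r * (n : ℝ) ^ (-(r : ℤ)) * Real.log (n : ℝ) ^ (r * d) with hτ
  -- At `s = κ n / (ln n)^d` the bound `s ^ (-r)` is `(κ c) ^ (-r)` times the claimed asymptotics;
  -- letting `κ` tend to `c⁻¹` gives the factor one. Here `n ≥ 2` ensures `ln n > 0`.
  have hval : ∀ κ : ℝ, 0 < κ → ∀ n : ℕ, 2 ≤ n →
      ((κ * n / Real.log n ^ d) ^ r)⁻¹ = ((κ * c) ^ r)⁻¹ * τ n := by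
    intro κ hκ n hn
    have hn1 : (1 : ℝ) < n := by exact_mod_cast hn
    have hn0 : (0 : ℝ) < n := by linarith
    have := Real.log_pos hn1
    rw [hτ]
    simp only [zpow_neg, zpow_natCast, div_pow, mul_pow, ← pow_mul, mul_comm d r]
    field_simp
  have hτpos : ∀ n : ℕ, 2 ≤ n → 0 < τ n := by
    intro n hn
    have hn1 : (1 : ℝ) < n := by exact_mod_cast hn
    have := Real.log_pos hn1
    have hn0 : (0 : ℝ) < n := by linarith
    simp only [hτ]
    positivity
  have hup : ∀ κ : ℝ, 0 < κ → κ * c < 1 → ∀ᶠ n : ℕ in atTop, e n ≤ ((κ * c) ^ r)⁻¹ * τ n := by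
    intro κ hκ hκc
    -- With this choice `(c + ε) * κ` is the midpoint of `κ * c` and `1`, leaving room for the
    -- limit.
    set ε := (1 - κ * c) / (2 * κ) with hε
    have hε0 : 0 < ε := div_pos (by linarith) (by linarith)
    have hlt : (c + ε) * κ < 1 := by
      have : ε * κ = (1 - κ * c) / 2 := by rw [hε]; field_simp
      linarith
    have h1 := ((tendsto_mulLogPow_div d hκ).const_mul (c + ε)).eventually_lt_const hlt
    filter_upwards [hcast.eventually h1,
      hcast.eventually ((tendsto_div_log_pow_atTop d hκ).eventually (hU ε hε0)),
      eventually_ge_atTop 2] with n h1 h2 hn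
    have hn0 : (0 : ℝ) < n := by exact_mod_cast (by omega : 0 < n)
    rw [← hval κ hκ n hn]
    refine h2 n (by omega) ?_
    rw [← mul_div_assoc, div_lt_one hn0] at h1
    exact h1.le
  have hlow : ∀ κ : ℝ, 0 < κ → 1 < κ * c → ∀ᶠ n : ℕ in atTop, ((κ * c) ^ r)⁻¹ * τ n ≤ e n := by
    intro κ hκ hκc
    set ε := (κ * c - 1) / (2 * κ) with hε
    have hε0 : 0 < ε := div_pos (by linarith) (by linarith)
    have hlt : 1 < (c - ε) * κ := by
      have : ε * κ = (κ * c - 1) / 2 := by rw [hε]; field_simp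
      linarith
    have h1 := ((tendsto_mulLogPow_div d hκ).const_mul (c - ε)).eventually_const_lt hlt
    filter_upwards [hcast.eventually h1,
      hcast.eventually ((tendsto_div_log_pow_atTop d hκ).eventually (hL ε hε0)),
      eventually_ge_atTop 2] with n h1 h2 hn
    have hn0 : (0 : ℝ) < n := by exact_mod_cast (by omega : 0 < n)
    rw [← hval κ hκ n hn]
    refine h2 n (by omega) ?_
    rwa [← mul_div_assoc, one_lt_div hn0] at h1
  have hlim : Tendsto (fun κ : ℝ => ((κ * c) ^ r)⁻¹) (𝓝 c⁻¹) (𝓝 1) := by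
    have : ContinuousAt (fun κ : ℝ => ((κ * c) ^ r)⁻¹) c⁻¹ := by
      refine ContinuousAt.inv₀ (by fun_prop) ?_
      rw [inv_mul_cancel₀ hc.ne']
      simp
    have h := this.tendsto
    rwa [inv_mul_cancel₀ hc.ne', one_pow, inv_one] at h
  rw [Asymptotics.isEquivalent_iff_tendsto_one]
  · rw [tendsto_order]
    constructor
    · intro x hx
      -- The lower bound needs `κ` slightly above `c⁻¹`, the upper bound below needs `κ` slightly
      -- under it.
      obtain ⟨κ, hκx, hκ⟩ := (((hlim.mono_left nhdsWithin_le_nhds).eventually_const_lt hx).and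
        (self_mem_nhdsWithin (s := Set.Ioi c⁻¹))).exists
      have hκ0 : 0 < κ := (inv_pos.mpr hc).trans hκ
      filter_upwards [hlow κ hκ0 (by rwa [← div_lt_iff₀ hc, one_div]), eventually_ge_atTop 2]
        with n h1 hn
      refine hκx.trans_le ?_
      rw [Pi.div_apply, le_div_iff₀ (hτpos n hn)]
      exact h1
    · intro x hx
      obtain ⟨κ, ⟨hκx, hκ⟩, hκ0⟩ := ((((hlim.mono_left nhdsWithin_le_nhds).eventually_lt_const hx).and
        (self_mem_nhdsWithin (s := Set.Iio c⁻¹))).and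
        (mem_nhdsWithin_of_mem_nhds (lt_mem_nhds (inv_pos.mpr hc)))).exists
      filter_upwards [hup κ hκ0 (by rwa [← lt_div_iff₀ hc, one_div]), eventually_ge_atTop 2]
        with n h1 hn
      refine lt_of_le_of_lt ?_ hκx
      rw [Pi.div_apply, div_le_iff₀ (hτpos n hn)]
      exact h1
  · filter_upwards [eventually_ge_atTop 2] with n hn
    exact (hτpos n hn).ne'

open MeasureTheory

/-! ## Weak derivatives on an interval -/

/-- Lebesgue measure on `[a,b]`. -/
abbrev intervalMeasure (a b : ℝ) : Measure ℝ := volume.restrict (Set.Icc a b)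

/-- Test functions on `(a,b)`. -/
def intervalTests (a b : ℝ) : Set (ℝ → ℝ) :=
  {φ | ContDiff ℝ ∞ φ ∧ HasCompactSupport φ ∧ tsupport φ ⊆ Set.Ioo a b}

section Interval

variable {𝕜 : Type u} [RCLike 𝕜] {a b : ℝ}

theorem integral_interval_eq {E : Type*} [NormedAddCommGroup E] [NormedSpace ℝ E] (hab : a ≤ b)
    (f : ℝ → E) : ∫ x, f x ∂(intervalMeasure a b) = ∫ x in a..b, f x := by
  rw [intervalIntegral.integral_of_le hab, integral_Icc_eq_integral_Ioc]

theorem integral_indicator_Iio {ψ : ℝ → ℝ} {x : ℝ} (hx : x ∈ Set.Icc a b) :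
    ∫ y, Set.indicator (Set.Iio x) ψ y ∂(intervalMeasure a b) = ∫ y in a..x, ψ y := by
  rw [integral_indicator measurableSet_Iio, Measure.restrict_restrict measurableSet_Iio,
    intervalIntegral.integral_of_le hx.1, integral_Ioc_eq_integral_Ioo,
    ← integral_Ico_eq_integral_Ioo]
  have : Set.Iio x ∩ Set.Icc a b = Set.Ico a x := by
    ext y
    simp only [Set.mem_inter_iff, Set.mem_Iio, Set.mem_Icc, Set.mem_Ico]
    exact ⟨fun h => ⟨h.2.1, h.1⟩, fun h => ⟨h.2, h.1, h.2.le.trans hx.2⟩⟩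
  rw [this]

/-- The tail integral `∫_y^b v`. -/
def tailIntegral (a b : ℝ) (v : ℝ → 𝕜) (y : ℝ) : 𝕜 :=
  ∫ x, Set.indicator (Set.Ioi y) v x ∂(intervalMeasure a b)

theorem integrable_triangle {ψ : ℝ → ℝ} (hψ : Continuous ψ) {v : ℝ → 𝕜}
    (hv : Integrable v (intervalMeasure a b)) :
    Integrable (Function.uncurry fun x y => (Set.indicator (Set.Iio x) ψ y) • v x)
      ((intervalMeasure a b).prod (intervalMeasure a b)) := by
  have hψi : Integrable (fun y => (ψ y : 𝕜)) (intervalMeasure a b) := by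
    have : Continuous fun y => (ψ y : 𝕜) := RCLike.continuous_ofReal.comp hψ
    exact this.continuousOn.integrableOn_Icc
  have h := (hv.mul_prod hψi).indicator (measurableSet_lt measurable_snd measurable_fst)
  refine h.congr (Eventually.of_forall fun p => ?_)
  by_cases hp : p.2 < p.1
  · simp [Function.uncurry, hp, Set.indicator, RCLike.real_smul_eq_coe_mul, mul_comm]
  · simp [Function.uncurry, hp, Set.indicator]

/-- Fubini on the triangle `y < x`. It replaces integration by parts when `v` is merely integrable.
-/
theorem integral_primitive_smul {ψ : ℝ → ℝ} (hψ : Continuous ψ) {v : ℝ → 𝕜}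
    (hv : Integrable v (intervalMeasure a b)) :
    ∫ x, (∫ y in a..x, ψ y) • v x ∂(intervalMeasure a b)
      = ∫ y, ψ y • tailIntegral a b v y ∂(intervalMeasure a b) := by
  have h1 : ∫ x, (∫ y in a..x, ψ y) • v x ∂(intervalMeasure a b)
      = ∫ x, ∫ y, (Set.indicator (Set.Iio x) ψ y) • v x ∂(intervalMeasure a b)
        ∂(intervalMeasure a b) := by
    refine setIntegral_congr_fun measurableSet_Icc fun x hx => ?_
    rw [integral_smul_const, integral_indicator_Iio hx]
  rw [h1, integral_integral_swap (integrable_triangle hψ hv)]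
  refine integral_congr_ae (Eventually.of_forall fun y => ?_)
  simp only [tailIntegral]
  rw [← integral_smul]
  refine integral_congr_ae (Eventually.of_forall fun x => ?_)
  by_cases hp : y < x <;> simp [hp, Set.indicator]

theorem integrable_tailIntegral {v : ℝ → 𝕜} (hv : Integrable v (intervalMeasure a b)) :
    Integrable (tailIntegral a b v) (intervalMeasure a b) := by
  have h := (integrable_triangle (ψ := fun _ => 1) continuous_const hv).integral_prod_right
  refine h.congr (Eventually.of_forall fun y => ?_)
  simp only [tailIntegral]
  refine integral_congr_ae (Eventually.of_forall fun x => ?_)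
  by_cases hp : y < x <;> simp [Function.uncurry, hp, Set.indicator]

theorem IsCompact.exists_Icc_subset_Ioo {K : Set ℝ} (hK : IsCompact K) (hab : a < b)
    (hKab : K ⊆ Set.Ioo a b) : ∃ α β, a < α ∧ β < b ∧ α ≤ β ∧ K ⊆ Set.Icc α β := by
  rcases K.eq_empty_or_nonempty with rfl | hne
  · exact ⟨(a + b) / 2, (a + b) / 2, by linarith, by linarith, le_rfl, Set.empty_subset _⟩
  · have h1 := hK.sInf_mem hne
    have h2 := hK.sSup_mem hne
    exact ⟨sInf K, sSup K, (hKab h1).1, (hKab h2).2, csInf_le hK.bddBelow h2,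
      fun x hx => ⟨csInf_le hK.bddBelow hx, le_csSup hK.bddAbove hx⟩⟩

theorem hasDerivAt_primitive {g : ℝ → ℝ} (hg : Continuous g) (a x : ℝ) :
    HasDerivAt (fun x => ∫ y in a..x, g y) (g x) x :=
  intervalIntegral.integral_hasDerivAt_right (hg.intervalIntegrable _ _)
    (hg.stronglyMeasurableAtFilter _ _) hg.continuousAt

/-- The primitive of a test function with vanishing integral is a test function. -/
theorem primitive_mem_intervalTests (hab : a < b) {g : ℝ → ℝ} (hg : g ∈ intervalTests a b)
    (hg0 : ∫ y in a..b, g y = 0) : (fun x => ∫ y in a..x, g y) ∈ intervalTests a b := by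
  obtain ⟨hsmooth, hcs, hsub⟩ := hg
  obtain ⟨α, β, ha, hb, hαβ, hK⟩ := IsCompact.exists_Icc_subset_Ioo hcs hab hsub
  have hgz : ∀ y, y ∉ Set.Icc α β → g y = 0 := fun y hy =>
    image_eq_zero_of_notMem_tsupport fun h => hy (hK h)
  have hcont := hsmooth.continuous
  have hzero : ∀ x, x ∉ Set.Icc α β → ∫ y in a..x, g y = 0 := by
    intro x hx
    rcases lt_or_ge x α with h | h
    · rw [intervalIntegral.integral_zero_ae]
      refine Eventually.of_forall fun y hy => hgz y fun hy' => ?_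
      have := hy.2
      rw [le_max_iff] at this
      rcases this with h' | h' <;> linarith [hy'.1]
    · have hx' : β < x := by
        by_contra! h'
        exact hx ⟨h, h'⟩
      -- To the right of the support the primitive equals the full integral, which is zero.
      have hsplit := intervalIntegral.integral_add_adjacent_intervals
        (hcont.intervalIntegrable (μ := volume) a b) (hcont.intervalIntegrable b x)
      rw [hg0, zero_add] at hsplit
      rw [← hsplit, intervalIntegral.integral_zero_ae]
      refine Eventually.of_forall fun y hy => hgz y fun hy' => ?_
      have := hy.1
      rw [min_lt_iff] at this
      rcases this with h' | h' <;> linarith [hy'.2]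
  have hsupp : tsupport (fun x => ∫ y in a..x, g y) ⊆ Set.Icc α β := by
    refine closure_minimal (fun x hx => ?_) isClosed_Icc
    by_contra h
    exact hx (hzero x h)
  refine ⟨?_, HasCompactSupport.of_support_subset_isCompact isCompact_Icc
    (subset_closure.trans hsupp), hsupp.trans fun x hx => ⟨ha.trans_le hx.1, hx.2.trans_lt hb⟩⟩
  rw [contDiff_infty_iff_deriv]
  have hd : deriv (fun x => ∫ y in a..x, g y) = g :=
    funext fun x => (hasDerivAt_primitive hcont a x).deriv
  rw [hd]
  exact ⟨fun x => (hasDerivAt_primitive hcont a x).differentiableAt, hsmooth⟩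

theorem exists_intervalTests_integral_eq_one (hab : a < b) :
    ∃ η ∈ intervalTests a b, ∫ y in a..b, η y = 1 := by
  let f : ContDiffBump ((a + b) / 2) := ⟨(b - a) / 8, (b - a) / 4, by linarith, by linarith⟩
  have hsub : tsupport (f.normed volume) ⊆ Set.Ioo a b := by
    rw [ContDiffBump.tsupport_normed_eq, Real.closedBall_eq_Icc]
    change Set.Icc ((a + b) / 2 - (b - a) / 4) ((a + b) / 2 + (b - a) / 4) ⊆ _
    exact fun x hx => ⟨by linarith [hx.1], by linarith [hx.2]⟩
  refine ⟨f.normed volume, ⟨f.contDiff_normed, f.hasCompactSupport_normed, hsub⟩, ?_⟩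
  rw [← f.integral_normed (μ := volume), intervalIntegral.integral_of_le hab.le]
  refine setIntegral_eq_integral_of_forall_compl_eq_zero fun x hx => ?_
  exact image_eq_zero_of_notMem_tsupport fun h => hx (Set.Ioo_subset_Ioc_self (hsub h))

theorem intervalTests_sub_smul {φ ψ : ℝ → ℝ} (hφ : φ ∈ intervalTests a b)
    (hψ : ψ ∈ intervalTests a b) (c : ℝ) : (fun x => φ x - c * ψ x) ∈ intervalTests a b := by
  have hsupp : tsupport (fun x => φ x - c * ψ x) ⊆ tsupport φ ∪ tsupport ψ := by
    refine closure_minimal (fun x hx => ?_) ((isClosed_tsupport _).union (isClosed_tsupport _))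
    by_contra h
    rw [Set.mem_union, not_or] at h
    refine hx ?_
    simp [image_eq_zero_of_notMem_tsupport h.1, image_eq_zero_of_notMem_tsupport h.2]
  refine ⟨hφ.1.sub (contDiff_const.mul hψ.1), ?_, hsupp.trans (Set.union_subset hφ.2.2 hψ.2.2)⟩
  exact HasCompactSupport.of_support_subset_isCompact (hφ.2.1.isCompact.union hψ.2.1.isCompact)
    (subset_closure.trans hsupp)

theorem integrable_continuous_smul {ψ : ℝ → ℝ} (hψ : Continuous ψ) {v : ℝ → 𝕜}
    (hv : Integrable v (intervalMeasure a b)) :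
    Integrable (fun x => ψ x • v x) (intervalMeasure a b) := by
  obtain ⟨C, hC⟩ := (isCompact_Icc (a := a) (b := b)).exists_bound_of_continuousOn hψ.continuousOn
  exact hv.bdd_smul C hψ.aestronglyMeasurable
    ((ae_restrict_mem measurableSet_Icc).mono fun x hx => hC x hx)

theorem ae_mem_Ioo : ∀ᵐ x ∂(intervalMeasure a b), x ∈ Set.Ioo a b := by
  rw [intervalMeasure, ← Measure.restrict_congr_set Ioo_ae_eq_Icc]
  exact ae_restrict_mem measurableSet_Ioo

theorem ae_eq_zero_of_forall_intervalTests {v : ℝ → 𝕜} (hv : Integrable v (intervalMeasure a b))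
    (h : ∀ φ ∈ intervalTests a b, ∫ x, φ x • v x ∂(intervalMeasure a b) = 0) :
    v =ᵐ[intervalMeasure a b] 0 := by
  have h1 := isOpen_Ioo.ae_eq_zero_of_integral_contDiff_smul_eq_zero (U := Set.Ioo a b)
    (hv.locallyIntegrable.locallyIntegrableOn _) fun φ h1 h2 h3 => h φ ⟨h1, h2, h3⟩
  filter_upwards [h1, ae_mem_Ioo] with x hx hx'
  exact hx hx'

/-- If `v` is the weak derivative of `u` on `(a,b)` and `∫ v = 0`, then `v` is also the weak
derivative of `u` on the circle. -/
theorem integral_deriv_smul_eq_of_periodic (hab : a < b) {u v : ℝ → 𝕜}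
    (hu : Integrable u (intervalMeasure a b)) (hv : Integrable v (intervalMeasure a b))
    (h : ∀ φ ∈ intervalTests a b, ∫ x, deriv φ x • u x ∂(intervalMeasure a b)
      = -∫ x, φ x • v x ∂(intervalMeasure a b))
    (hv0 : ∫ x, v x ∂(intervalMeasure a b) = 0) {t : ℝ → ℝ} (ht : ContDiff ℝ ∞ t)
    (hper : t b = t a) :
    ∫ x, deriv t x • u x ∂(intervalMeasure a b) = -∫ x, t x • v x ∂(intervalMeasure a b) := by
  -- The tail integral has derivative `-v`, so `w` has weak derivative zero and is constant by the
  -- lemma of du Bois-Reymond.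
  set w : ℝ → 𝕜 := fun x => u x + tailIntegral a b v x with hw
  have hwi : Integrable w (intervalMeasure a b) := hu.add (integrable_tailIntegral hv)
  have hzero : ∀ g ∈ intervalTests a b, ∫ y in a..b, g y = 0 →
      ∫ x, g x • w x ∂(intervalMeasure a b) = 0 := by
    intro g hg hg0
    have hd : deriv (fun x => ∫ y in a..x, g y) = g :=
      funext fun x => (hasDerivAt_primitive hg.1.continuous a x).deriv
    have h1 := h _ (primitive_mem_intervalTests hab hg hg0)
    rw [hd, integral_primitive_smul hg.1.continuous hv] at h1
    simp only [hw, smul_add]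
    rw [integral_add (integrable_continuous_smul hg.1.continuous hu)
      (integrable_continuous_smul hg.1.continuous (integrable_tailIntegral hv)), h1,
      neg_add_cancel]
  obtain ⟨η, hη, hη1⟩ := exists_intervalTests_integral_eq_one hab
  set c := ∫ x, η x • w x ∂(intervalMeasure a b) with hc
  have hconst : (fun x => w x - c) =ᵐ[intervalMeasure a b] 0 := by
    refine ae_eq_zero_of_forall_intervalTests (hwi.sub (integrable_const c)) fun φ hφ => ?_
    -- Subtracting `(∫ φ) • η` turns an arbitrary test function into one with vanishing integral.
    have h1 := hzero _ (intervalTests_sub_smul hφ hη (∫ y in a..b, φ y)) (by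
      rw [intervalIntegral.integral_sub (hφ.1.continuous.intervalIntegrable _ _)
        ((hη.1.continuous.intervalIntegrable _ _).const_mul _),
        intervalIntegral.integral_const_mul, hη1, mul_one, sub_self])
    simp only [sub_smul, mul_smul] at h1
    rw [integral_sub (integrable_continuous_smul hφ.1.continuous hwi)
      (g := fun x => (∫ y in a..b, φ y) • η x • w x)
      ((integrable_continuous_smul hη.1.continuous hwi).smul (∫ y in a..b, φ y)), integral_smul, ← hc] at h1
    simp only [smul_sub]
    rw [integral_sub (integrable_continuous_smul hφ.1.continuous hwi)
      (integrable_continuous_smul hφ.1.continuous (integrable_const c)), integral_smul_const,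
      integral_interval_eq hab.le φ]
    exact h1
  have hdt : Continuous (deriv t) := ht.continuous_deriv (by simp)
  have hprim : ∀ x, ∫ y in a..x, deriv t y = t x - t a := fun x =>
    intervalIntegral.integral_deriv_eq_sub
      (fun y _ => (ht.differentiable (by simp)).differentiableAt) (hdt.intervalIntegrable _ _)
  -- Since `t b = t a`, the derivative of `t` has mean zero and annihilates the constant `w`. The
  -- remaining boundary term `t a • ∫ v` vanishes by `hv0`.
  have h1 : ∫ x, deriv t x • w x ∂(intervalMeasure a b) = 0 := by
    have : ∫ x, deriv t x • w x ∂(intervalMeasure a b)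
        = ∫ x, deriv t x • c ∂(intervalMeasure a b) := by
      refine integral_congr_ae ?_
      filter_upwards [hconst] with x hx
      rw [sub_eq_zero.mp hx]
    rw [this, integral_smul_const, integral_interval_eq hab.le, hprim, hper, sub_self, zero_smul]
  simp only [hw, smul_add] at h1
  rw [integral_add (integrable_continuous_smul hdt hu)
      (integrable_continuous_smul hdt (integrable_tailIntegral hv)),
    ← integral_primitive_smul hdt hv] at h1
  simp only [hprim, sub_smul] at h1
  rw [integral_sub (integrable_continuous_smul ht.continuous hv) (g := fun x => t a • v x)
    (hv.smul (t a)), integral_smul, hv0,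
    smul_zero, sub_zero] at h1
  exact eq_neg_of_add_eq_zero_left h1

end Interval

/-! ## Trigonometric functions on an interval -/

/-- The frequency `2π|k|/(b-a)`. -/
def trigFreq (a b : ℝ) (k : ℤ) : ℝ := 2 * Real.pi * |k| / (b - a)

/-- The phase that distinguishes cosine and sine. -/
def trigPhase (k : ℤ) : ℝ := if 0 ≤ k then 0 else -(Real.pi / 2)

/-- The trigonometric functions: up to the factor `ξ^l`, the `l`-th derivatives of
`cos (ξ x)` (for `k ≥ 0`) and `sin (ξ x)` (for `k < 0`), where `ξ = 2π|k|/(b-a)`. -/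
def trigFun (a b : ℝ) (k : ℤ) (l : ℕ) (x : ℝ) : ℝ :=
  Real.cos (trigFreq a b k * x + trigPhase k + l * (Real.pi / 2))

section Trig

variable {a b : ℝ}

theorem trigFreq_nonneg (hab : a < b) (k : ℤ) : 0 ≤ trigFreq a b k := by
  have : 0 < b - a := by linarith
  unfold trigFreq
  positivity

theorem hasDerivAt_trigFun (k : ℤ) (l : ℕ) (x : ℝ) :
    HasDerivAt (trigFun a b k l) (trigFreq a b k * trigFun a b k (l + 1) x) x := by
  have h1 : HasDerivAt (fun x => trigFreq a b k * x + trigPhase k + l * (Real.pi / 2))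
      (trigFreq a b k) x := by
    simpa using ((((hasDerivAt_id x).const_mul (trigFreq a b k)).add_const
      (trigPhase k)).add_const ((l : ℝ) * (Real.pi / 2)))
  have h2 := h1.cos
  refine h2.congr_deriv ?_
  unfold trigFun
  push_cast
  rw [add_mul, one_mul, ← add_assoc, Real.cos_add_pi_div_two]
  ring

theorem deriv_trigFun (k : ℤ) (l : ℕ) :
    deriv (trigFun a b k l) = fun x => trigFreq a b k * trigFun a b k (l + 1) x :=
  funext fun x => (hasDerivAt_trigFun k l x).deriv

theorem contDiff_trigFun (k : ℤ) (l : ℕ) : ContDiff ℝ ∞ (trigFun a b k l) := by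
  unfold trigFun
  fun_prop

theorem trigFun_add_period (hab : a < b) (k : ℤ) (l : ℕ) (x : ℝ) :
    trigFun a b k l (x + (b - a)) = trigFun a b k l x := by
  have h : b - a ≠ 0 := by linarith
  unfold trigFun trigFreq
  rw [← Real.cos_add_int_mul_two_pi
    (2 * Real.pi * |k| / (b - a) * x + trigPhase k + l * (Real.pi / 2)) |k|]
  congr 1
  push_cast
  field_simp
  ring

theorem trigFun_add_two (k : ℤ) (l : ℕ) (x : ℝ) :
    trigFun a b k (l + 2) x = -trigFun a b k l x := by
  unfold trigFun
  rw [← Real.cos_add_pi]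
  congr 1
  push_cast
  ring

theorem trigFun_double (k : ℤ) (l : ℕ) (x : ℝ) :
    trigFun a b k (2 * l) x = (-1) ^ l * trigFun a b k 0 x := by
  induction l with
  | zero => simp
  | succ l ih => rw [mul_add, mul_one, trigFun_add_two, ih]; ring

theorem integral_cos_frequency (hab : a < b) (n : ℤ) (q : ℝ) :
    ∫ x in a..b, Real.cos (2 * Real.pi * n / (b - a) * x + q)
      = if n = 0 then (b - a) * Real.cos q else 0 := by
  have h : b - a ≠ 0 := by linarith
  split_ifs with hn
  · simp [hn]
  · set c := 2 * Real.pi * n / (b - a) with hc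
    have hc0 : c ≠ 0 := by
      have : (n : ℝ) ≠ 0 := by exact_mod_cast hn
      have := Real.pi_ne_zero
      positivity
    have hder : ∀ x, HasDerivAt (fun x => Real.sin (c * x + q) / c) (Real.cos (c * x + q)) x := by
      intro x
      have h1 : HasDerivAt (fun x => c * x + q) c x := by
        simpa using ((hasDerivAt_id x).const_mul c).add_const q
      refine (h1.sin.div_const c).congr_deriv ?_
      field_simp
    rw [intervalIntegral.integral_eq_sub_of_hasDerivAt (fun x _ => hder x)
      (Continuous.intervalIntegrable (by fun_prop) _ _)]
    have : Real.sin (c * b + q) = Real.sin (c * a + q) := by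
      rw [← Real.sin_add_int_mul_two_pi (c * a + q) n]
      congr 1
      rw [hc]
      field_simp
      ring
    rw [this, sub_self]

/-- The product-to-sum formula leaves cosines of the integer frequencies `|j| - |k|` and `|j| +
|k|`, which integrate to zero unless the frequency vanishes. -/
theorem integral_trigFun_mul (hab : a < b) (j k : ℤ) (l : ℕ) :
    ∫ x in a..b, trigFun a b j l x * trigFun a b k l x
      = ((if |j| - |k| = 0 then (b - a) * Real.cos (trigPhase j - trigPhase k) else 0)
        + (if |j| + |k| = 0 then (b - a) * Real.cos (trigPhase j + trigPhase k + l * Real.pi)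
          else 0)) / 2 := by
  rw [← integral_cos_frequency hab, ← integral_cos_frequency hab,
    ← intervalIntegral.integral_add (Continuous.intervalIntegrable (by fun_prop) _ _)
      (Continuous.intervalIntegrable (by fun_prop) _ _), ← intervalIntegral.integral_div]
  refine intervalIntegral.integral_congr fun x _ => ?_
  have h1 : 2 * Real.pi * ((|j| - |k| : ℤ) : ℝ) / (b - a) * x + (trigPhase j - trigPhase k)
      = (trigFreq a b j * x + trigPhase j + l * (Real.pi / 2))
        - (trigFreq a b k * x + trigPhase k + l * (Real.pi / 2)) := by
    unfold trigFreq; push_cast; ring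
  have h2 : 2 * Real.pi * ((|j| + |k| : ℤ) : ℝ) / (b - a) * x
        + (trigPhase j + trigPhase k + l * Real.pi)
      = (trigFreq a b j * x + trigPhase j + l * (Real.pi / 2))
        + (trigFreq a b k * x + trigPhase k + l * (Real.pi / 2)) := by
    unfold trigFreq; push_cast; ring
  simp only [h1, h2, trigFun, Real.cos_add, Real.cos_sub]
  ring

theorem integral_trigFun_mul_of_ne (hab : a < b) {j k : ℤ} (hjk : j ≠ k) (l : ℕ) :
    ∫ x in a..b, trigFun a b j l x * trigFun a b k l x = 0 := by
  rw [integral_trigFun_mul hab]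
  have h2 : |j| + |k| ≠ 0 := by
    intro h
    have := abs_nonneg j
    have := abs_nonneg k
    exact hjk ((abs_eq_zero.mp (by omega : |j| = 0)).trans (abs_eq_zero.mp (by omega : |k| = 0)).symm)
  rw [if_neg h2]
  split_ifs with h1
  -- These are the sine and the cosine of the same frequency, whose phases differ by a right angle.
  · have hj : j = -k := (abs_eq_abs.mp (by omega : |j| = |k|)).resolve_left hjk
    have hcos : Real.cos (trigPhase j - trigPhase k) = 0 := by
      unfold trigPhase
      rcases lt_trichotomy k 0 with hk | hk | hk
      · rw [if_pos (by omega), if_neg (by omega)]; simp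
      · omega
      · rw [if_neg (by omega), if_pos (by omega)]; simp
    rw [hcos]
    simp
  · simp

/-- The squared norm of the trigonometric functions. -/
theorem integral_trigFun_zero_sq_pos (hab : a < b) (k : ℤ) :
    0 < ∫ x in a..b, trigFun a b k 0 x * trigFun a b k 0 x := by
  have h : 0 < b - a := by linarith
  rw [integral_trigFun_mul hab]
  by_cases hk : k = 0
  · subst hk
    simp [trigPhase, h]
  · have h2 : |k| + |k| ≠ 0 := by
      have := abs_pos.mpr hk
      omega
    simp [h2, h]

/-- For `k ≠ 0` a phase shift does not change the norm. For `k = 0` the norms may differ, but then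
the frequency factor is zero for `l > 0`; hence the factor on both sides. -/
theorem integral_trigFun_sq (hab : a < b) (k : ℤ) (l : ℕ) :
    (trigFreq a b k ^ l) ^ 2 * ∫ x in a..b, trigFun a b k l x * trigFun a b k l x
      = (trigFreq a b k ^ l) ^ 2 * ∫ x in a..b, trigFun a b k 0 x * trigFun a b k 0 x := by
  rcases Nat.eq_zero_or_pos l with rfl | hl
  · rfl
  by_cases hk : k = 0
  · subst hk
    have : trigFreq a b 0 = 0 := by simp [trigFreq]
    rw [this, zero_pow hl.ne']
    simp
  · have h2 : |k| + |k| ≠ 0 := by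
      have := abs_pos.mpr hk
      omega
    rw [integral_trigFun_mul hab, integral_trigFun_mul hab, if_neg h2, if_neg h2]

theorem fourier_eq_trigFun (n : ℤ) : ∃ c : ℂ, ∀ x : ℝ,
    fourier n (x : AddCircle (b - a)) = trigFun a b |n| 0 x + c * trigFun a b (-|n|) 0 x := by
  have hform : ∀ x : ℝ, fourier n (x : AddCircle (b - a))
      = Real.cos (2 * Real.pi * n / (b - a) * x)
        + Real.sin (2 * Real.pi * n / (b - a) * x) * Complex.I := by
    intro x
    rw [fourier_coe_apply, Complex.ofReal_cos, Complex.ofReal_sin, ← Complex.exp_mul_I]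
    congr 1
    push_cast
    ring
  simp only [hform]
  rcases lt_trichotomy n 0 with hn | rfl | hn
  · refine ⟨-Complex.I, fun x => ?_⟩
    unfold trigFun trigFreq trigPhase
    rw [if_pos (abs_nonneg n), if_neg (by simp; omega), abs_neg, abs_abs, abs_of_neg hn]
    have h1 : 2 * Real.pi * ((-n : ℤ) : ℝ) / (b - a) * x + 0 + (0 : ℕ) * (Real.pi / 2)
        = -(2 * Real.pi * n / (b - a) * x) := by push_cast; ring
    have h2 : 2 * Real.pi * ((-n : ℤ) : ℝ) / (b - a) * x + -(Real.pi / 2) + (0 : ℕ) * (Real.pi / 2)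
        = -(2 * Real.pi * n / (b - a) * x) - Real.pi / 2 := by push_cast; ring
    rw [h1, h2, Real.cos_neg, Real.cos_sub_pi_div_two, Real.sin_neg]
    push_cast
    ring
  -- For `n = 0` the index `-|n|` gives the constant again rather than a sine, so its coefficient
  -- must be zero.
  · exact ⟨0, fun x => by simp [trigFun, trigFreq, trigPhase]⟩
  · refine ⟨Complex.I, fun x => ?_⟩
    unfold trigFun trigFreq trigPhase
    rw [if_pos (abs_nonneg n), if_neg (by simp; omega), abs_neg, abs_abs, abs_of_pos hn]
    have h1 : 2 * Real.pi * (n : ℝ) / (b - a) * x + 0 + (0 : ℕ) * (Real.pi / 2)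
        = 2 * Real.pi * n / (b - a) * x := by push_cast; ring
    have h2 : 2 * Real.pi * (n : ℝ) / (b - a) * x + -(Real.pi / 2) + (0 : ℕ) * (Real.pi / 2)
        = 2 * Real.pi * n / (b - a) * x - Real.pi / 2 := by push_cast; ring
    rw [h1, h2, Real.cos_sub_pi_div_two]
    ring

/-- All Fourier coefficients vanish by Euler's formula, and Parseval's identity gives norm zero. -/
theorem ae_eq_zero_of_forall_trigFun_complex (hab : a < b) {f : ℝ → ℂ}
    (hf : MemLp f 2 (intervalMeasure a b))
    (h : ∀ k, ∫ x, trigFun a b k 0 x • f x ∂(intervalMeasure a b) = 0) :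
    f =ᵐ[intervalMeasure a b] 0 := by
  have hmeas : volume.restrict (Set.Ioc a b) = intervalMeasure a b :=
    Measure.restrict_congr_set Ioc_ae_eq_Icc
  have hint : Integrable f (intervalMeasure a b) := hf.integrable (by norm_num)
  have hcoeff : ∀ n, fourierCoeffOn hab f n = 0 := by
    intro n
    obtain ⟨c, hc⟩ := fourier_eq_trigFun (a := a) (b := b) (-n)
    rw [fourierCoeffOn_eq_integral, ← integral_interval_eq hab.le]
    have : ∫ x, fourier (-n) (x : AddCircle (b - a)) • f x ∂(intervalMeasure a b)
        = ∫ x, (trigFun a b |(-n)| 0 x • f x + c • (trigFun a b (-|(-n)|) 0 x • f x))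
          ∂(intervalMeasure a b) := by
      refine integral_congr_ae (Eventually.of_forall fun x => ?_)
      simp only [hc, smul_eq_mul, Complex.real_smul]
      ring
    rw [this, integral_add (integrable_continuous_smul (contDiff_trigFun _ _).continuous hint)
      (g := fun x => c • (trigFun a b (-|(-n)|) 0 x • f x))
      ((integrable_continuous_smul (contDiff_trigFun _ _).continuous hint).smul c), h,
      integral_smul, h]
    simp
  have hsum := hasSum_sq_fourierCoeffOn hab (hmeas ▸ hf)
  simp only [hcoeff, norm_zero, ne_eq, OfNat.ofNat_ne_zero, not_false_eq_true, zero_pow] at hsum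
  have hz := hsum.unique hasSum_zero
  have hba : (b - a)⁻¹ ≠ 0 := inv_ne_zero (by linarith)
  have hz' := (smul_eq_zero.mp hz).resolve_left hba
  rw [← integral_interval_eq hab.le, integral_eq_zero_iff_of_nonneg (fun x => by positivity)
    ((memLp_two_iff_integrable_sq_norm hf.1).mp hf)] at hz'
  filter_upwards [hz'] with x hx
  simpa using hx

/-- As `trigFun` is real, the hypothesis splits into real and imaginary parts, and the complex case
applies to each of them. -/
theorem ae_eq_zero_of_forall_trigFun {𝕜 : Type u} [RCLike 𝕜] (hab : a < b) {f : ℝ → 𝕜}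
    (hf : MemLp f 2 (intervalMeasure a b))
    (h : ∀ k, ∫ x, trigFun a b k 0 x • f x ∂(intervalMeasure a b) = 0) :
    f =ᵐ[intervalMeasure a b] 0 := by
  have hint : Integrable f (intervalMeasure a b) := hf.integrable (by norm_num)
  have hi := fun k => integrable_continuous_smul (contDiff_trigFun (a := a) (b := b) k 0).continuous hint
  have hre : (fun x => ((RCLike.re (f x) : ℝ) : ℂ)) =ᵐ[intervalMeasure a b] 0 := by
    refine ae_eq_zero_of_forall_trigFun_complex hab hf.re.ofReal fun k => ?_
    have h1 := congrArg RCLike.re (h k)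
    rw [← integral_re (hi k), map_zero] at h1
    simp only [RCLike.smul_re] at h1
    have : ∫ x, trigFun a b k 0 x • ((RCLike.re (f x) : ℝ) : ℂ) ∂(intervalMeasure a b)
        = ((∫ x, trigFun a b k 0 x * RCLike.re (f x) ∂(intervalMeasure a b) : ℝ) : ℂ) := by
      rw [← integral_complex_ofReal]
      simp
    rw [this, h1, Complex.ofReal_zero]
  have him : (fun x => ((RCLike.im (f x) : ℝ) : ℂ)) =ᵐ[intervalMeasure a b] 0 := by
    refine ae_eq_zero_of_forall_trigFun_complex hab hf.im.ofReal fun k => ?_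
    have h1 := congrArg RCLike.im (h k)
    rw [← integral_im (hi k), map_zero] at h1
    simp only [RCLike.smul_im] at h1
    have : ∫ x, trigFun a b k 0 x • ((RCLike.im (f x) : ℝ) : ℂ) ∂(intervalMeasure a b)
        = ((∫ x, trigFun a b k 0 x * RCLike.im (f x) ∂(intervalMeasure a b) : ℝ) : ℂ) := by
      rw [← integral_complex_ofReal]
      simp
    rw [this, h1, Complex.ofReal_zero]
  filter_upwards [hre, him] with x h1 h2
  refine RCLike.ext ?_ ?_
  · simpa using h1
  · simpa using h2

end Trig

/-! ## The univariate Sobolev space -/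

/-- The space `L²([a,b])`. -/
abbrev L2Interval (𝕜 : Type u) [RCLike 𝕜] (a b : ℝ) : Type u := Lp 𝕜 2 (intervalMeasure a b)

/-- Families `(g_l)_{l ≤ r}` in `L²([a,b])`. -/
abbrev IntervalJet (𝕜 : Type u) [RCLike 𝕜] (r : ℕ) (a b : ℝ) : Type u :=
  PiLp 2 (fun _ : Fin (r + 1) => L2Interval 𝕜 a b)

theorem memLp_ofReal_of_continuous {𝕜 : Type u} [RCLike 𝕜] {a b : ℝ} {φ : ℝ → ℝ}
    (hφ : Continuous φ) : MemLp (fun x => (φ x : 𝕜)) 2 (intervalMeasure a b) := by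
  obtain ⟨C, hC⟩ := (isCompact_Icc (a := a) (b := b)).exists_bound_of_continuousOn hφ.continuousOn
  refine MemLp.of_bound (RCLike.continuous_ofReal.comp hφ).aestronglyMeasurable C ?_
  exact (ae_restrict_mem measurableSet_Icc).mono fun x hx => by
    rw [RCLike.norm_ofReal]; exact hC x hx

/-- A continuous real function as an element of `L²([a,b])`. -/
def contL2 (𝕜 : Type u) [RCLike 𝕜] (a b : ℝ) (φ : ℝ → ℝ) (hφ : Continuous φ) : L2Interval 𝕜 a b :=
  (memLp_ofReal_of_continuous hφ).toLp _

section Jet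

variable {𝕜 : Type u} [RCLike 𝕜] {a b : ℝ} {r : ℕ}

theorem coeFn_contL2 {φ : ℝ → ℝ} (hφ : Continuous φ) :
    contL2 𝕜 a b φ hφ =ᵐ[intervalMeasure a b] fun x => (φ x : 𝕜) :=
  MemLp.coeFn_toLp _

theorem integrable_L2Interval (f : L2Interval 𝕜 a b) : Integrable f (intervalMeasure a b) :=
  (Lp.memLp f).integrable (by norm_num)

theorem inner_contL2 {φ : ℝ → ℝ} (hφ : Continuous φ) (f : L2Interval 𝕜 a b) :
    inner 𝕜 (contL2 𝕜 a b φ hφ) f = ∫ x, φ x • f x ∂(intervalMeasure a b) := by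
  rw [L2.inner_def]
  refine integral_congr_ae ?_
  filter_upwards [coeFn_contL2 (𝕜 := 𝕜) hφ] with x hx
  rw [hx, RCLike.inner_apply, RCLike.conj_ofReal, mul_comm, RCLike.real_smul_eq_coe_mul]

theorem inner_contL2_contL2 (hab : a ≤ b) {φ ψ : ℝ → ℝ} (hφ : Continuous φ) (hψ : Continuous ψ) :
    inner 𝕜 (contL2 𝕜 a b φ hφ) (contL2 𝕜 a b ψ hψ) = ((∫ x in a..b, φ x * ψ x : ℝ) : 𝕜) := by
  rw [inner_contL2, ← integral_interval_eq hab, ← integral_ofReal]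
  refine integral_congr_ae ?_
  filter_upwards [coeFn_contL2 (𝕜 := 𝕜) hψ] with x hx
  rw [hx, RCLike.real_smul_eq_coe_mul, RCLike.ofReal_mul]

theorem inner_piLp_single_left {ι : Type*} [Fintype ι] [DecidableEq ι] {E : Type*}
    [NormedAddCommGroup E] [InnerProductSpace 𝕜 E] (i : ι) (x : E) (f : PiLp 2 (fun _ : ι => E)) :
    inner 𝕜 (PiLp.single 2 i x) f = inner 𝕜 x (f i) := by
  rw [PiLp.inner_apply, Finset.sum_eq_single i]
  · simp
  · intro j _ hj
    simp [hj]
  · simp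

theorem deriv_mem_intervalTests {φ : ℝ → ℝ} (hφ : φ ∈ intervalTests a b) :
    deriv φ ∈ intervalTests a b :=
  ⟨((contDiff_infty_iff_deriv.mp hφ.1).2), hφ.2.1.deriv,
    (closure_minimal support_deriv_subset (isClosed_tsupport _)).trans hφ.2.2⟩

theorem iterate_deriv_mem_intervalTests {φ : ℝ → ℝ} (hφ : φ ∈ intervalTests a b) (l : ℕ) :
    deriv^[l] φ ∈ intervalTests a b := by
  induction l with
  | zero => exact hφ
  | succ l ih => rw [Function.iterate_succ_apply']; exact deriv_mem_intervalTests ih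

/-- The families orthogonal to all families of weak derivatives of order `l`. -/
def testJet (𝕜 : Type u) [RCLike 𝕜] (r : ℕ) (a b : ℝ) (l : Fin (r + 1)) (φ : intervalTests a b) :
    IntervalJet 𝕜 r a b :=
  (-1 : 𝕜) ^ (l : ℕ) • PiLp.single 2 l (contL2 𝕜 a b φ φ.2.1.continuous)
    - PiLp.single 2 0 (contL2 𝕜 a b (deriv^[(l : ℕ)] φ)
      (iterate_deriv_mem_intervalTests φ.2 l).1.continuous)

/-- The univariate Sobolev space `H^r([a,b])`, as a space of families of weak derivatives. -/
def intervalSobolev (𝕜 : Type u) [RCLike 𝕜] (r : ℕ) (a b : ℝ) :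
    Submodule 𝕜 (IntervalJet 𝕜 r a b) :=
  (Submodule.span 𝕜 {g | ∃ l φ, g = testJet 𝕜 r a b l φ})ᗮ

theorem inner_testJet (l : Fin (r + 1)) (φ : intervalTests a b) (f : IntervalJet 𝕜 r a b) :
    inner 𝕜 (testJet 𝕜 r a b l φ) f = (-1) ^ (l : ℕ) * ∫ x, φ.1 x • f l x ∂(intervalMeasure a b)
      - ∫ x, (deriv^[(l : ℕ)] φ.1) x • f 0 x ∂(intervalMeasure a b) := by
  rw [testJet, inner_sub_left, inner_smul_left, inner_piLp_single_left, inner_piLp_single_left,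
    inner_contL2, inner_contL2]
  simp

/-- Orthogonality to `testJet` is the defining identity of weak derivatives. The description as an
orthogonal complement makes the space closed and exhibits its own complement as the closed span of
the `testJet`s, which the tensor argument needs. -/
theorem mem_intervalSobolev_iff {f : IntervalJet 𝕜 r a b} :
    f ∈ intervalSobolev 𝕜 r a b ↔ ∀ (l : Fin (r + 1)), ∀ φ ∈ intervalTests a b,
      ∫ x, (deriv^[(l : ℕ)] φ) x • f 0 x ∂(intervalMeasure a b)
        = (-1) ^ (l : ℕ) * ∫ x, φ x • f l x ∂(intervalMeasure a b) := by
  constructor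
  · intro hf l φ hφ
    have := (Submodule.mem_orthogonal _ _).mp hf _ (Submodule.subset_span ⟨l, ⟨φ, hφ⟩, rfl⟩)
    rw [inner_testJet] at this
    exact (sub_eq_zero.mp this).symm
  · intro h
    rw [intervalSobolev, Submodule.mem_orthogonal]
    intro g hg
    induction hg using Submodule.span_induction with
    | mem g hg =>
      obtain ⟨l, φ, rfl⟩ := hg
      rw [inner_testJet, h l φ φ.2, sub_self]
    | zero => simp
    | add p q _ _ hp hq => rw [inner_add_left, hp, hq, add_zero]
    | smul c p _ hp => rw [inner_smul_left, hp, mul_zero]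

/-! ### Trigonometric functions in the Sobolev space -/

/-- `trigFun` as an element of `L²([a,b])`. -/
def trigL2 (𝕜 : Type u) [RCLike 𝕜] (a b : ℝ) (k : ℤ) (l : ℕ) : L2Interval 𝕜 a b :=
  contL2 𝕜 a b (trigFun a b k l) (contDiff_trigFun k l).continuous

/-- The family of derivatives of a trigonometric function. -/
def trigJet (𝕜 : Type u) [RCLike 𝕜] (r : ℕ) (a b : ℝ) (k : ℤ) : IntervalJet 𝕜 r a b :=
  WithLp.toLp 2 fun l => ((trigFreq a b k ^ (l : ℕ) : ℝ) : 𝕜) • trigL2 𝕜 a b k l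

/-- The ratio of the Sobolev norm and the `L²`-norm of a trigonometric function. -/
def trigWeight (r : ℕ) (a b : ℝ) (k : ℤ) : ℝ :=
  √(∑ l : Fin (r + 1), (trigFreq a b k ^ (l : ℕ)) ^ 2)

theorem trigWeight_sq (k : ℤ) :
    trigWeight r a b k ^ 2 = ∑ l : Fin (r + 1), (trigFreq a b k ^ (l : ℕ)) ^ 2 :=
  Real.sq_sqrt (Finset.sum_nonneg fun _ _ => sq_nonneg _)

theorem pow_le_trigWeight (hab : a < b) (k : ℤ) : trigFreq a b k ^ r ≤ trigWeight r a b k := by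
  have h := trigFreq_nonneg hab k
  refine Real.le_sqrt_of_sq_le ?_
  exact Finset.single_le_sum (f := fun l : Fin (r + 1) => (trigFreq a b k ^ (l : ℕ)) ^ 2)
    (fun _ _ => sq_nonneg _) (Finset.mem_univ (Fin.last r))

theorem one_le_trigWeight (k : ℤ) : 1 ≤ trigWeight r a b k := by
  refine Real.le_sqrt_of_sq_le ?_
  have h := Finset.single_le_sum (f := fun l : Fin (r + 1) => (trigFreq a b k ^ (l : ℕ)) ^ 2)
    (fun _ _ => sq_nonneg _) (Finset.mem_univ 0)
  simpa using h

/-- `∑ ξ^(2l) ≤ (∑ ξ^l)²`, and `∑ ξ^l ≤ (1 + ξ)^r` because binomial coefficients are at least one.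
An exact `r`-th power reduces the lower bound to counting products of `1 + ξ`, at no asymptotic
loss. -/
theorem trigWeight_le (hab : a < b) (k : ℤ) : trigWeight r a b k ≤ (1 + trigFreq a b k) ^ r := by
  have h := trigFreq_nonneg hab k
  refine Real.sqrt_le_iff.mpr ⟨by positivity, ?_⟩
  set ξ := trigFreq a b k
  rw [Fin.sum_univ_eq_sum_range (fun l => (ξ ^ l) ^ 2)]
  have h1 : (∑ l ∈ Finset.range (r + 1), (ξ ^ l) ^ 2) ≤ (∑ l ∈ Finset.range (r + 1), ξ ^ l) ^ 2 :=
    Finset.sum_sq_le_sq_sum_of_nonneg fun _ _ => by positivity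
  refine h1.trans ?_
  gcongr
  rw [add_comm 1 ξ, add_pow]
  refine Finset.sum_le_sum fun l hl => ?_
  rw [one_pow, mul_one]
  refine le_mul_of_one_le_right (by positivity) ?_
  exact_mod_cast Nat.choose_pos (Nat.lt_succ_iff.mp (Finset.mem_range.mp hl))

theorem inner_trigL2_of_ne (hab : a < b) {j k : ℤ} (hjk : j ≠ k) (l : ℕ) :
    inner 𝕜 (trigL2 𝕜 a b j l) (trigL2 𝕜 a b k l) = 0 := by
  rw [trigL2, trigL2, inner_contL2_contL2 hab.le, integral_trigFun_mul_of_ne hab hjk,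
    RCLike.ofReal_zero]

theorem norm_sq_trigL2 (hab : a < b) (k : ℤ) (l : ℕ) :
    ‖trigL2 𝕜 a b k l‖ ^ 2 = ∫ x in a..b, trigFun a b k l x * trigFun a b k l x := by
  rw [← inner_self_eq_norm_sq (𝕜 := 𝕜), trigL2, inner_contL2_contL2 hab.le, RCLike.ofReal_re]

theorem norm_trigL2_pos (hab : a < b) (k : ℤ) : 0 < ‖trigL2 𝕜 a b k 0‖ := by
  have := integral_trigFun_zero_sq_pos hab k
  rw [← norm_sq_trigL2 (𝕜 := 𝕜) hab] at this
  exact (sq_pos_iff.mp this).lt_of_le' (norm_nonneg _)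

theorem inner_trigJet_of_ne (hab : a < b) {j k : ℤ} (hjk : j ≠ k) :
    inner 𝕜 (trigJet 𝕜 r a b j) (trigJet 𝕜 r a b k) = 0 := by
  rw [PiLp.inner_apply]
  refine Finset.sum_eq_zero fun l _ => ?_
  simp only [trigJet]
  rw [inner_smul_left, inner_smul_right, inner_trigL2_of_ne hab hjk, mul_zero, mul_zero]

theorem norm_trigJet (hab : a < b) (k : ℤ) :
    ‖trigJet 𝕜 r a b k‖ = trigWeight r a b k * ‖trigL2 𝕜 a b k 0‖ := by
  have hw : 0 ≤ trigWeight r a b k := zero_le_one.trans (one_le_trigWeight k)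
  have : ‖trigJet 𝕜 r a b k‖ ^ 2 = (trigWeight r a b k * ‖trigL2 𝕜 a b k 0‖) ^ 2 := by
    rw [PiLp.norm_sq_eq_of_L2, mul_pow, trigWeight_sq, Finset.sum_mul]
    refine Finset.sum_congr rfl fun l _ => ?_
    simp only [trigJet]
    rw [norm_smul, mul_pow, norm_sq_trigL2 hab, norm_sq_trigL2 hab, RCLike.norm_ofReal, sq_abs,
      integral_trigFun_sq hab]
  exact (sq_eq_sq₀ (norm_nonneg _) (by positivity)).mp this

theorem integral_iterate_deriv_mul_trigFun (k : ℤ) (l : ℕ) {φ : ℝ → ℝ}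
    (hφ : φ ∈ intervalTests a b) :
    ∫ x in a..b, (deriv^[l] φ) x * trigFun a b k 0 x
      = (-1) ^ l * trigFreq a b k ^ l * ∫ x in a..b, φ x * trigFun a b k l x := by
  induction l generalizing φ with
  | zero => simp
  | succ l ih =>
    rw [Function.iterate_succ_apply, ih (deriv_mem_intervalTests hφ)]
    have h0 : ∀ x, x ∉ Set.Ioo a b → φ x = 0 := fun x hx =>
      image_eq_zero_of_notMem_tsupport fun h => hx (hφ.2.2 h)
    have hparts := intervalIntegral.integral_deriv_mul_eq_sub (a := a) (b := b)
      (u := φ) (v := trigFun a b k l) (u' := deriv φ)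
      (v' := fun x => trigFreq a b k * trigFun a b k (l + 1) x)
      (fun x _ => (hφ.1.differentiable (by simp)).differentiableAt.hasDerivAt)
      (fun x _ => hasDerivAt_trigFun k l x)
      ((hφ.1.continuous_deriv (by simp)).intervalIntegrable _ _)
      ((continuous_const.mul (contDiff_trigFun k (l + 1)).continuous).intervalIntegrable _ _)
    rw [h0 a (by simp), h0 b (by simp), zero_mul, zero_mul, sub_zero,
      intervalIntegral.integral_add (f := fun x => deriv φ x * trigFun a b k l x)
        (g := fun x => φ x * (trigFreq a b k * trigFun a b k (l + 1) x))
        (((hφ.1.continuous_deriv (by simp)).mul (contDiff_trigFun k l).continuous).intervalIntegrable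
          _ _)
        ((hφ.1.continuous.mul (continuous_const.mul
          (contDiff_trigFun k (l + 1)).continuous)).intervalIntegrable _ _)] at hparts
    have : ∫ x in a..b, φ x * (trigFreq a b k * trigFun a b k (l + 1) x)
        = trigFreq a b k * ∫ x in a..b, φ x * trigFun a b k (l + 1) x := by
      rw [← intervalIntegral.integral_const_mul]
      exact intervalIntegral.integral_congr fun x _ => by ring
    rw [this] at hparts
    rw [eq_neg_of_add_eq_zero_left hparts]
    ring

theorem trigJet_mem_intervalSobolev (hab : a < b) (k : ℤ) :
    trigJet 𝕜 r a b k ∈ intervalSobolev 𝕜 r a b := by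
  rw [mem_intervalSobolev_iff]
  intro l φ hφ
  have h1 := (iterate_deriv_mem_intervalTests hφ l).1.continuous
  rw [← inner_contL2 h1, ← inner_contL2 hφ.1.continuous]
  simp only [trigJet, inner_smul_right]
  rw [trigL2, trigL2, inner_contL2_contL2 hab.le, inner_contL2_contL2 hab.le]
  simp only [Fin.val_zero, pow_zero, RCLike.ofReal_one, one_mul]
  rw [integral_iterate_deriv_mul_trigFun k l hφ]
  push_cast
  ring

/-- The partial Fourier coefficients of weak derivatives with vanishing means. -/
theorem inner_trigL2_eq (hab : a < b) {f : IntervalJet 𝕜 r a b} (hf : f ∈ intervalSobolev 𝕜 r a b)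
    (hf0 : ∀ l : Fin (r + 1), l ≠ 0 → ∫ x, f l x ∂(intervalMeasure a b) = 0) (k : ℤ) (l : ℕ)
    (hl : l < r + 1) (m : ℕ) :
    inner 𝕜 (trigL2 𝕜 a b k m) (f ⟨l, hl⟩)
      = (((-1) ^ l * trigFreq a b k ^ l : ℝ) : 𝕜) * inner 𝕜 (trigL2 𝕜 a b k (m + l)) (f 0) := by
  induction l generalizing m with
  | zero => simp
  | succ l ih =>
    have hl' : l < r + 1 := by omega
    have hmem := mem_intervalSobolev_iff.mp hf
    -- Membership only relates each component to `f 0`. Comparing order `l` tested with `φ'` and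
    -- order `l + 1` tested with `φ` shows that component `l + 1` is the weak derivative of
    -- component `l`.
    have hweak : ∀ φ ∈ intervalTests a b,
        ∫ x, deriv φ x • f ⟨l, hl'⟩ x ∂(intervalMeasure a b)
          = -∫ x, φ x • f ⟨l + 1, hl⟩ x ∂(intervalMeasure a b) := by
      intro φ hφ
      have h1 := hmem ⟨l, hl'⟩ _ (deriv_mem_intervalTests hφ)
      have h2 := hmem ⟨l + 1, hl⟩ φ hφ
      simp only at h1 h2
      rw [← Function.iterate_succ_apply, h2, pow_succ, mul_assoc] at h1
      have h3 := mul_left_cancel₀ (pow_ne_zero _ (by norm_num : (-1 : 𝕜) ≠ 0)) h1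
      rw [← h3, neg_one_mul]
    have h := integral_deriv_smul_eq_of_periodic hab (integrable_L2Interval _)
      (integrable_L2Interval _) hweak (hf0 _ (by simp [Fin.ext_iff])) (contDiff_trigFun k m)
      (by rw [← trigFun_add_period hab k m a, add_sub_cancel])
    rw [deriv_trigFun] at h
    simp only [mul_smul] at h
    rw [integral_smul] at h
    rw [trigL2, inner_contL2, ← neg_eq_iff_eq_neg.mpr h, ← inner_contL2
      (contDiff_trigFun k (m + 1)).continuous]
    have := ih hl' (m + 1)
    rw [trigL2] at this
    rw [this, RCLike.real_smul_eq_coe_mul, show m + 1 + l = m + (l + 1) by ring]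
    push_cast
    ring

/-- On jets with mean-free derivatives the trigonometric functions diagonalize both scalar products.
Integrating by parts `l` times gives the sign `(-1)^l` and `l` further phase shifts; the resulting
`2 l` shifts give the same sign again. -/
theorem inner_trigJet_eq (hab : a < b) {f : IntervalJet 𝕜 r a b} (hf : f ∈ intervalSobolev 𝕜 r a b)
    (hf0 : ∀ l : Fin (r + 1), l ≠ 0 → ∫ x, f l x ∂(intervalMeasure a b) = 0) (k : ℤ) :
    inner 𝕜 (trigJet 𝕜 r a b k) f
      = ((trigWeight r a b k ^ 2 : ℝ) : 𝕜) * inner 𝕜 (trigL2 𝕜 a b k 0) (f 0) := by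
  have hdouble : ∀ l : ℕ, inner 𝕜 (trigL2 𝕜 a b k (l + l)) (f 0)
      = (((-1) ^ l : ℝ) : 𝕜) * inner 𝕜 (trigL2 𝕜 a b k 0) (f 0) := by
    intro l
    rw [trigL2, trigL2, inner_contL2, inner_contL2, ← RCLike.real_smul_eq_coe_mul, ← integral_smul]
    refine integral_congr_ae (Eventually.of_forall fun x => ?_)
    simp only
    rw [← two_mul, trigFun_double, mul_smul]
  rw [PiLp.inner_apply, trigWeight_sq, RCLike.ofReal_sum, Finset.sum_mul]
  refine Finset.sum_congr rfl fun l _ => ?_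
  simp only [trigJet]
  rw [inner_smul_left, RCLike.conj_ofReal, inner_trigL2_eq hab hf hf0 k l l.2, hdouble,
    ← mul_assoc, ← mul_assoc]
  congr 1
  norm_cast
  have : ((-1 : ℝ) ^ (l : ℕ)) * (-1) ^ (l : ℕ) = 1 := by rw [← mul_pow]; simp
  calc _ = (trigFreq a b k ^ (l : ℕ)) ^ 2 * ((-1 : ℝ) ^ (l : ℕ) * (-1) ^ (l : ℕ)) := by
        push_cast; ring
    _ = _ := by rw [this, mul_one]

theorem eq_zero_of_forall_inner_trigL2 (hab : a < b) {g : L2Interval 𝕜 a b}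
    (h : ∀ k, inner 𝕜 (trigL2 𝕜 a b k 0) g = 0) : g = 0 := by
  rw [Lp.eq_zero_iff_ae_eq_zero]
  refine ae_eq_zero_of_forall_trigFun hab (Lp.memLp g) fun k => ?_
  rw [← inner_contL2 (contDiff_trigFun k 0).continuous]
  exact h k

/-- The trigonometric orthonormal basis of `L²([a,b])`. -/
theorem exists_trigBasis (𝕜 : Type u) [RCLike 𝕜] (hab : a < b) :
    ∃ e : HilbertBasis ℤ 𝕜 (L2Interval 𝕜 a b),
      ∀ k, e k = ((‖trigL2 𝕜 a b k 0‖⁻¹ : ℝ) : 𝕜) • trigL2 𝕜 a b k 0 := by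
  have hon : Orthonormal 𝕜 fun k => ((‖trigL2 𝕜 a b k 0‖⁻¹ : ℝ) : 𝕜) • trigL2 𝕜 a b k 0 := by
    constructor
    · intro k
      have := norm_trigL2_pos (𝕜 := 𝕜) hab k
      rw [norm_smul, RCLike.norm_ofReal, abs_of_pos (inv_pos.mpr this), inv_mul_cancel₀ this.ne']
    · intro j k hjk
      rw [inner_smul_left, inner_smul_right, inner_trigL2_of_ne hab hjk, mul_zero, mul_zero]
  refine ⟨HilbertBasis.mkOfOrthogonalEqBot hon ?_, fun k => ?_⟩
  · rw [eq_bot_iff]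
    intro g hg
    refine eq_zero_of_forall_inner_trigL2 hab fun k => ?_
    have := (Submodule.mem_orthogonal _ _).mp hg _ (Submodule.subset_span ⟨k, rfl⟩)
    rw [inner_smul_left] at this
    refine (mul_eq_zero.mp this).resolve_left ?_
    have := norm_trigL2_pos (𝕜 := 𝕜) hab k
    simpa using this.ne'
  · rw [HilbertBasis.coe_mkOfOrthogonalEqBot]

/-- Functions in the Sobolev space with periodic derivatives and without low frequencies are
small in `L²`. -/
theorem norm_le_of_low_frequencies_eq_zero (hab : a < b) {f : IntervalJet 𝕜 r a b}
    (hf : f ∈ intervalSobolev 𝕜 r a b)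
    (hf0 : ∀ l : Fin (r + 1), l ≠ 0 → ∫ x, f l x ∂(intervalMeasure a b) = 0) (M : ℕ)
    (hM : ∀ k ∈ Finset.Icc (-(M : ℤ)) M, inner 𝕜 (trigL2 𝕜 a b k 0) (f 0) = 0) :
    ‖f 0‖ ≤ ‖f‖ / (2 * Real.pi * (M + 1) / (b - a)) ^ r := by
  have hba : 0 < b - a := by linarith
  obtain ⟨e, he⟩ := exists_trigBasis 𝕜 hab
  have hw : ∀ k, 0 < trigWeight r a b k := fun k => zero_lt_one.trans_le (one_le_trigWeight k)
  have ht := fun k => norm_trigL2_pos (𝕜 := 𝕜) hab k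
  set h : ℤ → IntervalJet 𝕜 r a b := fun k => ((‖trigJet 𝕜 r a b k‖⁻¹ : ℝ) : 𝕜) • trigJet 𝕜 r a b k
    with hh
  have hJ : ∀ k, 0 < ‖trigJet 𝕜 r a b k‖ := fun k => by
    rw [norm_trigJet hab]; exact mul_pos (hw k) (ht k)
  have hon : Orthonormal 𝕜 h := by
    constructor
    · intro k
      rw [hh]
      simp only
      rw [norm_smul, RCLike.norm_ofReal, abs_of_pos (inv_pos.mpr (hJ k)),
        inv_mul_cancel₀ (hJ k).ne']
    · intro j k hjk
      simp only [hh]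
      rw [inner_smul_left, inner_smul_right, inner_trigJet_of_ne hab hjk, mul_zero, mul_zero]
  have hrel : ∀ k, inner 𝕜 (h k) f = (trigWeight r a b k : 𝕜) * inner 𝕜 (e k) (f 0) := by
    intro k
    rw [he, hh]
    simp only
    rw [inner_smul_left, inner_smul_left, inner_trigJet_eq hab hf hf0, RCLike.conj_ofReal,
      RCLike.conj_ofReal, norm_trigJet hab, ← mul_assoc, ← mul_assoc, ← RCLike.ofReal_mul,
      ← RCLike.ofReal_mul]
    congr 2
    have := (hw k).ne'
    have := (ht k).ne'
    field_simp
  -- The low-frequency part vanishes by `hM`, so the truncation error is `f 0` itself. All other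
  -- frequencies have `|k| ≥ M + 1`.
  have hmain := norm_sub_sum_inner_le e hon hrel (Finset.Icc (-(M : ℤ)) M)
    (t := (2 * Real.pi * (M + 1) / (b - a)) ^ r) (by have := Real.pi_pos; positivity) ?_
  · rw [Finset.sum_eq_zero, sub_zero] at hmain
    · exact hmain
    · intro k hk
      rw [he, inner_smul_left, hM k hk, mul_zero, zero_smul]
  · intro k hk
    refine le_trans ?_ (pow_le_trigWeight hab k)
    have hk' : (M : ℝ) + 1 ≤ ((|k| : ℤ) : ℝ) := by
      rw [Finset.mem_Icc, ← abs_le, not_le] at hk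
      exact_mod_cast hk
    have := Real.pi_pos
    unfold trigFreq
    gcongr

end Jet

/-! ### Singular values of the univariate embedding -/

section Singular

variable {𝕜 : Type u} [RCLike 𝕜] {a b : ℝ} {r : ℕ}

/-- The embedding of the univariate Sobolev space into `L²([a,b])`. -/
def intervalEmbedding (𝕜 : Type u) [RCLike 𝕜] (r : ℕ) (a b : ℝ) :
    intervalSobolev 𝕜 r a b →L[𝕜] L2Interval 𝕜 a b :=
  (PiLp.proj 2 (fun _ : Fin (r + 1) => L2Interval 𝕜 a b) 0).comp
    (intervalSobolev 𝕜 r a b).subtypeL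

/-- `r + 2 M + 1` functionals that control the embedding of the univariate Sobolev space. -/
theorem exists_functionals (𝕜 : Type u) [RCLike 𝕜] (r : ℕ) (hab : a < b) (M : ℕ) :
    ∃ L : intervalSobolev 𝕜 r a b →L[𝕜] (Fin (r + 2 * M + 1) → 𝕜),
      ∀ f, L f = 0 → ‖intervalEmbedding 𝕜 r a b f‖
        ≤ ‖f‖ / (2 * Real.pi * (M + 1) / (b - a)) ^ r := by
  -- The functionals are the means of the derivatives of orders `1, …, r` and the `2 M + 1` lowest
  -- Fourier coefficients.
  let ℓ : Fin r ⊕ Finset.Icc (-(M : ℤ)) M → intervalSobolev 𝕜 r a b →L[𝕜] 𝕜 := Sum.elim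
    (fun l => (innerSL 𝕜 (contL2 𝕜 a b (fun _ => 1) continuous_const)).comp
      ((PiLp.proj 2 (fun _ : Fin (r + 1) => L2Interval 𝕜 a b) l.succ).comp
        (intervalSobolev 𝕜 r a b).subtypeL))
    (fun k => (innerSL 𝕜 (trigL2 𝕜 a b k 0)).comp (intervalEmbedding 𝕜 r a b))
  have hcard : Fintype.card (Fin r ⊕ Finset.Icc (-(M : ℤ)) M) = r + 2 * M + 1 := by
    simp
    omega
  let σ := Fintype.equivFinOfCardEq hcard
  refine ⟨ContinuousLinearMap.pi fun i => ℓ (σ.symm i), fun f hf => ?_⟩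
  have hℓ : ∀ j, ℓ j f = 0 := fun j => by
    have := congrFun hf (σ j)
    simpa using this
  refine norm_le_of_low_frequencies_eq_zero hab f.2 (fun l hl => ?_) M fun k hk => ?_
  · obtain ⟨l', rfl⟩ := Fin.exists_succ_eq.mpr hl
    have h : inner 𝕜 (contL2 𝕜 a b (fun _ => 1) continuous_const) ((f : IntervalJet 𝕜 r a b) l'.succ)
      = 0 := hℓ (Sum.inl l')
    rw [inner_contL2] at h
    simpa using h
  · exact hℓ (Sum.inr ⟨k, hk⟩)

/-- The singular system of the embedding of the univariate Sobolev space into `L²`. -/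
theorem exists_interval_singular_system (𝕜 : Type u) [RCLike 𝕜] (hr : 1 ≤ r) (hab : a < b) :
    ∃ (I : Type u) (e : HilbertBasis I 𝕜 (L2Interval 𝕜 a b)) (h : I → IntervalJet 𝕜 r a b)
      (w : I → ℝ), Orthonormal 𝕜 h ∧ (∀ i, 1 ≤ w i) ∧
      (∀ i, h i - PiLp.single 2 0 ((w i : 𝕜) • e i) ∈ (intervalSobolev 𝕜 r a b)ᗮ) ∧
      ∀ (M : ℕ) (F : Finset I), (∀ i ∈ F, w i < (2 * Real.pi * (M + 1) / (b - a)) ^ r) →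
        F.card ≤ r + 2 * M + 1 := by
  have hba : 0 < b - a := by linarith
  have hπ := Real.pi_pos
  have hcomplete : CompleteSpace (intervalSobolev 𝕜 r a b) :=
    (Submodule.isClosed_orthogonal _).completeSpace_coe
  -- The trigonometric functions lie in the Sobolev space and are total in `L²`.
  have hdense : ∀ y, (∀ x, inner 𝕜 (intervalEmbedding 𝕜 r a b x) y = 0) → y = 0 := by
    intro y hy
    refine eq_zero_of_forall_inner_trigL2 hab fun k => ?_
    have := hy ⟨_, trigJet_mem_intervalSobolev hab k⟩
    change inner 𝕜 (((trigFreq a b k ^ 0 : ℝ) : 𝕜) • trigL2 𝕜 a b k 0) y = 0 at this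
    simpa using this
  have hsmall : ∀ t : ℝ, 0 < t → ∃ (n : ℕ) (L : intervalSobolev 𝕜 r a b →L[𝕜] (Fin n → 𝕜)),
      ∀ f, L f = 0 → ‖intervalEmbedding 𝕜 r a b f‖ ≤ ‖f‖ / t := by
    intro t ht
    -- The maximum with `1` makes the base at least one, so that its `r`-th power dominates it.
    obtain ⟨M, hM⟩ := exists_nat_ge (max 1 t * (b - a) / (2 * Real.pi))
    obtain ⟨L, hL⟩ := exists_functionals 𝕜 r hab M
    refine ⟨_, L, fun f hf => (hL f hf).trans ?_⟩
    have h1 : max 1 t ≤ 2 * Real.pi * (M + 1) / (b - a) := by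
      rw [div_le_iff₀ (by positivity)] at hM
      rw [le_div_iff₀ hba]
      nlinarith
    have h2 : t ≤ (2 * Real.pi * (M + 1) / (b - a)) ^ r :=
      (le_max_right 1 t).trans (h1.trans
        (le_self_pow₀ ((le_max_left 1 t).trans h1) (by omega)))
    gcongr
  obtain ⟨I, e, h, w, hh, hw, hSh, hrel⟩ :=
    exists_singular_system (intervalEmbedding 𝕜 r a b) hdense hsmall
  refine ⟨I, e, fun i => (h i : IntervalJet 𝕜 r a b), w, ?_, fun i => ?_, fun i => ?_,
    fun M F hF => ?_⟩
  · exact hh.comp_linearIsometry (intervalSobolev 𝕜 r a b).subtypeₗᵢ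
  · have h1 : ‖intervalEmbedding 𝕜 r a b (h i)‖ ≤ ‖h i‖ :=
      PiLp.norm_apply_le (h i : IntervalJet 𝕜 r a b) 0
    rw [hSh, norm_smul, e.orthonormal.1 i, hh.1 i, mul_one, norm_inv, RCLike.norm_ofReal,
      abs_of_pos (hw i)] at h1
    exact (inv_le_one₀ (hw i)).mp h1
  -- The relation `⟪h i, f⟫ = w i * ⟪e i, f 0⟫` is recast as orthogonality to the Sobolev space, the
  -- form that passes to tensor products.
  · rw [Submodule.mem_orthogonal']
    intro f hf
    rw [inner_sub_left, inner_piLp_single_left, inner_smul_left, RCLike.conj_ofReal, sub_eq_zero]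
    exact hrel i ⟨f, hf⟩
  · obtain ⟨L, hL⟩ := exists_functionals 𝕜 r hab M
    exact card_le_of_finite_codim hh hw hSh (by positivity) L hL F hF

end Singular

/-! ## Tensor products -/

/-- Multilinear maps with `⟪T u, T v⟫ = ∏ ⟪u i, v i⟫`. -/
def IsTensorMap {𝕜 : Type*} [RCLike 𝕜] {ι : Type*} [Fintype ι] {E H : Type*}
    [NormedAddCommGroup E] [InnerProductSpace 𝕜 E] [NormedAddCommGroup H] [InnerProductSpace 𝕜 H]
    (T : MultilinearMap 𝕜 (fun _ : ι => E) H) : Prop :=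
  ∀ u v, inner 𝕜 (T u) (T v) = ∏ i, inner 𝕜 (u i) (v i)

namespace IsTensorMap

variable {𝕜 : Type*} [RCLike 𝕜] {ι : Type*} [Fintype ι] {E H : Type*}
  [NormedAddCommGroup E] [InnerProductSpace 𝕜 E] [NormedAddCommGroup H] [InnerProductSpace 𝕜 H]
  {T : MultilinearMap 𝕜 (fun _ : ι => E) H}

theorem norm_apply (hT : IsTensorMap T) (u : ι → E) : ‖T u‖ = ∏ i, ‖u i‖ := by
  have h := hT u u
  simp only [inner_self_eq_norm_sq_to_K] at h
  have h' : ‖T u‖ ^ 2 = (∏ i, ‖u i‖) ^ 2 := by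
    rw [← Finset.prod_pow]
    exact_mod_cast h
  exact (sq_eq_sq₀ (norm_nonneg _) (Finset.prod_nonneg fun _ _ => norm_nonneg _)).mp h'

theorem orthonormal (hT : IsTensorMap T) {I : Type*} {e : I → E} (he : Orthonormal 𝕜 e) :
    Orthonormal 𝕜 fun m : ι → I => T fun i => e (m i) := by
  constructor
  · intro m
    rw [hT.norm_apply]
    exact Finset.prod_eq_one fun i _ => he.1 _
  · intro m m' hne
    rw [hT]
    obtain ⟨i, hi⟩ := Function.ne_iff.mp hne
    exact Finset.prod_eq_zero (Finset.mem_univ i) (he.2 hi)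

/-- A tensor map is linear and bounded in each argument, since its norm is the product of the norms.
So vanishing on `A` in one slot extends to the closed span. -/
theorem inner_update_eq_zero [DecidableEq ι] (hT : IsTensorMap T) {F : H} {u : ι → E} {i : ι}
    {A : Set E} (h : ∀ y ∈ A, inner 𝕜 (T (Function.update u i y)) F = 0) {x : E}
    (hx : x ∈ (Submodule.span 𝕜 A).topologicalClosure) :
    inner 𝕜 (T (Function.update u i x)) F = 0 := by
  have hcont : Continuous fun y => T (Function.update u i y) := by
    have hlip : ∀ y, ‖T.toLinearMap u i y‖ ≤ (∏ j ∈ Finset.univ.erase i, ‖u j‖) * ‖y‖ := by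
      intro y
      rw [MultilinearMap.toLinearMap_apply, hT.norm_apply,
        ← Finset.mul_prod_erase _ _ (Finset.mem_univ i), Function.update_self, mul_comm]
      refine le_of_eq ?_
      congr 1
      refine Finset.prod_congr rfl fun j hj => ?_
      rw [Function.update_of_ne (Finset.ne_of_mem_erase hj)]
    exact (LinearMap.mkContinuous (T.toLinearMap u i) _ hlip).continuous
  have hclosed : IsClosed {y : E | inner 𝕜 (T (Function.update u i y)) F = 0} :=
    isClosed_eq (hcont.inner continuous_const) continuous_const
  refine closure_minimal (fun y hy => ?_) hclosed hx
  induction hy using Submodule.span_induction with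
  | mem y hy => exact h y hy
  | zero =>
    simp only [Set.mem_ofPred_eq, MultilinearMap.map_update_zero, inner_zero_left]
  | add p q _ _ hp hq =>
    simp only [Set.mem_ofPred_eq, MultilinearMap.map_update_add, inner_add_left] at hp hq ⊢
    rw [hp, hq, add_zero]
  | smul c p _ hp =>
    simp only [Set.mem_ofPred_eq, MultilinearMap.map_update_smul, inner_smul_left] at hp ⊢
    rw [hp, mul_zero]

/-- Orthogonality to elementary tensors extends from generating sets to closed spans. -/
theorem inner_eq_zero_of_span (hT : IsTensorMap T) {F : H} {A : ι → Set E}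
    (h : ∀ u : ι → E, (∀ i, u i ∈ A i) → inner 𝕜 (T u) F = 0) {u : ι → E}
    (hu : ∀ i, u i ∈ (Submodule.span 𝕜 (A i)).topologicalClosure) : inner 𝕜 (T u) F = 0 := by
  classical
  -- `S` collects the slots already enlarged from the generating set to its closed span.
  have key : ∀ S : Finset ι, ∀ u : ι → E,
      (∀ i ∈ S, u i ∈ (Submodule.span 𝕜 (A i)).topologicalClosure) → (∀ i ∉ S, u i ∈ A i) →
      inner 𝕜 (T u) F = 0 := by
    intro S
    induction S using Finset.induction_on with
    | empty => exact fun u _ h2 => h u fun i => h2 i (Finset.notMem_empty i)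
    | insert i S hi ih =>
      intro u h1 h2
      rw [← Function.update_eq_self i u]
      refine hT.inner_update_eq_zero (A := A i) (fun y hy => ih _ (fun j hj => ?_) fun j hj => ?_)
        (h1 i (Finset.mem_insert_self i S))
      · rw [Function.update_of_ne (ne_of_mem_of_not_mem hj hi)]
        exact h1 j (Finset.mem_insert_of_mem hj)
      · by_cases hji : j = i
        · subst hji; simpa using hy
        · rw [Function.update_of_ne hji]
          exact h2 j (by simp [hji, hj])
  exact key Finset.univ u (fun i _ => hu i) fun i hi => absurd (Finset.mem_univ i) hi

end IsTensorMap

/-- If `F` is orthogonal to all elementary tensors with a factor in `K`, then `⟪T u, F⟫` depends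
only on the factors modulo `K`. -/
theorem inner_eq_inner_of_sub_mem {𝕜 : Type*} [RCLike 𝕜] {ι : Type*} {E H : Type*}
    [NormedAddCommGroup E] [InnerProductSpace 𝕜 E] [NormedAddCommGroup H] [InnerProductSpace 𝕜 H]
    [Fintype ι] {T : MultilinearMap 𝕜 (fun _ : ι => E) H} {F : H} {K : Submodule 𝕜 E}
    (h : ∀ (u : ι → E) (i : ι), u i ∈ K → inner 𝕜 (T u) F = 0) {u v : ι → E}
    (huv : ∀ i, u i - v i ∈ K) : inner 𝕜 (T u) F = inner 𝕜 (T v) F := by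
  classical
  -- The factors are exchanged one at a time, each exchange changing the tensor by one with a factor
  -- in `K`.
  have key : ∀ S : Finset ι, inner 𝕜 (T u) F = inner 𝕜 (T (S.piecewise v u)) F := by
    intro S
    induction S using Finset.induction_on with
    | empty => simp
    | insert i S hi ih =>
      rw [ih, Finset.piecewise_insert, ← sub_eq_zero, ← inner_sub_left]
      have h1 : S.piecewise v u = Function.update (S.piecewise v u) i (u i) := by
        rw [Function.eq_update_iff]
        exact ⟨by simp [hi], fun _ _ => rfl⟩
      nth_rewrite 1 [h1]
      rw [← MultilinearMap.map_update_sub]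
      exact h _ i (by simpa using huv i)
  rw [key Finset.univ, Finset.piecewise_univ]

/-! ### Tensor products of functions on the interval -/

theorem cubeMeasure_eq_pi (d : ℕ) (a b : ℝ) :
    cubeMeasure d a b = Measure.pi fun _ : Fin d => intervalMeasure a b := by
  rw [cubeMeasure, cube, ← Set.pi_univ_Icc, volume_pi, Measure.restrict_pi_pi]

section Tens

variable {𝕜 : Type u} [RCLike 𝕜] {d r : ℕ} {a b : ℝ}

theorem quasiMeasurePreserving_eval_cube (j : Fin d) :
    Measure.QuasiMeasurePreserving (Function.eval j) (cubeMeasure d a b) (intervalMeasure a b) := by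
  rw [cubeMeasure_eq_pi]
  exact Measure.quasiMeasurePreserving_eval _ j

theorem memLp_prod (u : Fin d → L2Interval 𝕜 a b) :
    MemLp (fun x : Fin d → ℝ => ∏ j, u j (x j)) 2 (cubeMeasure d a b) := by
  have hmeas : AEStronglyMeasurable (fun x : Fin d → ℝ => ∏ j, u j (x j)) (cubeMeasure d a b) := by
    refine Finset.aestronglyMeasurable_fun_prod _ fun j _ => ?_
    exact (Lp.aestronglyMeasurable (u j)).comp_quasiMeasurePreserving
      (quasiMeasurePreserving_eval_cube j)
  rw [memLp_two_iff_integrable_sq_norm hmeas]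
  simp only [norm_prod, ← Finset.prod_pow]
  rw [cubeMeasure_eq_pi]
  exact Integrable.fintype_prod (f := fun j x => ‖u j x‖ ^ 2) fun j =>
    (memLp_two_iff_integrable_sq_norm (Lp.aestronglyMeasurable _)).mp (Lp.memLp (u j))

/-- The function `∏ u_j(x_j)`. -/
def tens (u : Fin d → L2Interval 𝕜 a b) : L2Cube 𝕜 d a b := (memLp_prod u).toLp _

theorem coeFn_tens (u : Fin d → L2Interval 𝕜 a b) :
    tens u =ᵐ[cubeMeasure d a b] fun x => ∏ j, u j (x j) :=
  MemLp.coeFn_toLp _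

/-- The tensor product of functions on the interval as a multilinear map. -/
def tensMap (𝕜 : Type u) [RCLike 𝕜] (d : ℕ) (a b : ℝ) :
    MultilinearMap 𝕜 (fun _ : Fin d => L2Interval 𝕜 a b) (L2Cube 𝕜 d a b) where
  toFun := tens
  map_update_add' u i p q := by
    refine Lp.ext ?_
    have h := (quasiMeasurePreserving_eval_cube (d := d) i).ae (Lp.coeFn_add p q)
    filter_upwards [coeFn_tens (Function.update u i (p + q)), coeFn_tens (Function.update u i p),
      coeFn_tens (Function.update u i q), Lp.coeFn_add (tens (Function.update u i p))
        (tens (Function.update u i q)), h] with x h1 h2 h3 h4 h5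
    rw [h1, h4, Pi.add_apply, h2, h3]
    simp only [Function.eval, Pi.add_apply] at h5
    simp only [Function.apply_update (fun j (f : L2Interval 𝕜 a b) => f (x j)),
      Finset.prod_update_of_mem (Finset.mem_univ i), h5, add_mul]
  map_update_smul' u i c p := by
    refine Lp.ext ?_
    have h := (quasiMeasurePreserving_eval_cube (d := d) i).ae (Lp.coeFn_smul c p)
    filter_upwards [coeFn_tens (Function.update u i (c • p)), coeFn_tens (Function.update u i p),
      Lp.coeFn_smul c (tens (Function.update u i p)), h] with x h1 h2 h3 h5
    rw [h1, h3, Pi.smul_apply, h2]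
    simp only [Function.eval, Pi.smul_apply] at h5
    simp only [Function.apply_update (fun j (f : L2Interval 𝕜 a b) => f (x j)),
      Finset.prod_update_of_mem (Finset.mem_univ i), h5, smul_mul_assoc]

theorem isTensorMap_tensMap : IsTensorMap (tensMap 𝕜 d a b) := by
  intro u v
  change inner 𝕜 (tens u) (tens v) = _
  simp only [L2.inner_def]
  rw [← integral_fintype_prod_eq_prod (fun j x => inner 𝕜 (u j x) (v j x)), ← cubeMeasure_eq_pi]
  refine integral_congr_ae ?_
  filter_upwards [coeFn_tens u, coeFn_tens v] with x h1 h2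
  rw [h1, h2]
  simp only [RCLike.inner_apply, map_prod, Finset.prod_mul_distrib]

theorem integrable_L2Cube (F : L2Cube 𝕜 d a b) : Integrable F (cubeMeasure d a b) := by
  simpa using integrable_smul (ψ := fun _ => (1 : ℝ)) continuous_const F

/-- Elementary tensors are total in `L²` of the cube. -/
theorem eq_zero_of_forall_inner_tens {F : L2Cube 𝕜 d a b} (h : ∀ u, inner 𝕜 (tens u) F = 0) :
    F = 0 := by
  have hint := integrable_L2Cube F
  -- The indicator of a measurable box is an elementary tensor. Boxes form a π-system generating the
  -- σ-algebra, so all set integrals of `F` vanish.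
  have hbox : ∀ s : Fin d → Set ℝ, (∀ j, MeasurableSet (s j)) →
      ∫ x in Set.pi Set.univ s, F x ∂(cubeMeasure d a b) = 0 := by
    intro s hs
    have hu := h fun j => indicatorConstLp 2 (hs j) (measure_ne_top _ _) (1 : 𝕜)
    rw [← integral_indicator (MeasurableSet.univ_pi hs), ← hu, L2.inner_def]
    refine integral_congr_ae ?_
    have hall : ∀ᵐ x ∂(cubeMeasure d a b), ∀ j : Fin d,
        indicatorConstLp 2 (hs j) (measure_ne_top (intervalMeasure a b) _) (1 : 𝕜) (x j)
          = (s j).indicator (fun _ => (1 : 𝕜)) (x j) :=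
      ae_all_iff.mpr fun j => (quasiMeasurePreserving_eval_cube j).ae indicatorConstLp_coeFn
    filter_upwards [hall, coeFn_tens fun j => indicatorConstLp 2 (hs j)
      (measure_ne_top (intervalMeasure a b) _) (1 : 𝕜)] with x h1 h2
    rw [h2, RCLike.inner_apply]
    simp only [h1]
    by_cases hx : x ∈ Set.pi Set.univ s
    · rw [Set.indicator_of_mem hx, Finset.prod_eq_one, map_one, mul_one]
      exact fun j _ => Set.indicator_of_mem (hx j (Set.mem_univ j)) _
    · rw [Set.indicator_of_notMem hx]
      simp only [Set.mem_pi, Set.mem_univ, true_implies, not_forall] at hx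
      obtain ⟨j, hj⟩ := hx
      rw [Finset.prod_eq_zero (Finset.mem_univ j) (Set.indicator_of_notMem hj _), map_zero, mul_zero]
  have hall : ∀ s : Set (Fin d → ℝ), MeasurableSet s →
      ∫ x in s, F x ∂(cubeMeasure d a b) = 0 := by
    refine MeasurableSpace.induction_on_inter
      (C := fun s _ => ∫ x in s, F x ∂(cubeMeasure d a b) = 0) generateFrom_pi.symm isPiSystem_pi
      (by simp) ?_ ?_ ?_
    · rintro _ ⟨s, hs, rfl⟩
      exact hbox s fun j => hs j (Set.mem_univ j)
    · intro t htm ih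
      have h1 := integral_add_compl htm hint
      have h2 := hbox (fun _ => Set.univ) fun _ => MeasurableSet.univ
      rw [Set.pi_univ, setIntegral_univ] at h2
      rwa [ih, zero_add, h2] at h1
    · intro f hd hf ih
      rw [integral_iUnion hf hd hint.integrableOn]
      simp [ih]
  rw [Lp.eq_zero_iff_ae_eq_zero]
  exact hint.ae_eq_zero_of_forall_setIntegral_eq_zero fun s hs _ => hall s hs

/-- The tensor product of an orthonormal basis. -/
theorem exists_tensBasis {I : Type*} (e : HilbertBasis I 𝕜 (L2Interval 𝕜 a b)) (d : ℕ) :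
    ∃ e' : HilbertBasis (Fin d → I) 𝕜 (L2Cube 𝕜 d a b), ∀ m, e' m = tens fun j => e (m j) := by
  have hon := (isTensorMap_tensMap (𝕜 := 𝕜) (d := d) (a := a) (b := b)).orthonormal e.orthonormal
  refine ⟨HilbertBasis.mkOfOrthogonalEqBot hon ?_, fun m => ?_⟩
  · rw [eq_bot_iff]
    intro F hF
    refine eq_zero_of_forall_inner_tens fun u => ?_
    refine isTensorMap_tensMap.inner_eq_zero_of_span (A := fun _ => Set.range e) ?_ (u := u) ?_
    · intro v hv
      choose m hm using hv
      have := (Submodule.mem_orthogonal _ _).mp hF _ (Submodule.subset_span ⟨m, rfl⟩)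
      simpa only [hm] using this
    · intro i
      rw [e.dense_span]
      trivial
  · rw [HilbertBasis.coe_mkOfOrthogonalEqBot]
    rfl

/-! ### Tensor products of families of derivatives -/

/-- The tensor product of families of functions on the interval. -/
def jetTens (g : Fin d → IntervalJet 𝕜 r a b) : JetSpace 𝕜 d r a b :=
  WithLp.toLp 2 fun α => tens fun j => g j (α j)

/-- The tensor product of families of functions as a multilinear map. -/
def jetTensMap (𝕜 : Type u) [RCLike 𝕜] (d r : ℕ) (a b : ℝ) :
    MultilinearMap 𝕜 (fun _ : Fin d => IntervalJet 𝕜 r a b) (JetSpace 𝕜 d r a b) where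
  toFun := jetTens
  map_update_add' g i p q := by
    ext1 α
    simp only [jetTens, PiLp.add_apply]
    simp only [Function.apply_update (fun j (f : IntervalJet 𝕜 r a b) => f (α j))]
    exact (tensMap 𝕜 d a b).map_update_add _ i _ _
  map_update_smul' g i c p := by
    ext1 α
    simp only [jetTens, PiLp.smul_apply]
    simp only [Function.apply_update (fun j (f : IntervalJet 𝕜 r a b) => f (α j))]
    exact (tensMap 𝕜 d a b).map_update_smul _ i _ _

/-- The index set `{0,…,r}^d` is a full product, so the sum over `α` of products factors into a
product of univariate sums. -/
theorem isTensorMap_jetTensMap : IsTensorMap (jetTensMap 𝕜 d r a b) := by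
  intro g h
  change inner 𝕜 (jetTens g) (jetTens h) = _
  simp only [PiLp.inner_apply]
  rw [Finset.prod_univ_sum, Fintype.piFinset_univ]
  refine Finset.sum_congr rfl fun α _ => ?_
  exact isTensorMap_tensMap _ _

theorem jetTens_single (α : Fin d → Fin (r + 1)) (x : Fin d → L2Interval 𝕜 a b) :
    jetTens (fun j => PiLp.single 2 (α j) (x j)) = PiLp.single 2 α (tens x) := by
  ext1 β
  by_cases hβ : β = α
  · subst hβ
    simp [jetTens]
  · rw [PiLp.single_eq_of_ne 2 hβ]
    obtain ⟨j, hj⟩ := Function.ne_iff.mp hβ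
    simp only [jetTens]
    exact (tensMap 𝕜 d a b).map_coord_zero j (PiLp.single_eq_of_ne 2 hj _)

end Tens

/-! ## Elementary tensors and weak derivatives on the cube -/

theorem hasDerivAt_partialDeriv {d : ℕ} {φ : (Fin d → ℝ) → ℝ} (hφ : Differentiable ℝ φ)
    (i : Fin d) (x : Fin d → ℝ) (t : ℝ) :
    HasDerivAt (fun t => φ (Function.update x i t)) (partialDeriv i φ (Function.update x i t)) t :=
  (hφ _).hasFDerivAt.comp_hasDerivAt t (hasDerivAt_update x i t)

/-- The function `∏ ψ_j(x_j)`. -/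
def prodFun {d : ℕ} (ψ : Fin d → ℝ → ℝ) (x : Fin d → ℝ) : ℝ := ∏ j, ψ j (x j)

theorem prodFun_eq_mul {d : ℕ} (ψ : Fin d → ℝ → ℝ) (i : Fin d) (x : Fin d → ℝ) :
    prodFun ψ x = ψ i (x i) * ∏ j ∈ Finset.univ.erase i, ψ j (x j) :=
  (Finset.mul_prod_erase _ _ (Finset.mem_univ i)).symm

theorem contDiff_prodFun {d : ℕ} {ψ : Fin d → ℝ → ℝ} (hψ : ∀ j, ContDiff ℝ ∞ (ψ j)) :
    ContDiff ℝ ∞ (prodFun ψ) :=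
  contDiff_prod fun j _ => (hψ j).comp (contDiff_apply ℝ ℝ j)

theorem contDiff_iterate_deriv {ψ : ℝ → ℝ} (hψ : ContDiff ℝ ∞ ψ) (k : ℕ) :
    ContDiff ℝ ∞ (deriv^[k] ψ) := by
  induction k with
  | zero => exact hψ
  | succ k ih => rw [Function.iterate_succ_apply']; exact (contDiff_infty_iff_deriv.mp ih).2

theorem prodFun_update_update {d : ℕ} (ψ : Fin d → ℝ → ℝ) (i : Fin d) (η : ℝ → ℝ)
    (x : Fin d → ℝ) (t : ℝ) : prodFun (Function.update ψ i η) (Function.update x i t)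
      = η t * ∏ j ∈ Finset.univ.erase i, ψ j (x j) := by
  rw [prodFun_eq_mul _ i, Function.update_self, Function.update_self]
  congr 1
  refine Finset.prod_congr rfl fun j hj => ?_
  rw [Function.update_of_ne (Finset.ne_of_mem_erase hj),
    Function.update_of_ne (Finset.ne_of_mem_erase hj)]

theorem partialDeriv_prodFun {d : ℕ} {ψ : Fin d → ℝ → ℝ} (hψ : ∀ j, ContDiff ℝ ∞ (ψ j))
    (i : Fin d) : partialDeriv i (prodFun ψ) = prodFun (Function.update ψ i (deriv (ψ i))) := by
  funext x
  have h1 := hasDerivAt_partialDeriv ((contDiff_prodFun hψ).differentiable (by simp)) i x (x i)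
  have h2 : HasDerivAt (fun t => prodFun ψ (Function.update x i t))
      (prodFun (Function.update ψ i (deriv (ψ i))) (Function.update x i (x i))) (x i) := by
    have heq : (fun t => prodFun ψ (Function.update x i t))
        = fun t => ψ i t * ∏ j ∈ Finset.univ.erase i, ψ j (x j) := by
      funext t
      rw [← prodFun_update_update, Function.update_eq_self]
    rw [heq, prodFun_update_update]
    exact (((hψ i).differentiable (by simp)) _).hasDerivAt.mul_const _
  have := h1.unique h2
  rwa [Function.update_eq_self] at this

theorem iterate_partialDeriv_prodFun {d : ℕ} {ψ : Fin d → ℝ → ℝ}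
    (hψ : ∀ j, ContDiff ℝ ∞ (ψ j)) (i : Fin d) (k : ℕ) :
    (partialDeriv i)^[k] (prodFun ψ) = prodFun (Function.update ψ i (deriv^[k] (ψ i))) := by
  induction k with
  | zero => simp
  | succ k ih =>
    rw [Function.iterate_succ_apply', ih, partialDeriv_prodFun, Function.update_self,
      Function.update_idem, Function.iterate_succ_apply']
    intro j
    by_cases hj : j = i
    · subst hj; simpa using contDiff_iterate_deriv (hψ j) k
    · simpa [Function.update_of_ne hj] using hψ j

theorem multiDeriv_prodFun {d : ℕ} {ψ : Fin d → ℝ → ℝ} (hψ : ∀ j, ContDiff ℝ ∞ (ψ j))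
    (α : Fin d → ℕ) : multiDeriv α (prodFun ψ) = prodFun fun j => deriv^[α j] (ψ j) := by
  -- Without repetition in the list, each factor is differentiated in exactly one step of the fold.
  have key : ∀ l : List (Fin d), l.Nodup →
      l.foldr (fun i ψ => (partialDeriv i)^[α i] ψ) (prodFun ψ)
        = prodFun fun j => if j ∈ l then deriv^[α j] (ψ j) else ψ j := by
    intro l
    induction l with
    | nil => simp
    | cons i l ih =>
      intro hl
      rw [List.nodup_cons] at hl
      rw [List.foldr_cons, ih hl.2, iterate_partialDeriv_prodFun, if_neg hl.1]
      · congr 1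
        funext j
        by_cases hj : j = i
        · subst hj; simp
        · simp [hj]
      · intro j
        split_ifs
        · exact contDiff_iterate_deriv (hψ j) _
        · exact hψ j
  rw [multiDeriv, key _ (List.nodup_finRange d)]
  simp

section Cube

variable {𝕜 : Type u} [RCLike 𝕜] {d r : ℕ} {a b : ℝ}

theorem prodFun_mem_cubeTests {φ : Fin d → ℝ → ℝ} (hφ : ∀ j, φ j ∈ intervalTests a b) :
    prodFun φ ∈ cubeTests d a b := by
  have hsub : tsupport (prodFun φ) ⊆ Set.pi Set.univ fun j => tsupport (φ j) := by
    refine closure_minimal (fun x hx j _ => ?_) (isClosed_set_pi fun j _ => isClosed_tsupport _)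
    by_contra h
    exact hx (Finset.prod_eq_zero (Finset.mem_univ j) (image_eq_zero_of_notMem_tsupport h))
  refine ⟨contDiff_prodFun fun j => (hφ j).1, ?_, hsub.trans (Set.pi_mono fun j _ => (hφ j).2.2)⟩
  exact HasCompactSupport.of_support_subset_isCompact
    (isCompact_univ_pi fun j => (hφ j).2.1.isCompact) (subset_closure.trans hsub)

theorem coeFn_tens_contL2 {φ : Fin d → ℝ → ℝ} (hφ : ∀ j, Continuous (φ j)) :
    tens (fun j => contL2 𝕜 a b (φ j) (hφ j))
      =ᵐ[cubeMeasure d a b] fun x => ((prodFun φ x : ℝ) : 𝕜) := by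
  have hall : ∀ᵐ x ∂(cubeMeasure d a b), ∀ j : Fin d,
      contL2 𝕜 a b (φ j) (hφ j) (x j) = (φ j (x j) : 𝕜) :=
    ae_all_iff.mpr fun j => (quasiMeasurePreserving_eval_cube j).ae (coeFn_contL2 (hφ j))
  filter_upwards [coeFn_tens fun j => contL2 𝕜 a b (φ j) (hφ j), hall] with x h1 h2
  rw [h1, prodFun, RCLike.ofReal_prod]
  exact Finset.prod_congr rfl fun j _ => h2 j

theorem inner_tens_contL2 {φ : Fin d → ℝ → ℝ} (hφ : ∀ j, Continuous (φ j))
    (G : L2Cube 𝕜 d a b) : inner 𝕜 (tens fun j => contL2 𝕜 a b (φ j) (hφ j)) G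
      = ∫ x, prodFun φ x • G x ∂(cubeMeasure d a b) := by
  rw [L2.inner_def]
  refine integral_congr_ae ?_
  filter_upwards [coeFn_tens_contL2 (𝕜 := 𝕜) hφ] with x hx
  rw [hx, RCLike.inner_apply, RCLike.conj_ofReal, mul_comm, RCLike.real_smul_eq_coe_mul]

/-- It supplies generators for the slots that carry no orthogonality condition: test functions in a
single component are total. -/
theorem span_single_contL2 : (Submodule.span 𝕜 {g : IntervalJet 𝕜 r a b |
    ∃ (l : Fin (r + 1)) (φ : intervalTests a b),
      g = PiLp.single 2 l (contL2 𝕜 a b φ φ.2.1.continuous)}).topologicalClosure = ⊤ := by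
  rw [Submodule.topologicalClosure_eq_top_iff, eq_bot_iff]
  intro f hf
  rw [Submodule.mem_orthogonal] at hf
  rw [Submodule.mem_bot]
  ext1 l
  rw [PiLp.zero_apply, Lp.eq_zero_iff_ae_eq_zero]
  refine ae_eq_zero_of_forall_intervalTests (integrable_L2Interval _) fun φ hφ => ?_
  have := hf _ (Submodule.subset_span ⟨l, ⟨φ, hφ⟩, rfl⟩)
  rwa [inner_piLp_single_left, inner_contL2] at this

/-- The two terms of `testJet` in slot `i` give product test functions: one for `α`, and one for `α`
with entry `i` set to zero and `φ i` already differentiated. Their multi-derivatives coincide, so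
the two weak derivative identities for `F` have the same left-hand side and cancel up to the sign
`(-1) ^ α i`. -/
theorem inner_jetTens_testJet {F : JetSpace 𝕜 d r a b} (hF : F ∈ mixedSobolev 𝕜 d r a b)
    (φ : Fin d → intervalTests a b) (α : Fin d → Fin (r + 1)) (i : Fin d) :
    inner 𝕜 (jetTens (Function.update
      (fun j => PiLp.single 2 (α j) (contL2 𝕜 a b (φ j) (φ j).2.1.continuous)) i
      (testJet 𝕜 r a b (α i) (φ i)))) F = 0 := by
  set φ' : Fin d → intervalTests a b := Function.update φ i
    ⟨deriv^[(α i : ℕ)] (φ i), iterate_deriv_mem_intervalTests (φ i).2 _⟩ with hφ'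
  have h1 : jetTens (Function.update
      (fun j => PiLp.single 2 (α j) (contL2 𝕜 a b (φ j) (φ j).2.1.continuous)) i
      (testJet 𝕜 r a b (α i) (φ i)))
      = (-1 : 𝕜) ^ (α i : ℕ) •
          PiLp.single 2 α (tens fun j => contL2 𝕜 a b (φ j) (φ j).2.1.continuous)
        - PiLp.single 2 (Function.update α i 0)
          (tens fun j => contL2 𝕜 a b (φ' j) (φ' j).2.1.continuous) := by
    rw [← jetTens_single, ← jetTens_single, testJet]
    change jetTensMap 𝕜 d r a b _ = _ • jetTensMap 𝕜 d r a b _ - jetTensMap 𝕜 d r a b _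
    rw [MultilinearMap.map_update_sub, MultilinearMap.map_update_smul]
    congr 3
    · exact Function.update_eq_self i _
    · funext j
      by_cases hj : j = i
      · subst hj; simp [hφ']
      · simp [hφ', Function.update_of_ne hj]
  have h2 : multiDeriv (fun j => (α j : ℕ)) (prodFun fun j => φ j)
      = multiDeriv (fun j => ((Function.update α i 0 : Fin d → Fin (r + 1)) j : ℕ))
        (prodFun fun j => φ' j) := by
    rw [multiDeriv_prodFun fun j => (φ j).2.1, multiDeriv_prodFun fun j => (φ' j).2.1]
    congr 1
    funext j
    by_cases hj : j = i
    · subst hj; simp [hφ']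
    · simp [hφ', Function.update_of_ne hj]
  have h3 : ∑ j, (α j : ℕ)
      = ∑ j, ((Function.update α i 0 : Fin d → Fin (r + 1)) j : ℕ) + (α i : ℕ) := by
    simp only [Function.apply_update (fun _ (y : Fin (r + 1)) => (y : ℕ)),
      Finset.sum_update_of_mem (Finset.mem_univ i), Fin.val_zero, zero_add]
    rw [Finset.sdiff_singleton_eq_erase]
    exact (Finset.sum_erase_add _ (fun j => (α j : ℕ)) (Finset.mem_univ i)).symm
  have h4 := hF α _ (prodFun_mem_cubeTests fun j => (φ j).2)
  have h5 := hF (Function.update α i 0) _ (prodFun_mem_cubeTests fun j => (φ' j).2)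
  rw [h2, h5, h3, pow_add, mul_smul] at h4
  have h6 := smul_right_injective 𝕜 (pow_ne_zero _ (neg_ne_zero.mpr one_ne_zero) :
    (-1 : ℝ) ^ (∑ j, ((Function.update α i 0 : Fin d → Fin (r + 1)) j : ℕ)) ≠ 0) h4
  rw [h1, inner_sub_left, inner_smul_left, inner_piLp_single_left, inner_piLp_single_left,
    inner_tens_contL2 (φ := fun j => φ j), inner_tens_contL2 (φ := fun j => φ' j), h6,
    RCLike.real_smul_eq_coe_mul]
  simp

/-- Elementary tensors with a factor orthogonal to the univariate Sobolev space are orthogonal to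
the space of mixed smoothness. -/
theorem inner_jetTens_eq_zero {F : JetSpace 𝕜 d r a b} (hF : F ∈ mixedSobolev 𝕜 d r a b)
    (g : Fin d → IntervalJet 𝕜 r a b) (i : Fin d) (hg : g i ∈ (intervalSobolev 𝕜 r a b)ᗮ) :
    inner 𝕜 (jetTens g) F = 0 := by
  -- Slot `i` is generated by the `testJet`s, whose closed span is the complement of the Sobolev
  -- space; the other slots by single test functions.
  refine isTensorMap_jetTensMap.inner_eq_zero_of_span
    (A := Function.update (fun _ => {g : IntervalJet 𝕜 r a b |
      ∃ (l : Fin (r + 1)) (φ : intervalTests a b),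
        g = PiLp.single 2 l (contL2 𝕜 a b φ φ.2.1.continuous)}) i
      {g | ∃ l φ, g = testJet 𝕜 r a b l φ}) (fun u hu => ?_) fun j => ?_
  · have hex : ∀ j, ∃ (l : Fin (r + 1)) (φ : intervalTests a b),
        u j = Function.update (fun _ : Fin d =>
          PiLp.single 2 l (contL2 𝕜 a b φ φ.2.1.continuous)) i (testJet 𝕜 r a b l φ) j := by
      intro j
      have := hu j
      by_cases hj : j = i
      · subst hj; simpa using this
      · simpa [Function.update_of_ne hj] using this
    choose α φ h using hex
    rw [← inner_jetTens_testJet hF φ α i]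
    change _ = inner 𝕜 (jetTensMap 𝕜 d r a b _) F
    congr 2
    funext j
    rw [h]
    by_cases hj : j = i
    · subst hj; simp
    · simp [Function.update_of_ne hj]
  · by_cases hj : j = i
    · subst hj
      rw [Function.update_self, ← Submodule.orthogonal_orthogonal_eq_closure]
      exact hg
    · rw [Function.update_of_ne hj, span_single_contL2]
      trivial

/-- Modulo the complement of the univariate space every factor `h j` may be replaced by `w j • e j`
placed in component zero, so only `F 0` is seen. This makes the tensor product system diagonal on
all of `mixedSobolev`. -/
theorem inner_jetTens_eq {F : JetSpace 𝕜 d r a b} (hF : F ∈ mixedSobolev 𝕜 d r a b)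
    {h : Fin d → IntervalJet 𝕜 r a b} {e : Fin d → L2Interval 𝕜 a b} {w : Fin d → ℝ}
    (hh : ∀ j, h j - PiLp.single 2 0 ((w j : 𝕜) • e j) ∈ (intervalSobolev 𝕜 r a b)ᗮ) :
    inner 𝕜 (jetTens h) F = ((∏ j, w j : ℝ) : 𝕜) * inner 𝕜 (tens e) (F 0) := by
  have h1 : inner 𝕜 (jetTensMap 𝕜 d r a b h) F
      = inner 𝕜 (jetTensMap 𝕜 d r a b fun j => PiLp.single 2 0 ((w j : 𝕜) • e j)) F :=
    inner_eq_inner_of_sub_mem (fun u i hu => inner_jetTens_eq_zero hF u i hu) hh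
  have h2 : jetTensMap 𝕜 d r a b (fun j => PiLp.single 2 0 ((w j : 𝕜) • e j))
      = PiLp.single 2 0 ((∏ j, (w j : 𝕜)) • tens e) := by
    refine (jetTens_single (fun _ => 0) _).trans ?_
    congr 1
    exact (tensMap 𝕜 d a b).map_smul_univ (fun j => (w j : 𝕜)) e
  change inner 𝕜 (jetTensMap 𝕜 d r a b h) F = _
  rw [h1, h2, inner_piLp_single_left, inner_smul_left, map_prod, RCLike.ofReal_prod]
  simp only [RCLike.conj_ofReal]

end Cube

/-! ## Trigonometric functions in the periodic Sobolev space -/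

/-- The divergence theorem for the field whose only nonzero component is `F` in direction `i`; the
integrals over the two opposite faces cancel. -/
theorem integral_partialDeriv_eq_zero {d : ℕ} {a b : ℝ} (hab : a ≤ b) (i : Fin d)
    {F : (Fin d → ℝ) → ℝ} (hF : ContDiff ℝ ∞ F)
    (hper : ∀ x, F (Function.update x i b) = F (Function.update x i a)) :
    ∫ x, partialDeriv i F x ∂(cubeMeasure d a b) = 0 := by
  cases d with
  | zero => exact i.elim0
  | succ n =>
    have hsum : ∀ x, ∑ j, (if j = i then fderiv ℝ F x else 0) (Pi.single j (1 : ℝ))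
        = partialDeriv i F x := by
      intro x
      rw [Finset.sum_eq_single i (fun j _ hj => by rw [if_neg hj]; rfl) (by simp), if_pos rfl]
      rfl
    have h := integral_divergence_of_hasFDerivAt_off_countable' (fun _ : Fin (n + 1) => a)
      (fun _ => b) (fun _ => hab) (fun j => if j = i then F else fun _ => 0)
      (fun j x => if j = i then fderiv ℝ F x else 0) ∅ Set.countable_empty
      (fun j => by
        split_ifs
        · exact hF.continuous.continuousOn
        · exact continuousOn_const)
      (fun x _ j => by
        split_ifs
        · exact (hF.differentiable (by simp) x).hasFDerivAt
        · exact hasFDerivAt_const _ _)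
      (by
        simp only [hsum]
        exact (contDiff_partialDeriv i hF).continuous.continuousOn.integrableOn_compact
          isCompact_Icc)
    simp only [hsum] at h
    rw [cubeMeasure, cube, h]
    refine Finset.sum_eq_zero fun j _ => ?_
    split_ifs with hj
    · subst hj
      rw [sub_eq_zero]
      congr 1
      funext x
      have := hper (j.insertNth a x)
      rwa [Fin.update_insertNth, Fin.update_insertNth] at this
    · simp

theorem partialDeriv_mul {d : ℕ} (i : Fin d) {f g : (Fin d → ℝ) → ℝ} (hf : Differentiable ℝ f)
    (hg : Differentiable ℝ g) : partialDeriv i (fun x => f x * g x)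
      = fun x => partialDeriv i f x * g x + f x * partialDeriv i g x := by
  funext x
  simp only [partialDeriv]
  rw [fderiv_fun_mul (hf x) (hg x)]
  simp
  ring

theorem integral_partialDeriv_mul {d : ℕ} {a b : ℝ} (hab : a ≤ b) (i : Fin d)
    {f g : (Fin d → ℝ) → ℝ} (hf : ContDiff ℝ ∞ f) (hg : ContDiff ℝ ∞ g)
    (hfp : ∀ x, f (Function.update x i b) = f (Function.update x i a))
    (hgp : ∀ x, g (Function.update x i b) = g (Function.update x i a)) :
    ∫ x, partialDeriv i f x * g x ∂(cubeMeasure d a b)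
      = -∫ x, f x * partialDeriv i g x ∂(cubeMeasure d a b) := by
  have h := integral_partialDeriv_eq_zero hab i (hf.mul hg) fun x => by
    simp only [hfp, hgp]
  have hint : ∀ {u : (Fin d → ℝ) → ℝ}, Continuous u → Integrable u (cubeMeasure d a b) :=
    fun hu => hu.continuousOn.integrableOn_compact isCompact_Icc
  have h2 := integral_add (hint ((contDiff_partialDeriv i hf).continuous.mul hg.continuous))
    (hint (hf.continuous.mul (contDiff_partialDeriv i hg).continuous))
  rw [partialDeriv_mul i (hf.differentiable (by simp)) (hg.differentiable (by simp))] at h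
  exact eq_neg_of_add_eq_zero_left (h2.symm.trans h)

/-- A class of test functions that is invariant under differentiation and whose members take the
same values on opposite faces of the cube. -/
structure IsFacePeriodic {d : ℕ} (a b : ℝ) (T : Set ((Fin d → ℝ) → ℝ)) : Prop where
  contDiff : ∀ φ ∈ T, ContDiff ℝ ∞ φ
  partialDeriv_mem : ∀ φ ∈ T, ∀ i, partialDeriv i φ ∈ T
  update_eq : ∀ φ ∈ T, ∀ (i : Fin d) (x : Fin d → ℝ),
    φ (Function.update x i b) = φ (Function.update x i a)

theorem isFacePeriodic_cubeTests (d : ℕ) (a b : ℝ) : IsFacePeriodic a b (cubeTests d a b) where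
  contDiff _ h := h.1
  partialDeriv_mem φ h i := ⟨contDiff_partialDeriv i h.1, h.2.1.fderiv_apply (𝕜 := ℝ) _,
    (tsupport_fderiv_apply_subset ℝ _).trans h.2.2⟩
  update_eq φ h i x := by
    have hz : ∀ t, t ∉ Set.Ioo a b → φ (Function.update x i t) = 0 := fun t ht =>
      image_eq_zero_of_notMem_tsupport fun hx => ht (by simpa using h.2.2 hx i (Set.mem_univ i))
    rw [hz a (by simp), hz b (by simp)]

theorem isFacePeriodic_torusTests (d : ℕ) (a b : ℝ) : IsFacePeriodic a b (torusTests d a b) where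
  contDiff _ h := h.1
  partialDeriv_mem φ h i := by
    refine ⟨contDiff_partialDeriv i h.1, fun x j => ?_⟩
    unfold partialDeriv
    rw [← fderiv_comp_add_right]
    congr 2
    funext y
    exact h.2 y j
  update_eq φ h i x := by
    rw [← h.2 (Function.update x i a) i]
    congr 1
    funext j
    by_cases hj : j = i
    · subst hj; simp
    · simp [hj]

section Periodic

variable {𝕜 : Type u} [RCLike 𝕜] {d r : ℕ} {a b : ℝ}

theorem IsFacePeriodic.iterate_mem {T : Set ((Fin d → ℝ) → ℝ)} (hT : IsFacePeriodic a b T)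
    {φ : (Fin d → ℝ) → ℝ} (hφ : φ ∈ T) (i : Fin d) (k : ℕ) : (partialDeriv i)^[k] φ ∈ T := by
  induction k with
  | zero => exact hφ
  | succ k ih => rw [Function.iterate_succ_apply']; exact hT.partialDeriv_mem _ ih i

theorem deriv_periodic {ψ : ℝ → ℝ} {c : ℝ} (h : Function.Periodic ψ c) :
    Function.Periodic (deriv ψ) c := by
  intro x
  rw [← deriv_comp_add_const]
  congr 1
  funext y
  exact h y

theorem iterate_deriv_periodic {ψ : ℝ → ℝ} {c : ℝ} (h : Function.Periodic ψ c) (k : ℕ) :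
    Function.Periodic (deriv^[k] ψ) c := by
  induction k with
  | zero => exact h
  | succ k ih => rw [Function.iterate_succ_apply']; exact deriv_periodic ih

theorem prodFun_mem_torusTests {ψ : Fin d → ℝ → ℝ} (hψ : ∀ j, ContDiff ℝ ∞ (ψ j))
    (hper : ∀ j, Function.Periodic (ψ j) (b - a)) : prodFun ψ ∈ torusTests d a b := by
  refine ⟨contDiff_prodFun hψ, fun x i => Finset.prod_congr rfl fun j _ => ?_⟩
  by_cases hj : j = i
  · subst hj; simpa using hper j (x j)
  · simp [hj]

theorem IsFacePeriodic.integral_iterate_mul (hab : a ≤ b) {T : Set ((Fin d → ℝ) → ℝ)}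
    (hT : IsFacePeriodic a b T) {φ : (Fin d → ℝ) → ℝ} (hφ : φ ∈ T) {ψ : (Fin d → ℝ) → ℝ}
    (hψ : ψ ∈ torusTests d a b) (i : Fin d) (k : ℕ) :
    ∫ x, (partialDeriv i)^[k] φ x * ψ x ∂(cubeMeasure d a b)
      = (-1) ^ k * ∫ x, φ x * (partialDeriv i)^[k] ψ x ∂(cubeMeasure d a b) := by
  have hP := isFacePeriodic_torusTests d a b
  induction k generalizing ψ with
  | zero => simp
  | succ k ih =>
    have h := hT.iterate_mem hφ i k
    rw [Function.iterate_succ_apply', integral_partialDeriv_mul hab i (hT.contDiff _ h) hψ.1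
      (hT.update_eq _ h i) (hP.update_eq _ hψ i), ih (hP.partialDeriv_mem _ hψ i),
      Function.iterate_succ_apply, pow_succ]
    ring

theorem IsFacePeriodic.integral_multiDeriv_mul (hab : a ≤ b) {T : Set ((Fin d → ℝ) → ℝ)}
    (hT : IsFacePeriodic a b T) {φ : (Fin d → ℝ) → ℝ} (hφ : φ ∈ T) {ψ : Fin d → ℝ → ℝ}
    (hψ : ∀ j, ContDiff ℝ ∞ (ψ j)) (hper : ∀ j, Function.Periodic (ψ j) (b - a))
    (α : Fin d → ℕ) :
    ∫ x, multiDeriv α φ x * prodFun ψ x ∂(cubeMeasure d a b)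
      = (-1) ^ (∑ j, α j) * ∫ x, φ x * prodFun (fun j => deriv^[α j] (ψ j)) x
        ∂(cubeMeasure d a b) := by
  have hmem : ∀ l : List (Fin d), l.foldr (fun i ψ => (partialDeriv i)^[α i] ψ) φ ∈ T := by
    intro l
    induction l with
    | nil => exact hφ
    | cons i l ih => exact hT.iterate_mem ih i _
  have key : ∀ l : List (Fin d), l.Nodup → ∀ ψ : Fin d → ℝ → ℝ, (∀ j, ContDiff ℝ ∞ (ψ j)) →
      (∀ j, Function.Periodic (ψ j) (b - a)) →
      ∫ x, l.foldr (fun i ψ => (partialDeriv i)^[α i] ψ) φ x * prodFun ψ x ∂(cubeMeasure d a b)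
        = (-1) ^ (l.map α).sum *
          ∫ x, φ x * prodFun (fun j => if j ∈ l then deriv^[α j] (ψ j) else ψ j) x
            ∂(cubeMeasure d a b) := by
    intro l
    induction l with
    | nil => simp
    | cons i l ih =>
      intro hl ψ hψ hper
      rw [List.nodup_cons] at hl
      rw [List.foldr_cons, hT.integral_iterate_mul hab (hmem l) (prodFun_mem_torusTests hψ hper),
        iterate_partialDeriv_prodFun hψ, ih hl.2, List.map_cons, List.sum_cons, pow_add, mul_assoc]
      · congr 3
        funext x
        congr 2
        funext j
        by_cases hj : j = i
        · subst hj; simp [hl.1]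
        · simp [hj]
      · intro j
        by_cases hj : j = i
        · subst hj; simpa using contDiff_iterate_deriv (hψ j) _
        · simpa [Function.update_of_ne hj] using hψ j
      · intro j
        by_cases hj : j = i
        · subst hj; simpa using iterate_deriv_periodic (hper j) _
        · simpa [Function.update_of_ne hj] using hper j
  rw [multiDeriv, key _ (List.nodup_finRange d) ψ hψ hper, ← List.ofFn_eq_map, List.sum_ofFn]
  simp

theorem iterate_deriv_trigFun (k : ℤ) (l : ℕ) :
    deriv^[l] (trigFun a b k 0) = fun x => trigFreq a b k ^ l * trigFun a b k l x := by
  induction l with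
  | zero => simp
  | succ l ih =>
    rw [Function.iterate_succ_apply', ih]
    funext x
    rw [deriv_const_mul_field, deriv_trigFun]
    ring

theorem coeFn_jetTens_trigJet (m : Fin d → ℤ) (α : Fin d → Fin (r + 1)) :
    jetTens (fun j => trigJet 𝕜 r a b (m j)) α =ᵐ[cubeMeasure d a b]
      fun x => ((prodFun (fun j => deriv^[(α j : ℕ)] (trigFun a b (m j) 0)) x : ℝ) : 𝕜) := by
  have hcont : ∀ j, Continuous (deriv^[(α j : ℕ)] (trigFun a b (m j) 0)) := fun j =>
    (contDiff_iterate_deriv (contDiff_trigFun _ _) _).continuous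
  refine EventuallyEq.trans (Eq.eventuallyEq ?_) (coeFn_tens_contL2 hcont)
  change (⇑(tens fun j => trigJet 𝕜 r a b (m j) (α j)) : (Fin d → ℝ) → 𝕜) = _
  congr 2
  refine congrArg tens (funext fun j => Lp.ext ?_)
  filter_upwards [coeFn_contL2 (𝕜 := 𝕜) (a := a) (b := b) (hcont j),
    coeFn_contL2 (𝕜 := 𝕜) (a := a) (b := b)
      (contDiff_trigFun (a := a) (b := b) (m j) (α j)).continuous,
    Lp.coeFn_smul ((trigFreq a b (m j) ^ (α j : ℕ) : ℝ) : 𝕜) (trigL2 𝕜 a b (m j) (α j))]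
    with x h1 h2 h3
  rw [h1]
  refine h3.trans ?_
  rw [Pi.smul_apply, trigL2, h2, iterate_deriv_trigFun, smul_eq_mul, RCLike.ofReal_mul]

/-- `IsFacePeriodic` covers cube and torus test functions alike: against a periodic trigonometric
product the boundary terms cancel in both cases. -/
theorem isWeakDeriv_jetTens_trigJet (hab : a < b) {T : Set ((Fin d → ℝ) → ℝ)}
    (hT : IsFacePeriodic a b T) (m : Fin d → ℤ) (α : Fin d → Fin (r + 1)) :
    IsWeakDeriv T (fun j => (α j : ℕ)) (jetTens (fun j => trigJet 𝕜 r a b (m j)) 0)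
      (jetTens (fun j => trigJet 𝕜 r a b (m j)) α) := by
  have key : ∀ (β : Fin d → Fin (r + 1)) (φ : (Fin d → ℝ) → ℝ),
      ∫ x, φ x • jetTens (fun j => trigJet 𝕜 r a b (m j)) β x ∂(cubeMeasure d a b)
        = ((∫ x, φ x * prodFun (fun j => deriv^[(β j : ℕ)] (trigFun a b (m j) 0)) x
          ∂(cubeMeasure d a b) : ℝ) : 𝕜) := by
    intro β φ
    rw [← integral_ofReal]
    refine integral_congr_ae ?_
    filter_upwards [coeFn_jetTens_trigJet (𝕜 := 𝕜) (a := a) (b := b) m β] with x hx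
    rw [hx, RCLike.real_smul_eq_coe_mul, RCLike.ofReal_mul]
  intro φ hφ
  rw [key, key, RCLike.real_smul_eq_coe_mul, ← RCLike.ofReal_mul]
  congr 1
  exact hT.integral_multiDeriv_mul hab.le hφ (fun j => contDiff_trigFun (m j) 0)
    (fun j => trigFun_add_period hab (m j) 0) _

theorem jetTens_trigJet_mem (hab : a < b) (m : Fin d → ℤ) :
    jetTens (fun j => trigJet 𝕜 r a b (m j)) ∈ periodicMixedSobolev 𝕜 d r a b :=
  ⟨isWeakDeriv_jetTens_trigJet hab (isFacePeriodic_cubeTests d a b) m,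
    isWeakDeriv_jetTens_trigJet hab (isFacePeriodic_torusTests d a b) m⟩

end Periodic

/-! ## The minimal errors -/

section Errors

variable {𝕜 : Type u} [RCLike 𝕜] {d r : ℕ} {a b : ℝ}

/-- The evaluation `f ↦ f` into `L²` on a space of functions represented by families of
derivatives. -/
def evalL2 (V : Submodule 𝕜 (JetSpace 𝕜 d r a b)) : V →L[𝕜] L2Cube 𝕜 d a b :=
  (PiLp.proj 2 (fun _ : Fin d → Fin (r + 1) => L2Cube 𝕜 d a b) 0).comp V.subtypeL

/-- The zero algorithm has error at most one. Finiteness is needed because `toReal` sends `⊤` to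
zero, which would spoil lower bounds. -/
theorem minimalError_ne_top (V : Submodule 𝕜 (JetSpace 𝕜 d r a b)) {n : ℕ} (hn : 1 ≤ n) :
    (L2Approximation V).minimalError n ≠ ⊤ := by
  have h := minimalError_le (𝕜 := 𝕜) (fun f : V => evalL2 V f) (F := (∅ : Finset ℕ)) (n := n)
    (by simp) hn (fun _ => 0) (fun _ => 0) (τ := 1) fun f hf => by
      rw [Finset.sum_empty, sub_zero]
      exact (PiLp.norm_apply_le (f : JetSpace 𝕜 d r a b) 0).trans hf
  exact ne_top_of_le_ne_top ENNReal.ofReal_ne_top h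

/-- The singular values of the univariate embedding determine an upper bound for the minimal
errors. -/
theorem exists_minimalError_le (𝕜 : Type u) [RCLike 𝕜] (d : ℕ) (hr : 1 ≤ r) (hab : a < b) :
    ∃ (I : Type u) (ν : I → ℝ) (hfin : ∀ s, {i | ν i ≤ s}.Finite), (∀ i, 1 ≤ ν i) ∧
      (∀ v, 1 ≤ v → ((hfin v).toFinset.card : ℝ) ≤ (b - a) / Real.pi * v + (r + 1)) ∧
      ∀ V ≤ mixedSobolev 𝕜 d r a b, ∀ s : ℝ, 0 < s → ∀ n : ℕ, 1 ≤ n → prodCount ν d s ≤ n →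
        (L2Approximation V).minimalError n ≤ ENNReal.ofReal (s ^ r)⁻¹ := by
  obtain ⟨I, e, h, w, hh, hw, hhe, hcard⟩ := exists_interval_singular_system 𝕜 hr hab
  have hba : 0 < b - a := by linarith
  have hπ := Real.pi_pos
  -- Taking `r`-th roots turns the thresholds into products of `ν` compared with `s`, the setting of
  -- `prodCount`.
  set ν : I → ℝ := fun i => w i ^ ((r : ℝ)⁻¹) with hνdef
  have hνpow : ∀ i, ν i ^ r = w i := fun i =>
    Real.rpow_inv_natCast_pow (zero_le_one.trans (hw i)) (by omega)
  have hν : ∀ i, 1 ≤ ν i := fun i => Real.one_le_rpow (hw i) (by positivity)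
  -- The choice `M = ⌊v (b - a) / (2π)⌋` guarantees `v < 2π (M + 1) / (b - a)`. The bound for
  -- arbitrary finite sets also yields finiteness of the level sets.
  have hbound : ∀ (v : ℝ) (F : Finset I), (∀ i ∈ F, ν i ≤ v) →
      F.card ≤ r + 2 * ⌊v * (b - a) / (2 * Real.pi)⌋₊ + 1 := by
    intro v F hF
    refine hcard _ F fun i hi => ?_
    rw [← hνpow i]
    refine pow_lt_pow_left₀ ((hF i hi).trans_lt ?_) (zero_le_one.trans (hν i)) (by omega)
    have := Nat.lt_floor_add_one (v * (b - a) / (2 * Real.pi))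
    rw [div_lt_iff₀ (by positivity)] at this
    rw [lt_div_iff₀ hba]
    linarith
  have hfin : ∀ s, {i | ν i ≤ s}.Finite := by
    intro s
    by_contra hinf
    obtain ⟨F, hF, hFc⟩ := Set.Infinite.exists_subset_card_eq hinf
      (r + 2 * ⌊s * (b - a) / (2 * Real.pi)⌋₊ + 2)
    have := hbound s F fun i hi => hF hi
    omega
  refine ⟨I, ν, hfin, hν, fun v hv => ?_, fun V hV s hs n hn hcount => ?_⟩
  · have h1 := hbound v (hfin v).toFinset fun i hi => by simpa using hi
    have h2 := Nat.floor_le (show 0 ≤ v * (b - a) / (2 * Real.pi) by positivity)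
    have h3 : ((hfin v).toFinset.card : ℝ) ≤ r + 2 * ⌊v * (b - a) / (2 * Real.pi)⌋₊ + 1 := by
      exact_mod_cast h1
    have h4 : 2 * (v * (b - a) / (2 * Real.pi)) = (b - a) / Real.pi * v := by field_simp
    linarith
  · obtain ⟨e', he'⟩ := exists_tensBasis e d
    have hfinite := finite_prod_le hν hfin d s
    have hcard' : hfinite.toFinset.card ≤ n := by
      rwa [prodCount, Set.ncard_eq_toFinset_card _ hfinite] at hcount
    refine minimalError_le (𝕜 := 𝕜) (fun f : V => evalL2 V f) hcard' hn
      (fun m => (innerSL 𝕜 (e' m)).comp (evalL2 V)) e' fun f hf => ?_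
    -- Orthonormality in the full jet space is enough; the tensors of the `h i` need not belong to
    -- `V`.
    have hon := (isTensorMap_jetTensMap (𝕜 := 𝕜) (d := d) (r := r) (a := a) (b := b)).orthonormal hh
    refine (norm_sub_sum_inner_le e' hon (w := fun m => ∏ j, w (m j))
      (f := (f : JetSpace 𝕜 d r a b)) (fun m => ?_) hfinite.toFinset (pow_pos hs r)
      fun m hm => ?_).trans ?_
    · rw [he']
      exact inner_jetTens_eq (hV f.2) fun j => hhe (m j)
    · simp only [Set.Finite.mem_toFinset, Set.mem_ofPred_eq, not_le] at hm
      simp only [← hνpow, Finset.prod_pow]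
      exact pow_le_pow_left₀ hs.le hm.le r
    · rw [← one_div]
      exact div_le_div_of_nonneg_right hf (pow_pos hs r).le

/-- The trigonometric functions determine a lower bound for the minimal errors. -/
theorem le_minimalError_of_periodic (hab : a < b) {V : Submodule 𝕜 (JetSpace 𝕜 d r a b)}
    (hV : periodicMixedSobolev 𝕜 d r a b ≤ V) {s : ℝ} (hs : 0 < s) {n : ℕ}
    (hn : n < prodCount (fun k => 1 + trigFreq a b k) d s) :
    ENNReal.ofReal (s ^ r)⁻¹ ≤ (L2Approximation V).minimalError n := by
  -- An infinite set has `ncard` zero, which `n < prodCount` excludes.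
  have hfinite : {m : Fin d → ℤ | ∏ j, (1 + trigFreq a b (m j)) ≤ s}.Finite :=
    Set.finite_of_ncard_ne_zero (by rw [prodCount] at hn; omega)
  rw [prodCount, Set.ncard_eq_toFinset_card _ hfinite] at hn
  have heval : ∀ m : Fin d → ℤ, jetTens (fun j => trigJet 𝕜 r a b (m j)) 0
      = tensMap 𝕜 d a b fun j => trigL2 𝕜 a b (m j) 0 := by
    intro m
    change tens _ = tens _
    congr 1
    funext j
    simp [trigJet]
  rw [← one_div]
  refine le_minimalError (evalL2 V).toLinearMap hn
    (v := fun m => ⟨jetTens fun j => trigJet 𝕜 r a b (m j), hV (jetTens_trigJet_mem hab m)⟩)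
    (fun m _ m' _ hne => ?_) (fun m _ m' _ hne => ?_) (fun m _ h0 => ?_) (pow_pos hs r)
    fun m hm => ?_
  · obtain ⟨j, hj⟩ := Function.ne_iff.mp hne
    refine (isTensorMap_jetTensMap _ _).trans ?_
    exact Finset.prod_eq_zero (Finset.mem_univ j) (inner_trigJet_of_ne hab hj)
  · obtain ⟨j, hj⟩ := Function.ne_iff.mp hne
    change inner 𝕜 (jetTens (fun j => trigJet 𝕜 r a b (m j)) 0)
      (jetTens (fun j => trigJet 𝕜 r a b (m' j)) 0) = 0
    rw [heval, heval, isTensorMap_tensMap]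
    exact Finset.prod_eq_zero (Finset.mem_univ j) (inner_trigL2_of_ne hab hj 0)
  · have h1 : ‖jetTensMap 𝕜 d r a b fun j => trigJet 𝕜 r a b (m j)‖ = 0 := by
      rw [norm_eq_zero]
      exact congrArg Subtype.val h0
    rw [isTensorMap_jetTensMap.norm_apply, Finset.prod_eq_zero_iff] at h1
    obtain ⟨j, _, hj⟩ := h1
    rw [norm_trigJet hab] at hj
    exact (mul_pos (zero_lt_one.trans_le (one_le_trigWeight _)) (norm_trigL2_pos hab _)).ne' hj
  · change ‖jetTensMap 𝕜 d r a b fun j => trigJet 𝕜 r a b (m j)‖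
      ≤ s ^ r * ‖jetTens (fun j => trigJet 𝕜 r a b (m j)) 0‖
    rw [heval, isTensorMap_jetTensMap.norm_apply, isTensorMap_tensMap.norm_apply]
    simp only [norm_trigJet hab, Finset.prod_mul_distrib]
    -- The ratio of the two norms is the product of the `trigWeight`s, at most the `r`-th power of
    -- `∏ (1 + trigFreq)`, hence at most `s ^ r`.
    refine mul_le_mul_of_nonneg_right ?_ (Finset.prod_nonneg fun _ _ => norm_nonneg _)
    refine (Finset.prod_le_prod (fun j _ => zero_le_one.trans (one_le_trigWeight _))
      fun j _ => trigWeight_le hab (m j)).trans ?_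
    rw [Finset.prod_pow]
    refine pow_le_pow_left₀ (Finset.prod_nonneg fun j _ => ?_) (by simpa using hm) r
    linarith [trigFreq_nonneg hab (m j)]

theorem setOf_trigFreq_le (hab : a < b) (v : ℝ) : {k : ℤ | 1 + trigFreq a b k ≤ v}
    = Set.Icc (-⌊(v - 1) * (b - a) / (2 * Real.pi)⌋) ⌊(v - 1) * (b - a) / (2 * Real.pi)⌋ := by
  have hba : 0 < b - a := by linarith
  have hπ := Real.pi_pos
  ext k
  rw [Set.mem_Icc, ← abs_le, Int.le_floor, le_div_iff₀ (by positivity), Set.mem_ofPred_eq,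
    trigFreq, ← le_sub_iff_add_le', div_le_iff₀ hba, mul_comm (2 * Real.pi)]

/-- The count is `2⌊x⌋ + 1`: a constant, and a sine and a cosine for each frequency. Its slope `(b -
a) / π` agrees with the one in `exists_minimalError_le`, which is why upper and lower bounds match.
-/
theorem card_trigFreq_le (hab : a < b) {v : ℝ} (hv : 1 ≤ v)
    (hfin : {k : ℤ | 1 + trigFreq a b k ≤ v}.Finite) :
    (hfin.toFinset.card : ℝ) ≤ (b - a) / Real.pi * v + ((b - a) / Real.pi + 1) ∧
    (b - a) / Real.pi * v - ((b - a) / Real.pi + 1) ≤ (hfin.toFinset.card : ℝ) := by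
  have hba : 0 < b - a := by linarith
  have hπ := Real.pi_pos
  set x := (v - 1) * (b - a) / (2 * Real.pi) with hx
  have hx0 : 0 ≤ x := div_nonneg (mul_nonneg (by linarith) hba.le) (by positivity)
  have hset : hfin.toFinset = Finset.Icc (-⌊x⌋) ⌊x⌋ := by
    ext k
    rw [Set.Finite.mem_toFinset, setOf_trigFreq_le hab, Finset.mem_Icc, Set.mem_Icc]
  have hfl : 0 ≤ ⌊x⌋ := Int.floor_nonneg.mpr hx0
  have hcard : (hfin.toFinset.card : ℝ) = 2 * ⌊x⌋ + 1 := by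
    have : (hfin.toFinset.card : ℤ) = 2 * ⌊x⌋ + 1 := by
      rw [hset, Int.card_Icc]
      omega
    exact_mod_cast this
  have h2x : 2 * x = (b - a) / Real.pi * v - (b - a) / Real.pi := by
    rw [hx]; field_simp
  have h1 := Int.floor_le x
  have h2 := Int.lt_floor_add_one x
  have h3 : 0 < (b - a) / Real.pi := by positivity
  rw [hcard]
  constructor <;> linarith

/-- The minimal errors for all spaces between the periodic and the nonperiodic Sobolev space of
mixed smoothness. -/
theorem isEquivalent_minimalError (hr : 1 ≤ r) (hab : a < b)
    {V : Submodule 𝕜 (JetSpace 𝕜 (d + 1) r a b)}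
    (hV : periodicMixedSobolev 𝕜 (d + 1) r a b ≤ V) (hV' : V ≤ mixedSobolev 𝕜 (d + 1) r a b) :
    Asymptotics.IsEquivalent atTop (fun n : ℕ => ((L2Approximation V).minimalError n).toReal)
      (fun n : ℕ => ((b - a) ^ (d + 1) / (Real.pi ^ (d + 1) * (d.factorial : ℝ))) ^ r
        * (n : ℝ) ^ (-(r : ℤ)) * Real.log (n : ℝ) ^ (r * d)) := by
  have hba : 0 < b - a := by linarith
  have hA : 0 < (b - a) / Real.pi := div_pos hba Real.pi_pos
  have hc : (b - a) ^ (d + 1) / (Real.pi ^ (d + 1) * (d.factorial : ℝ))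
      = ((b - a) / Real.pi) ^ (d + 1) / d.factorial := by
    rw [div_pow, div_div]
  rw [hc]
  refine isEquivalent_of_counting d r (by positivity) (fun ε hε => ?_) fun ε hε => ?_
  -- The upper bound uses only `V ≤ mixedSobolev`, the lower bound only that `V` contains the
  -- periodic space. In both, the lower order terms are absorbed into `ε * mulLogPow d s`.
  · obtain ⟨I, ν, hfin, hν, hN, herr⟩ := exists_minimalError_le 𝕜 (d + 1) hr hab
    obtain ⟨K, hK, hcount⟩ := prodCount_le hν hfin hA.le (by positivity) hN d
    filter_upwards [eventually_lowerOrder_le d K hK hε, eventually_ge_atTop 1] with s hs hs1 n hn hle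
    refine ENNReal.toReal_le_of_le_ofReal (by positivity) (herr V hV' s (by linarith) n hn ?_)
    have := hcount s hs1
    rw [add_mul] at hle
    exact_mod_cast (show (prodCount ν (d + 1) s : ℝ) ≤ n by linarith)
  · have hν : ∀ k : ℤ, 1 ≤ 1 + trigFreq a b k := fun k => by linarith [trigFreq_nonneg hab k]
    have hfin : ∀ s, {k : ℤ | 1 + trigFreq a b k ≤ s}.Finite := fun s => by
      rw [setOf_trigFreq_le hab]
      exact Set.finite_Icc _ _
    obtain ⟨K, hK, hcount⟩ := le_prodCount hν hfin hA.le (by positivity)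
      (fun v hv => (card_trigFreq_le hab hv (hfin v)).1)
      (fun v hv => (card_trigFreq_le hab hv (hfin v)).2) d
    filter_upwards [eventually_lowerOrder_le d K hK hε, eventually_ge_atTop 1] with s hs hs1 n hn hlt
    rw [← ENNReal.ofReal_le_iff_le_toReal (minimalError_ne_top V hn)]
    refine le_minimalError_of_periodic hab hV (by linarith) ?_
    have := hcount s hs1
    rw [sub_mul] at hlt
    exact_mod_cast (show (n : ℝ) < prodCount (fun k => 1 + trigFreq a b k) (d + 1) s by linarith)

end Errors

end IBC

end

theorem mainTheorem4 {𝕜 : Type*} [RCLike 𝕜] (d r : ℕ) (hd : 1 ≤ d) (hr : 1 ≤ r)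
    (a b : ℝ) (hab : a < b) :
    Asymptotics.IsEquivalent Filter.atTop
      (fun n : ℕ =>
        ((IBC.L2Approximation (IBC.mixedSobolev 𝕜 d r a b)).minimalError n).toReal)
      (fun n : ℕ =>
        ((b - a) ^ d / (Real.pi ^ d * (Nat.factorial (d - 1) : ℝ))) ^ r
          * (n : ℝ) ^ (-(r : ℤ)) * Real.log (n : ℝ) ^ (r * (d - 1))) ∧
    Asymptotics.IsEquivalent Filter.atTop
      (fun n : ℕ =>
        ((IBC.L2Approximation (IBC.mixedSobolev 𝕜 d r a b)).minimalError n).toReal)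
      (fun n : ℕ =>
        ((IBC.L2Approximation (IBC.periodicMixedSobolev 𝕜 d r a b)).minimalError n).toReal) := by
  obtain ⟨d, rfl⟩ : ∃ k, d = k + 1 := ⟨d - 1, by omega⟩
  have h := IBC.isEquivalent_minimalError (𝕜 := 𝕜) (V := IBC.mixedSobolev 𝕜 (d + 1) r a b) hr hab
    inf_le_left le_rfl
  exact ⟨h, h.trans (IBC.isEquivalent_minimalError hr hab le_rfl inf_le_left).symm⟩
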